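/- Let $\psi^{C_1\cdots C_mBR}$ be a pure state (a unit vector) of finite-dimensional systems, shared by $m$ senders $C_1,\dots,C_m$, a receiver $B$ and a purifying reference $R$, and let $K_i,L_i\ge 1$ be integers. Write $\Phi^{n}$ for the maximally entangled state of dimension $n$, $\tau$ for maximally mixed states, $\|X\|_1=\mathrm{Tr}\sqrt{X^\dagger X}$, and $d_X$ for the dimension of the system $X$. Besides $\psi$, sender $i$ shares the state $\Phi^{K_i}$ on $C_i^0B_i^0$ with the receiver; $\Phi^{K_M}=\bigotimes_i\Phi^{K_i}$ and $\Phi^{L_M}=\bigotimes_i\Phi^{L_i}$. If every sender $i$ applies an instrument $\mathcal I_i=\{\mathcal E^i_j\}_j$ with completely positive components $\mathcal E^i_j$ from $C_iC_i^0$ to a system $C_i^1$ of dimension $L_i$, then for each tuple of outcomes $J=(j_1,\dots,j_m)$ let $p_J$ be its probability and $\psi_J^{C^1_MR}$ the normalized reduced outcome state on $C^1_MR=C_1^1\cdots C_m^1R$. The decoupling error is $$Q_{\mathcal I}=\sum_J p_J\,\big\|\psi_J^{C^1_MR}-\tau^{C^1_M}\otimes\psi^R\big\|_1 .$$ A merging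 protocol with error $\varepsilon$ consists of such instruments together with channels (completely positive trace-preserving maps) $\mathcal D_J:BB^0_M\to B^1_MB_MB$ applied by the receiver after he has been told $J$, where $d_{B^1_i}=L_i$ and $B_M$ is a copy of $C_M=C_1\cdots C_m$, such that the resulting map $\Lambda=\sum_J(\mathrm{id}\otimes\mathcal D_J)\circ(\bigotimes_i\mathcal E^i_{j_i}\otimes\mathrm{id})$ satisfies $\|(\Lambda\otimes\mathrm{id}_R)(\psi\otimes\Phi^{K_M})-\psi^{B_MBR}\otimes\Phi^{L_M}\|_1\le\varepsilon$. Put $N_i=\lfloor d_{C_i}K_i/L_i\rfloor$ and $$\Delta=2\sum_{\emptyset\ne T\subseteq\{1,\dots,m\}}\ \prod_{i\in T}\frac{L_i}{d_{C_i}K_i}+2\sqrt{d_R\sum_{\emptyset\neq T\subseteq\{1,\dots,m\}}\Big(\prod_{i\in T}\frac{L_i}{K_i}\Big)\mathrm{Tr}\big[(\psi^{RT})^2\big]},$$ where $\psi^{RT}$ is the reduced state on $R$ and the systems $C_i$, $i\in T$. Call operators $Q^0,\dots,Q^{N_i}:C_iC_i^0\to C_i^1$ a partial-isometry measurement of sender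 $i$ if $Q^1,\dots,Q^{N_i}$ are partial isometries of rank $L_i$, $Q^0$ is a partial isometry of rank $d_{C_i}K_i-N_iL_i<L_i$, and $\sum_{j}(Q^j)^\dagger Q^j=I$. 1. For each $i$ let $Q_i^0,\dots,Q_i^{N_i}$ be any partial-isometry measurement of sender $i$, and let $U_1,\dots,U_m$ be independent Haar-random unitaries, $U_i$ acting on $C_iC_i^0$. For the instruments $\mathcal E^i_j(\rho)=(Q_i^jU_i)\rho(Q_i^jU_i)^\dagger$, the decoupling error is an integrable function of $(U_1,\dots,U_m)$ and its average is at most $\Delta$. 2. There exist partial-isometry measurements $A_i^0,\dots,A_i^{N_i}$ of the senders such that the instruments $\mathcal E^i_j(\rho)=A_i^j\rho (A_i^j)^\dagger$ have decoupling error at most $\Delta$, and such that these instruments, together with suitable decoding channels $\mathcal D_J$, form a merging protocol with error at most $2\sqrt{\Delta}$. -/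

import Mathlib

open MeasureTheory
open scoped Kronecker Matrix ComplexOrder

noncomputable section

/-! ### Finite-dimensional quantum systems

A system is a finite type `a`: its state space is `ℂ^a`, its operators are `Matrix a a ℂ`, and the
system composed of `a` and `b` (of all the `X i`) is `a × b` (is `∀ i, X i`). -/

/-- The pure state `|v⟩⟨v|`. -/
def pureState {a : Type*} (v : a → ℂ) : Matrix a a ℂ :=
  Matrix.vecMulVec v (star v)

/-- The maximally mixed state `τ = I / d`. -/
def maximallyMixed (a : Type*) [Fintype a] [DecidableEq a] : Matrix a a ℂ :=
  (Fintype.card a : ℂ)⁻¹ • 1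

/-- The amplitudes of the maximally entangled vector `|Φ^n⟩ = n^{-1/2} ∑ₖ |k⟩|k⟩`. -/
def maxEntangled (n : ℕ) (k l : Fin n) : ℂ :=
  if k = l then ((√(n : ℝ) : ℝ) : ℂ)⁻¹ else 0

/-- The trace norm `‖X‖₁ = Tr √(X† X)`. -/
def traceNorm {a : Type*} [Fintype a] [DecidableEq a] (X : Matrix a a ℂ) : ℝ :=
  (cfc Real.sqrt (Xᴴ * X)).trace.re

/-- The partial trace `Tr_b` over the second factor. -/
def partialTraceSnd {a b : Type*} [Fintype b] (M : Matrix (a × b) (a × b) ℂ) : Matrix a a ℂ :=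
  Matrix.of fun x x' => ∑ y, M (x, y) (x', y)

/-- The partial trace `Tr_a` over the first factor. -/
def partialTraceFst {a b : Type*} [Fintype a] (M : Matrix (a × b) (a × b) ℂ) : Matrix b b ℂ :=
  Matrix.of fun y y' => ∑ x, M (x, y) (x, y')

/-! ### Quantum operations -/

/-- A linear map from operators on the system `a` to operators on the system `b`. -/
abbrev SuperOp (a b : Type*) := Matrix a a ℂ →ₗ[ℂ] Matrix b b ℂ

/-- `E ⊗ id_s`. -/
def SuperOp.actFst {a b : Type*} (E : SuperOp a b) (s : Type*) : SuperOp (a × s) (b × s) where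
  toFun M := Matrix.of fun y y' => E (Matrix.of fun x x' => M (x, y.2) (x', y'.2)) y.1 y'.1
  map_add' M N := by
    ext y y'
    exact congrFun (congrFun (E.map_add (Matrix.of fun x x' => M (x, y.2) (x', y'.2))
      (Matrix.of fun x x' => N (x, y.2) (x', y'.2))) y.1) y'.1
  map_smul' c M := by
    ext y y'
    exact congrFun (congrFun (E.map_smul c (Matrix.of fun x x' => M (x, y.2) (x', y'.2))) y.1) y'.1

/-- `id_s ⊗ E`. -/
def SuperOp.actSnd {a b : Type*} (E : SuperOp a b) (s : Type*) : SuperOp (s × a) (s × b) where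
  toFun M := Matrix.of fun y y' => E (Matrix.of fun x x' => M (y.1, x) (y'.1, x')) y.2 y'.2
  map_add' M N := by
    ext y y'
    exact congrFun (congrFun (E.map_add (Matrix.of fun x x' => M (y.1, x) (y'.1, x'))
      (Matrix.of fun x x' => N (y.1, x) (y'.1, x'))) y.2) y'.2
  map_smul' c M := by
    ext y y'
    exact congrFun (congrFun (E.map_smul c (Matrix.of fun x x' => M (y.1, x) (y'.1, x'))) y.2) y'.2

/-- The tensor product `⨂ᵢ Eᵢ`: it sends the matrix unit `⨂ᵢ |xᵢ⟩⟨x'ᵢ|` to `⨂ᵢ Eᵢ(|xᵢ⟩⟨x'ᵢ|)`. -/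
def SuperOp.piTensor {ι : Type*} [Fintype ι] [DecidableEq ι] {X Y : ι → Type*}
    [∀ i, Fintype (X i)] [∀ i, DecidableEq (X i)] (E : ∀ i, SuperOp (X i) (Y i)) :
    SuperOp (∀ i, X i) (∀ i, Y i) where
  toFun M := Matrix.of fun y y' =>
    ∑ x, ∑ x', M x x' * ∏ i, E i (Matrix.single (x i) (x' i) 1) (y i) (y' i)
  map_add' M N := by
    ext y y'
    simp [add_mul, Finset.sum_add_distrib]
  map_smul' c M := by
    ext y y'
    simp [mul_assoc, Finset.mul_sum]

/-- The map `ρ ↦ A ρ A†` with the single Kraus operator `A`. -/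
def SuperOp.kraus {a b : Type*} [Fintype a] (A : Matrix b a ℂ) : SuperOp a b where
  toFun M := A * M * Aᴴ
  map_add' M N := by rw [Matrix.mul_add, Matrix.add_mul]
  map_smul' c M := by simp

/-- Complete positivity: `E ⊗ id` preserves positive semidefiniteness, for every finite-dimensional
ancilla. -/
def SuperOp.IsCP {a b : Type*} (E : SuperOp a b) : Prop :=
  ∀ (n : ℕ) (M : Matrix (a × Fin n) (a × Fin n) ℂ), M.PosSemidef →
    (E.actFst (Fin n) M).PosSemidef

/-- A quantum channel: a completely positive trace-preserving map. -/
def SuperOp.IsChannel {a b : Type*} [Fintype a] [Fintype b] (E : SuperOp a b) : Prop :=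
  E.IsCP ∧ ∀ M, (E M).trace = M.trace

/-- A quantum instrument: completely positive maps whose sum is trace-preserving. -/
def IsInstrument {J a b : Type*} [Fintype J] [Fintype a] [Fintype b] (E : J → SuperOp a b) : Prop :=
  (∀ j, (E j).IsCP) ∧ (∑ j, E j).IsChannel

/-! ### The states of multiparty merging

The senders hold `C i`, the receiver holds `B`, the purifying reference is `R`. -/

section Merging

variable {ι : Type*} [Fintype ι] [DecidableEq ι] {C : ι → Type*} [∀ i, Fintype (C i)]
  [∀ i, DecidableEq (C i)] {B R : Type*} [Fintype B] [DecidableEq B] [Fintype R] [DecidableEq R]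

/-- The vector `|ψ⟩ ⊗ |Φ^{K_M}⟩`. Sender `i` holds `C i` and `C⁰ᵢ = Fin (K i)`; the receiver holds
`B` and `B⁰_M`. -/
def initialVec (ψ : EuclideanSpace ℂ ((∀ i, C i) × B × R)) (K : ι → ℕ) :
    ((∀ i, C i × Fin (K i)) × (B × (∀ i, Fin (K i)))) × R → ℂ :=
  fun x => ψ (fun i => (x.1.1 i).1, x.1.2.1, x.2) *
    ∏ i, maxEntangled (K i) (x.1.1 i).2 (x.1.2.2 i)

/-- The vector `|ψ⟩^{B_M B R} ⊗ |Φ^{L_M}⟩`. Sender `i` holds `C¹ᵢ = Fin (L i)`; the receiver holds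
`B¹_M`, the copy `B_M` of `C_M`, and `B`. -/
def targetVec (ψ : EuclideanSpace ℂ ((∀ i, C i) × B × R)) (L : ι → ℕ) :
    ((∀ i, Fin (L i)) × ((∀ i, Fin (L i)) × (∀ i, C i) × B)) × R → ℂ :=
  fun x => ψ (x.1.2.2.1, x.1.2.2.2, x.2) * ∏ i, maxEntangled (L i) (x.1.1 i) (x.1.2.1 i)

/-- The reduced state `ψ^R`. -/
def reducedR (ψ : EuclideanSpace ℂ ((∀ i, C i) × B × R)) : Matrix R R ℂ :=
  partialTraceFst (partialTraceFst (pureState fun x => ψ x))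

/-- The reduced state `ψ^{R𝒯}` on the reference and the senders in `T`. -/
def reducedRT (ψ : EuclideanSpace ℂ ((∀ i, C i) × B × R)) (T : Finset ι) :
    Matrix (((i : {i // i ∈ T}) → C i) × R) (((i : {i // i ∈ T}) → C i) × R) ℂ :=
  partialTraceSnd (pureState fun x : (((i : {i // i ∈ T}) → C i) × R) ×
      (((i : {i // i ∉ T}) → C i) × B) =>
    ψ ((Equiv.piEquivPiSubtypeProd (· ∈ T) C).symm (x.1.1, x.2.1), x.2.2, x.1.2))

/-! ### Decoupling error and merging protocols -/

set_option synthInstance.maxSize 512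

variable {K L : ι → ℕ} {J : ι → Type*} [∀ i, Fintype (J i)]

/-- The unnormalized state of `C¹_M R` after the senders have applied their instruments to
`ψ ⊗ Φ^{K_M}` and obtained the outcomes `j`. -/
def outcomeState (ψ : EuclideanSpace ℂ ((∀ i, C i) × B × R))
    (E : ∀ i, J i → SuperOp (C i × Fin (K i)) (Fin (L i))) (j : ∀ i, J i) :
    Matrix ((∀ i, Fin (L i)) × R) ((∀ i, Fin (L i)) × R) ℂ :=
  let ρ := (((SuperOp.piTensor fun i => E i (j i)).actFst (B × (∀ i, Fin (K i)))).actFst R)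
    (pureState (initialVec ψ K))
  partialTraceSnd (ρ.submatrix (fun x : ((∀ i, Fin (L i)) × R) × (B × (∀ i, Fin (K i))) =>
    ((x.1.1, x.2), x.1.2)) (fun x => ((x.1.1, x.2), x.1.2)))

/-- The decoupling error `Q_I(ψ ⊗ Φ^{K_M}) = ∑_j p_j ‖ψ_j^{C¹_M R} - τ^{C¹_M} ⊗ ψ^R‖₁`, where
`p_j` is the probability of the outcomes `j` and `ψ_j` the normalized outcome state. -/
def decouplingError (ψ : EuclideanSpace ℂ ((∀ i, C i) × B × R))
    (E : ∀ i, J i → SuperOp (C i × Fin (K i)) (Fin (L i))) : ℝ :=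
  ∑ j : ∀ i, J i,
    let p : ℝ := (outcomeState ψ E j).trace.re
    p * traceNorm ((p : ℂ)⁻¹ • outcomeState ψ E j - maximallyMixed (∀ i, Fin (L i)) ⊗ₖ reducedR ψ)

/-- The one-way LOCC map `Λ`: each sender `i` applies `E i` and announces the outcome `j i`; the
receiver then applies the decoder `D j`. -/
def mergingMap (E : ∀ i, J i → SuperOp (C i × Fin (K i)) (Fin (L i)))
    (D : (∀ i, J i) → SuperOp (B × (∀ i, Fin (K i))) ((∀ i, Fin (L i)) × (∀ i, C i) × B)) :
    SuperOp ((∀ i, C i × Fin (K i)) × (B × (∀ i, Fin (K i))))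
      ((∀ i, Fin (L i)) × ((∀ i, Fin (L i)) × (∀ i, C i) × B)) :=
  ∑ j : ∀ i, J i, (D j).actSnd (∀ i, Fin (L i)) ∘ₗ
    (SuperOp.piTensor fun i => E i (j i)).actFst (B × (∀ i, Fin (K i)))

/-- The instruments `E` and the decoders `D` form a state merging protocol for `ψ` with error `ε`
(and entanglement cost `log K i - log L i` for the sender `i`). -/
def IsMergingProtocol (ψ : EuclideanSpace ℂ ((∀ i, C i) × B × R))
    (E : ∀ i, J i → SuperOp (C i × Fin (K i)) (Fin (L i)))
    (D : (∀ i, J i) → SuperOp (B × (∀ i, Fin (K i))) ((∀ i, Fin (L i)) × (∀ i, C i) × B))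
    (ε : ℝ) : Prop :=
  (∀ i, IsInstrument (E i)) ∧ (∀ j, (D j).IsChannel) ∧
    traceNorm ((mergingMap E D).actFst R (pureState (initialVec ψ K)) -
      pureState (targetVec ψ L)) ≤ ε

/-- `Δ = 2 ∑_{T≠∅} ∏_{i∈T} Lᵢ/(d_{Cᵢ}Kᵢ) + 2 √(d_R ∑_{T≠∅} (∏_{i∈T} Lᵢ/Kᵢ) Tr[(ψ^{RT})²])`. -/
def mergingBound (ψ : EuclideanSpace ℂ ((∀ i, C i) × B × R)) (K L : ι → ℕ) : ℝ :=
  2 * ∑ T : Finset ι with T.Nonempty, ∏ i ∈ T, (L i : ℝ) / ((Fintype.card (C i) : ℝ) * K i) +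
    2 * √((Fintype.card R : ℝ) * ∑ T : Finset ι with T.Nonempty,
      (∏ i ∈ T, (L i : ℝ) / K i) * (reducedRT ψ T ^ 2).trace.re)

end Merging

/-! ### Measurements by partial isometries -/

/-- A partial isometry: it preserves the norm on the orthogonal complement of its kernel. -/
def IsPartialIsometry {a b : Type*} [Fintype a] [DecidableEq a] [Fintype b]
    (A : Matrix b a ℂ) : Prop :=
  ∀ v ∈ (LinearMap.ker (Matrix.toEuclideanLin A))ᗮ, ‖Matrix.toEuclideanLin A v‖ = ‖v‖

/-- Kraus operators `A 0, …, A N` of a measurement of the system `a`, where `N = ⌊d_a / l⌋`: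
`A 1, …, A N` are partial isometries of rank `l`, and `A 0` is one of rank `d_a - N l < l`. -/
def IsPartialIsometryMeasurement {a : Type*} [Fintype a] [DecidableEq a] {l : ℕ}
    (A : Fin (Fintype.card a / l + 1) → Matrix (Fin l) a ℂ) : Prop :=
  (∀ j, IsPartialIsometry (A j)) ∧ (∀ j, j ≠ 0 → (A j).rank = l) ∧
    (A 0).rank = Fintype.card a - Fintype.card a / l * l ∧ (A 0).rank < l ∧
    ∑ j, (A j)ᴴ * A j = 1

/-! ### Haar measure on the unitary group -/

instance instMeasurableSpaceUnitaryGroup (a : Type*) [Fintype a] [DecidableEq a] :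
    MeasurableSpace (Matrix.unitaryGroup a ℂ) := borel _

instance instBorelSpaceUnitaryGroup (a : Type*) [Fintype a] [DecidableEq a] :
    BorelSpace (Matrix.unitaryGroup a ℂ) := ⟨rfl⟩

instance instCompactSpaceUnitaryGroup (a : Type*) [Fintype a] [DecidableEq a] :
    CompactSpace (Matrix.unitaryGroup a ℂ) := by
  suffices hU : IsCompact ((Matrix.unitaryGroup a ℂ : Submonoid (Matrix a a ℂ)) :
      Set (Matrix a a ℂ)) from isCompact_iff_compactSpace.mp hU
  have hc : IsCompact (Set.univ.pi fun _ : a => Set.univ.pi fun _ : a =>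
      Metric.closedBall (0 : ℂ) 1) :=
    isCompact_univ_pi fun _ => isCompact_univ_pi fun _ => isCompact_closedBall _ _
  refine IsCompact.of_isClosed_subset hc ?_ ?_
  · have h : ((Matrix.unitaryGroup a ℂ : Submonoid (Matrix a a ℂ)) : Set (Matrix a a ℂ)) =
        {A | star A * A = 1} := by
      ext A
      exact Matrix.mem_unitaryGroup_iff'
    rw [h]
    exact isClosed_eq (by fun_prop) continuous_const
  · intro A hA i _ j _
    simpa using entry_norm_bound_of_unitary hA i j

/-- The Haar probability measure on the unitary group `𝕌(a)`. -/
def haarUnitary (a : Type*) [Fintype a] [DecidableEq a] : Measure (Matrix.unitaryGroup a ℂ) :=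
  Measure.haarMeasure ⊤

end

noncomputable section

/-! ### Hilbert–Schmidt inner product and trace norm -/

section TraceNorm

variable {a b c : Type*} [Fintype a] [Fintype b] [Fintype c]

/-! Let σ be the state of all the $C_iC_i^0$ and $R$ in $\psi\otimes\Phi^{K_M}$, and $\omega_J(U)$
the unnormalized outcome state. Absorbing probabilities into the norms, the decoupling error is
$\sum_J\|\omega_J-(\mathrm{Tr}\,\omega_J)\,\tau\otimes\psi^R\|_1$, a continuous function on a
compact group, hence integrable.

Average bound. If some sender obtains the low-rank outcome 0, the summand is at most
$2\,\mathrm{Tr}\,\omega_J$, whose mean is twice the product of the relative ranks; grouping such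
tuples by the set $T$ of senders with outcome 0 gives the first term of Δ
(`sum_prod_zero_outcome_le`). For the other tuples, replacing $\mathrm{Tr}\,\omega_J$ by its mean
costs a factor 2. Then $\|\cdot\|_1\le\sqrt{\dim}\,\|\cdot\|_2$ and Jensen's inequality leave a
variance. It involves each unitary only through two copies of the rotated projector $U_i^\dagger
P_iU_i$, whose second moment is $\beta_i I+\alpha_i F$ with $F$ the swap
(`exists_integral_conjBy_mul_conjBy`). Expanding the product over senders gives a sum over subsets
$T$ of swap overlaps of σ, which are the purities of $\psi^{RT}$ divided by $\prod_{i\in T}K_i$. The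
bounds on $\alpha_i,\beta_i$ make the term $T=\emptyset$ no larger than the squared mean that is
subtracted, so only nonempty $T$ survive (`integral_traceNorm_rotatedOutcome_sub_le`).

Existence. Some tuple of unitaries does no worse than the average, and composing a fixed measurement
with it gives the $A_i$. The target vector purifies $\tau\otimes\psi^R$, so for each $J$ Uhlmann's
theorem and the Powers–Størmer inequality yield a contraction at the receiver with squared overlap
at least $p_J(1-\varepsilon_J)$, where $\varepsilon_J$ is the trace distance for that outcome
(`exists_contraction_overlap_of_trace`). Each contraction is completed to a channel. Summing over
$J$, the final state has fidelity at least $1-\Delta$ with a pure target, so their trace-norm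
distance is at most $2\sqrt\Delta$ (`traceNorm_sum_pureState_sub_le`). -/

theorem trace_conjTranspose_mul_self_re (A : Matrix a b ℂ) :
    (Aᴴ * A).trace.re = ∑ p : a × b, ‖A p.1 p.2‖ ^ 2 := by
  rw [Fintype.sum_prod_type_right]
  simp [Matrix.trace, Matrix.mul_apply, ← Complex.normSq_eq_norm_sq, Complex.normSq_apply]

theorem norm_trace_conjTranspose_mul_le (A B : Matrix a b ℂ) :
    ‖(Aᴴ * B).trace‖ ≤ √((Aᴴ * A).trace.re) * √((Bᴴ * B).trace.re) := by
  have h := norm_inner_le_norm (𝕜 := ℂ) (WithLp.toLp 2 fun p : a × b => A p.1 p.2)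
    (WithLp.toLp 2 fun p : a × b => B p.1 p.2)
  rw [EuclideanSpace.norm_eq, EuclideanSpace.norm_eq] at h
  rw [trace_conjTranspose_mul_self_re, trace_conjTranspose_mul_self_re]
  refine le_trans (le_of_eq ?_) h
  congr 1
  simp only [PiLp.inner_apply, RCLike.inner_apply]
  rw [Fintype.sum_prod_type_right]
  simp [Matrix.trace, Matrix.mul_apply, mul_comm]

variable [DecidableEq a] [DecidableEq b]

theorem Matrix.IsHermitian.exists_diagonalization {X : Matrix a a ℂ} (hX : X.IsHermitian) :
    ∃ (U : Matrix a a ℂ) (l : a → ℝ), Uᴴ * U = 1 ∧ U * Uᴴ = 1 ∧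
      X = U * Matrix.diagonal (fun i => (l i : ℂ)) * Uᴴ ∧
      ∀ f : ℝ → ℝ, cfc f X = U * Matrix.diagonal (fun i => ((f (l i) : ℝ) : ℂ)) * Uᴴ := by
  refine ⟨hX.eigenvectorUnitary, hX.eigenvalues, ?_, ?_, ?_, fun f => ?_⟩
  · exact Matrix.mem_unitaryGroup_iff'.mp hX.eigenvectorUnitary.2
  · exact Matrix.mem_unitaryGroup_iff.mp hX.eigenvectorUnitary.2
  · conv_lhs => rw [hX.spectral_theorem]
    rw [Unitary.conjStarAlgAut_apply]; rfl
  · rw [hX.cfc_eq, Matrix.IsHermitian.cfc, Unitary.conjStarAlgAut_apply]; rfl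

theorem Matrix.PosSemidef.diagonal_conj {l : a → ℝ} (U : Matrix a a ℂ) (hl : ∀ i, 0 ≤ l i) :
    (U * Matrix.diagonal (fun i => (l i : ℂ)) * Uᴴ).PosSemidef := by
  apply Matrix.PosSemidef.mul_mul_conjTranspose_same
  exact Matrix.PosSemidef.diagonal fun i => by simpa using hl i

theorem Matrix.PosSemidef.exists_diagonalization {X : Matrix a a ℂ} (hX : X.PosSemidef) :
    ∃ (U : Matrix a a ℂ) (l : a → ℝ), Uᴴ * U = 1 ∧ U * Uᴴ = 1 ∧ (∀ i, 0 ≤ l i) ∧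
      X = U * Matrix.diagonal (fun i => (l i : ℂ)) * Uᴴ ∧
      ∀ f : ℝ → ℝ, cfc f X = U * Matrix.diagonal (fun i => ((f (l i) : ℝ) : ℂ)) * Uᴴ := by
  obtain ⟨U, l, hU, hU', hX', hf⟩ := hX.1.exists_diagonalization
  refine ⟨U, l, hU, hU', fun i => ?_, hX', hf⟩
  have h := hX.conjTranspose_mul_mul_same U
  have h2 : Uᴴ * X * U = Matrix.diagonal (fun i => (l i : ℂ)) := by
    calc _ = (Uᴴ * U) * Matrix.diagonal (fun i => (l i : ℂ)) * (Uᴴ * U) := by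
          rw [hX']; simp only [Matrix.mul_assoc]
      _ = _ := by rw [hU, Matrix.one_mul, Matrix.mul_one]
  rw [h2] at h
  simpa using h.diag_nonneg (i := i)

theorem diagonal_conj_mul {U : Matrix a a ℂ} (hU : Uᴴ * U = 1) (f g : a → ℂ) :
    (U * Matrix.diagonal f * Uᴴ) * (U * Matrix.diagonal g * Uᴴ) =
      U * Matrix.diagonal (fun i => f i * g i) * Uᴴ := by
  calc _ = U * Matrix.diagonal f * (Uᴴ * U) * Matrix.diagonal g * Uᴴ := by
        simp only [Matrix.mul_assoc]
    _ = _ := by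
        rw [hU, Matrix.mul_one, Matrix.mul_assoc U, Matrix.diagonal_mul_diagonal]

theorem Matrix.PosSemidef.exists_sqrt {X : Matrix a a ℂ} (hX : X.PosSemidef) :
    ∃ A : Matrix a a ℂ, A.PosSemidef ∧ A * A = X := by
  obtain ⟨U, l, hU, -, hl, hX', -⟩ := hX.exists_diagonalization
  refine ⟨_, Matrix.PosSemidef.diagonal_conj U fun i => Real.sqrt_nonneg (l i), ?_⟩
  rw [diagonal_conj_mul hU, hX']
  simp only [← Complex.ofReal_mul, Real.mul_self_sqrt (hl _)]

theorem traceNorm_eq_trace_abs {X : Matrix a a ℂ} (hX : X.IsHermitian) :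
    traceNorm X = (cfc (fun x : ℝ => |x|) X).trace.re := by
  have h : cfc Real.sqrt (Xᴴ * X) = cfc (fun x : ℝ => |x|) X := by
    have h1 : Xᴴ * X = cfc (fun x : ℝ => x ^ 2) X := by
      rw [cfc_pow_id (R := ℝ) X 2 hX.isSelfAdjoint, hX.eq, sq]
    rw [h1, ← cfc_comp' Real.sqrt (fun x : ℝ => x ^ 2) X]
    simp only [Real.sqrt_sq_eq_abs]
  rw [traceNorm, h]

/-- The kernel of `X` gets sign +1, so that the sign is a unitary involution and not merely a
partial isometry. Together with `re_trace_mul_le_traceNorm` this is the variational formula for the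
trace norm, from which its norm properties are derived. -/
theorem exists_sign {X : Matrix a a ℂ} (hX : X.IsHermitian) :
    ∃ S : Matrix a a ℂ, Sᴴ = S ∧ S * S = 1 ∧ S * X = X * S ∧ (S * X).PosSemidef ∧
      traceNorm X = (S * X).trace.re := by
  obtain ⟨U, l, hU, hU', hX', hf⟩ := hX.exists_diagonalization
  have hs : ∀ i, (if 0 ≤ l i then (1 : ℂ) else -1) * l i = ((|l i| : ℝ) : ℂ) := fun i => by
    split_ifs with h
    · rw [abs_of_nonneg h, one_mul]
    · rw [abs_of_neg (not_le.mp h)]; push_cast; ring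
  have hSX : (U * Matrix.diagonal (fun i => if 0 ≤ l i then (1 : ℂ) else -1) * Uᴴ) * X =
      U * Matrix.diagonal (fun i => ((|l i| : ℝ) : ℂ)) * Uᴴ := by
    rw [hX', diagonal_conj_mul hU]; simp only [hs]
  have hXS : X * (U * Matrix.diagonal (fun i => if 0 ≤ l i then (1 : ℂ) else -1) * Uᴴ) =
      U * Matrix.diagonal (fun i => ((|l i| : ℝ) : ℂ)) * Uᴴ := by
    rw [hX', diagonal_conj_mul hU]; simp only [mul_comm _ (ite _ _ _), hs]
  refine ⟨U * Matrix.diagonal (fun i => if 0 ≤ l i then (1 : ℂ) else -1) * Uᴴ,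
    ?_, ?_, hSX.trans hXS.symm, ?_, ?_⟩
  · simp only [Matrix.conjTranspose_mul, Matrix.conjTranspose_conjTranspose,
      Matrix.diagonal_conjTranspose, Matrix.mul_assoc]
    congr 3
    ext i
    simp only [Pi.star_apply]
    split_ifs <;> simp
  · rw [diagonal_conj_mul hU]
    have : (fun i => (if 0 ≤ l i then (1 : ℂ) else -1) * (if 0 ≤ l i then (1 : ℂ) else -1)) =
        fun _ => 1 := by
      ext i; split_ifs <;> simp
    rw [this, Matrix.diagonal_one, Matrix.mul_one, hU']
  · rw [hSX]
    exact Matrix.PosSemidef.diagonal_conj U fun i => abs_nonneg _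
  · rw [hSX, traceNorm_eq_trace_abs hX, hf]

/-- In an eigenbasis of `X` the trace pairs the eigenvalues with the diagonal entries of a unitary,
which have modulus at most 1. -/
theorem re_trace_mul_le_traceNorm {X : Matrix a a ℂ} (hX : X.IsHermitian) {S : Matrix a a ℂ}
    (hS : S ∈ Matrix.unitaryGroup a ℂ) : (S * X).trace.re ≤ traceNorm X := by
  obtain ⟨U, l, hU, hU', hX', hf⟩ := hX.exists_diagonalization
  have hUm : U ∈ Matrix.unitaryGroup a ℂ := Matrix.mem_unitaryGroup_iff.mpr hU'
  have hW : Uᴴ * S * U ∈ Matrix.unitaryGroup a ℂ :=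
    mul_mem (mul_mem (Unitary.star_mem hUm) hS) hUm
  have h0 : traceNorm X = ∑ i, |l i| := by
    rw [traceNorm_eq_trace_abs hX, hf, Matrix.trace_mul_comm, ← Matrix.mul_assoc, hU,
      Matrix.one_mul, Matrix.trace_diagonal]
    simp
  have h1 : (S * X).trace = (Uᴴ * S * U * Matrix.diagonal (fun i => (l i : ℂ))).trace := by
    conv_lhs => rw [hX', ← Matrix.mul_assoc, Matrix.trace_mul_comm]
    simp only [Matrix.mul_assoc]
  rw [h0, h1]
  simp only [Matrix.trace, Matrix.diag_apply, Matrix.mul_diagonal,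
    Complex.re_sum]
  refine Finset.sum_le_sum fun i _ => ?_
  calc _ ≤ ‖(Uᴴ * S * U) i i * (l i : ℂ)‖ := Complex.re_le_norm _
    _ = ‖(Uᴴ * S * U) i i‖ * |l i| := by rw [norm_mul, Complex.norm_real, Real.norm_eq_abs]
    _ ≤ 1 * |l i| := by gcongr; exact entry_norm_bound_of_unitary hW i i
    _ = _ := by simp

theorem mem_unitaryGroup_of_sign {S : Matrix a a ℂ} (h : Sᴴ = S) (h' : S * S = 1) :
    S ∈ Matrix.unitaryGroup a ℂ := by
  rw [Matrix.mem_unitaryGroup_iff, Matrix.star_eq_conjTranspose, h, h']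

theorem traceNorm_nonneg {X : Matrix a a ℂ} (hX : X.IsHermitian) : 0 ≤ traceNorm X := by
  obtain ⟨S, -, -, -, hS, h⟩ := exists_sign hX
  rw [h]
  exact (Complex.nonneg_iff.mp hS.trace_nonneg).1

theorem traceNorm_add_le {X Y : Matrix a a ℂ} (hX : X.IsHermitian) (hY : Y.IsHermitian) :
    traceNorm (X + Y) ≤ traceNorm X + traceNorm Y := by
  obtain ⟨S, h1, h2, -, -, h⟩ := exists_sign (hX.add hY)
  have hS := mem_unitaryGroup_of_sign h1 h2
  rw [h, Matrix.mul_add, Matrix.trace_add, Complex.add_re]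
  exact add_le_add (re_trace_mul_le_traceNorm hX hS) (re_trace_mul_le_traceNorm hY hS)

theorem abs_re_trace_le_traceNorm {X : Matrix a a ℂ} (hX : X.IsHermitian) :
    |X.trace.re| ≤ traceNorm X := by
  rw [abs_le']
  constructor
  · simpa using re_trace_mul_le_traceNorm hX (one_mem _)
  · have h := re_trace_mul_le_traceNorm hX (S := -1)
      (mem_unitaryGroup_of_sign (by simp) (by simp))
    simpa using h

theorem traceNorm_of_posSemidef {X : Matrix a a ℂ} (hX : X.PosSemidef) :
    traceNorm X = X.trace.re := by
  obtain ⟨U, l, -, -, hl, hX', hf⟩ := hX.exists_diagonalization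
  refine le_antisymm ?_ ((le_abs_self _).trans (abs_re_trace_le_traceNorm hX.1))
  rw [traceNorm_eq_trace_abs hX.1, hf, hX']
  simp only [abs_of_nonneg (hl _), le_refl]

theorem traceNorm_smul {X : Matrix a a ℂ} (hX : X.IsHermitian) {r : ℝ} (hr : 0 ≤ r) :
    traceNorm ((r : ℂ) • X) = r * traceNorm X := by
  have hrX : ((r : ℂ) • X).IsHermitian := by
    simp [Matrix.IsHermitian, Matrix.conjTranspose_smul, hX.eq]
  apply le_antisymm
  · obtain ⟨S, h1, h2, -, -, h⟩ := exists_sign hrX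
    rw [h, Matrix.mul_smul, Matrix.trace_smul, smul_eq_mul, Complex.re_ofReal_mul]
    exact mul_le_mul_of_nonneg_left
      (re_trace_mul_le_traceNorm hX (mem_unitaryGroup_of_sign h1 h2)) hr
  · obtain ⟨S, h1, h2, -, -, h⟩ := exists_sign hX
    have := re_trace_mul_le_traceNorm hrX (mem_unitaryGroup_of_sign h1 h2)
    rwa [Matrix.mul_smul, Matrix.trace_smul, smul_eq_mul, Complex.re_ofReal_mul, ← h] at this

theorem traceNorm_neg {X : Matrix a a ℂ} : traceNorm (-X) = traceNorm X := by
  simp [traceNorm]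

/-- Cauchy–Schwarz for the Hilbert–Schmidt product of `X` with its sign, whose squared norm is the
dimension. -/
theorem traceNorm_le_sqrt_card_mul {X : Matrix a a ℂ} (hX : X.IsHermitian) :
    traceNorm X ≤ √(Fintype.card a) * √((Xᴴ * X).trace.re) := by
  obtain ⟨S, h1, h2, -, -, h⟩ := exists_sign hX
  have := norm_trace_conjTranspose_mul_le S X
  rw [h1, h2, Matrix.trace_one] at this
  rw [h]
  exact (Complex.re_le_norm _).trans (by simpa using this)

/-- Powers–Størmer inequality. -/
theorem powers_stormer {A B : Matrix a a ℂ} (hA : A.PosSemidef) (hB : B.PosSemidef) :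
    ((A - B) * (A - B)).trace.re ≤ traceNorm (A * A - B * B) := by
  have hAA : (A * A - B * B).IsHermitian := by
    simp [Matrix.IsHermitian, Matrix.conjTranspose_mul, hA.1.eq, hB.1.eq]
  obtain ⟨E, h1, h2, h3, h4, -⟩ := exists_sign (hA.1.sub hB.1)
  refine le_trans ?_ (re_trace_mul_le_traceNorm hAA (mem_unitaryGroup_of_sign h1 h2))
  set D := A - B with hD
  -- Here `E * D` is |D|, so for `s = ±1` the matrix `E * D * (1 + s • E)` is |D| ± D, which is
  -- positive semidefinite: it is half of the conjugate of |D| by `1 + s • E`. Since A² − B² = DA +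
  -- BD, the difference of the two sides is Tr (|D| − D)A + Tr (|D| + D)B.
  have key : ∀ s : ℂ, s * s = 1 → star s = s → ∀ M : Matrix a a ℂ, M.PosSemidef →
      0 ≤ ((E * D * (1 + s • E)) * M).trace.re := by
    intro s hs hs' M hM
    have hP : (1 + s • E) * (1 + s • E) = (2 : ℂ) • (1 + s • E) := by
      rw [two_smul]
      simp only [Matrix.add_mul, Matrix.mul_add, Matrix.one_mul, Matrix.mul_one, Matrix.smul_mul,
        Matrix.mul_smul, h2, smul_add, smul_smul, hs, one_smul]
      abel
    have hc : (1 + s • E) * (E * D) = E * D * (1 + s • E) := by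
      have : E * (E * D) = E * D * E := by rw [Matrix.mul_assoc, ← h3]
      simp [Matrix.add_mul, Matrix.mul_add, this]
    have hPh : (1 + s • E)ᴴ = 1 + s • E := by
      rw [Matrix.conjTranspose_add, Matrix.conjTranspose_smul, h1, hs', Matrix.conjTranspose_one]
    have h5 := h4.mul_mul_conjTranspose_same (1 + s • E)
    rw [hPh, hc, Matrix.mul_assoc, hP, Matrix.mul_smul] at h5
    obtain ⟨N, hN, rfl⟩ := hM.exists_sqrt
    replace hN := hN.1.eq
    have h6 := (h5.mul_mul_conjTranspose_same N).trace_nonneg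
    rw [hN, Matrix.mul_assoc, Matrix.trace_mul_comm, Matrix.mul_assoc, Matrix.smul_mul,
      Matrix.trace_smul] at h6
    have := (Complex.nonneg_iff.mp h6).1
    simp only [smul_eq_mul, Complex.mul_re, Complex.re_ofNat, Complex.im_ofNat, zero_mul,
      sub_zero] at this
    linarith
  have k1 := key 1 (by simp) (by simp) B hB
  have k2 := key (-1) (by simp) (by simp) A hA
  have e1 : (E * (D * A)).trace = (E * D * A).trace := by rw [Matrix.mul_assoc]
  have e2 : (E * (B * D)).trace = (E * D * B).trace := by
    rw [← Matrix.mul_assoc, Matrix.trace_mul_comm, ← Matrix.mul_assoc, ← h3]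
  have e3 : A * A - B * B = D * A + B * D := by rw [hD]; noncomm_ring
  have e4 : ∀ M, (E * D * E * M).trace = (D * M).trace := fun M => by
    rw [h3, Matrix.mul_assoc D, h2, Matrix.mul_one]
  have e5 : D * D = D * A - D * B := by rw [hD]; noncomm_ring
  simp only [Matrix.mul_add, Matrix.add_mul, Matrix.mul_one,
    one_smul, neg_smul, Matrix.neg_mul, Matrix.mul_neg, Matrix.trace_add, Matrix.trace_neg, e4,
    Complex.add_re, Complex.neg_re] at k1 k2
  rw [e3, e5, Matrix.mul_add, Matrix.trace_add, e1, e2, Matrix.trace_sub, Complex.add_re,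
    Complex.sub_re]
  linarith

end TraceNorm

/-! ### Uhlmann's theorem and fidelity estimates -/

section Uhlmann

variable {a b c : Type*} [Fintype a] [Fintype b] [Fintype c] [DecidableEq a] [DecidableEq b]
  [DecidableEq c]

omit [DecidableEq a] in
theorem re_trace_conjTranspose (M : Matrix a a ℂ) : Mᴴ.trace.re = M.trace.re := by
  rw [Matrix.trace_conjTranspose, Complex.star_def, Complex.conj_re]

omit [DecidableEq a] in
theorem posSemidef_of_idempotent {P : Matrix a a ℂ} (h : Pᴴ = P) (h' : P * P = P) :
    P.PosSemidef := by
  have := Matrix.posSemidef_conjTranspose_mul_self P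
  rwa [h, h'] at this

theorem posSemidef_one_sub_of_idempotent {P : Matrix a a ℂ} (h : Pᴴ = P) (h' : P * P = P) :
    (1 - P).PosSemidef := by
  apply posSemidef_of_idempotent
  · simp [h]
  · simp [Matrix.sub_mul, Matrix.mul_sub, h']

/-- Polar decomposition of a rectangular matrix with `A = √(X Xᴴ)`. The factor `V` is only a partial
isometry, so the statement records what Uhlmann's theorem uses: `V * Vᴴ` acts as the identity on the
support of `A`, and `V` is a contraction from both sides. -/
theorem exists_polar (X : Matrix a b ℂ) :
    ∃ (A : Matrix a a ℂ) (V : Matrix a b ℂ), A.PosSemidef ∧ A * A = X * Xᴴ ∧ A * V = X ∧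
      A * (V * Vᴴ) = A ∧ (1 - V * Vᴴ).PosSemidef ∧ (1 - Vᴴ * V).PosSemidef := by
  obtain ⟨U, l, hU, hU', hl, hX, -⟩ :=
    (Matrix.posSemidef_self_mul_conjTranspose X).exists_diagonalization
  set F : (a → ℝ) → Matrix a a ℂ := fun f => U * Matrix.diagonal (fun i => (f i : ℂ)) * Uᴴ with hF
  have hmul : ∀ f g, F f * F g = F (fun i => f i * g i) := fun f g => by
    simp only [hF, diagonal_conj_mul hU, Complex.ofReal_mul]
  have hFh : ∀ f, (F f)ᴴ = F f := fun f => by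
    simp only [hF, Matrix.conjTranspose_mul, Matrix.conjTranspose_conjTranspose,
      Matrix.diagonal_conjTranspose, Matrix.mul_assoc]
    congr 3
    ext i
    simp
  set P := F fun i => if l i = 0 then 0 else 1 with hP
  -- Because `0⁻¹ = 0`, this is the pseudo-inverse of `√(X Xᴴ)`; `P` is the support projection.
  set A' := F fun i => (√(l i))⁻¹ with hA'
  have hs : ∀ i, √(l i) = 0 ↔ l i = 0 := fun i => Real.sqrt_eq_zero (hl i)
  have hX' : X * Xᴴ = F l := hX
  have hPh : Pᴴ = P := hFh _
  have hPP : P * P = P := by rw [hP, hmul]; congr 1; ext i; split_ifs <;> simp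
  have hVV : (A' * X) * (A' * X)ᴴ = P := by
    rw [Matrix.conjTranspose_mul, hA', hFh, Matrix.mul_assoc, ← Matrix.mul_assoc X, hX', hmul, hmul]
    congr 1
    ext i
    split_ifs with h
    · simp [h]
    · have h2 : √(l i) ≠ 0 := fun h' => h ((hs i).mp h')
      have h3 := Real.mul_self_sqrt (hl i)
      field_simp
      rw [sq, h3]
  have hAP : F (fun i => √(l i)) * P = F fun i => √(l i) := by
    rw [hP, hmul]; congr 1; ext i
    split_ifs with h
    · simp [h]
    · simp
  have hPA' : P * A' = A' := by
    rw [hP, hmul]; congr 1; ext i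
    split_ifs with h
    · simp [h]
    · simp
  refine ⟨F fun i => √(l i), A' * X, Matrix.PosSemidef.diagonal_conj U fun i => Real.sqrt_nonneg _,
    ?_, ?_, ?_, ?_, ?_⟩
  · rw [hmul, hX']; simp only [Real.mul_self_sqrt (hl _)]
  · have h1 : F (fun i => √(l i)) * A' = P := by
      rw [hA', hmul]; congr 1; ext i
      split_ifs with h
      · simp [h]
      · exact mul_inv_cancel₀ fun h' => h ((hs i).mp h')
    rw [← Matrix.mul_assoc, h1]
    -- The columns of `X` lie in the support of `X * Xᴴ`: the product of `(1 - P) * X` with its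
    -- adjoint vanishes.
    have h2 : (1 - P) * X = 0 := by
      rw [← Matrix.self_mul_conjTranspose_eq_zero, Matrix.conjTranspose_mul, Matrix.mul_assoc,
        ← Matrix.mul_assoc X, hX']
      have : P * F l = F l := by
        rw [hP, hmul]; congr 1; ext i
        split_ifs with h
        · simp [h]
        · simp
      rw [← Matrix.mul_assoc, Matrix.sub_mul, this, Matrix.one_mul, sub_self, Matrix.zero_mul]
    rw [Matrix.sub_mul, Matrix.one_mul, sub_eq_zero] at h2
    exact h2.symm
  · rw [hVV, hAP]
  · rw [hVV]; exact posSemidef_one_sub_of_idempotent hPh hPP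
  · apply posSemidef_one_sub_of_idempotent
    · simp [Matrix.conjTranspose_mul, Matrix.mul_assoc]
    · rw [Matrix.mul_assoc, ← Matrix.mul_assoc (A' * X), hVV, ← Matrix.mul_assoc, ← Matrix.mul_assoc,
        Matrix.mul_assoc _ P, hPA', Matrix.mul_assoc]

/-- Uhlmann's theorem combined with the Fuchs–van de Graaf inequality: the purifications `X`, `Y` of
`X * Xᴴ`, `Y * Yᴴ` are mapped close to each other by a contraction of the purifying system. -/
theorem exists_contraction_overlap (X : Matrix a b ℂ) (Y : Matrix a c ℂ)
    (hX : (X * Xᴴ).trace.re = 1) (hY : (Y * Yᴴ).trace.re = 1) :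
    ∃ W : Matrix c b ℂ, (1 - Wᴴ * W).PosSemidef ∧
      1 - traceNorm (X * Xᴴ - Y * Yᴴ) ≤ ‖(Yᴴ * X * Wᵀ).trace‖ ^ 2 := by
  obtain ⟨A, V, hA, hAA, hAV, hAP, hV1, hV2⟩ := exists_polar X
  obtain ⟨A', V', hA', hAA', hAV', hAP', hV1', hV2'⟩ := exists_polar Y
  -- This choice aligns the two polar parts, turning the overlap into Tr A'A. The transpose appears
  -- because an operator on the purifying system multiplies the reshaped vector from the right by
  -- its transpose. Contractivity: 1 − VᴴV'V'ᴴV = (1 − VᴴV) + Vᴴ(1 − V'V'ᴴ)V.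
  refine ⟨(Vᴴ * V')ᵀ, ?_, ?_⟩
  · have h1 : (1 - (Vᴴ * V') * (Vᴴ * V')ᴴ).PosSemidef := by
      have h2 := hV2.add (hV1'.conjTranspose_mul_mul_same V)
      convert h2 using 1
      rw [Matrix.mul_sub, Matrix.sub_mul, Matrix.mul_one, Matrix.conjTranspose_mul,
        Matrix.conjTranspose_conjTranspose]
      simp only [Matrix.mul_assoc]
      abel
    have h3 : (1 - (Vᴴ * V') * (Vᴴ * V')ᴴ)ᵀ = 1 - (Vᴴ * V')ᵀᴴ * (Vᴴ * V')ᵀ := by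
      rw [Matrix.transpose_sub, Matrix.transpose_one, Matrix.transpose_mul]
      rfl
    exact h3 ▸ h1.transpose
  · have htr : (Yᴴ * X * (Vᴴ * V')ᵀᵀ).trace = (A' * A).trace := by
      have h1 : V' * V'ᴴ * A' = A' := by
        have := congrArg Matrix.conjTranspose hAP'
        rwa [Matrix.conjTranspose_mul, Matrix.conjTranspose_mul, Matrix.conjTranspose_conjTranspose,
          hA'.1.eq] at this
      rw [Matrix.transpose_transpose, ← hAV, ← hAV', Matrix.conjTranspose_mul, hA'.1.eq]
      calc _ = (V'ᴴ * (A' * (A * (V * Vᴴ)) * V')).trace := by simp only [Matrix.mul_assoc]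
        _ = (V'ᴴ * (A' * A * V')).trace := by rw [hAP]
        _ = ((V' * V'ᴴ * A') * A).trace := by
            rw [Matrix.trace_mul_comm, Matrix.mul_assoc, Matrix.trace_mul_comm]
            simp only [Matrix.mul_assoc]
        _ = _ := by rw [h1]
    have hps := powers_stormer hA hA'
    have h2 : ((A - A') * (A - A')).trace.re = 2 - 2 * (A' * A).trace.re := by
      simp only [Matrix.sub_mul, Matrix.mul_sub, Matrix.trace_sub, Complex.sub_re, hAA, hAA', hX, hY,
        Matrix.trace_mul_comm A A']
      ring
    rw [hAA, hAA', h2] at hps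
    rw [htr]
    set ε := traceNorm (X * Xᴴ - Y * Yᴴ)
    have h3 := Complex.re_le_norm (A' * A).trace
    have h4 := norm_nonneg (A' * A).trace
    -- Powers–Størmer gives Re Tr A'A ≥ 1 − ε/2. Squaring needs the right side to be nonnegative;
    -- otherwise 1 − ε is negative and the claim is trivial.
    by_cases h5 : ε ≤ 2
    · nlinarith [sq_nonneg ε]
    · nlinarith [sq_nonneg ‖(A' * A).trace‖]

/-- Write 2(MMᴴ − NNᴴ) = (M − N)(M + N)ᴴ + (M + N)(M − N)ᴴ and pair it with its sign. Cauchy–Schwarz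
then bounds the trace norm by ‖M − N‖₂‖M + N‖₂, whose squared factors are 2 − 2x and 2 + 2x. -/
theorem traceNorm_mul_conjTranspose_sub_le (M N : Matrix a b ℂ) (hM : (Mᴴ * M).trace.re = 1)
    (hN : (Nᴴ * N).trace.re = 1) :
    traceNorm (M * Mᴴ - N * Nᴴ) ≤ 2 * √(1 - (Nᴴ * M).trace.re ^ 2) := by
  have hH : (M * Mᴴ - N * Nᴴ).IsHermitian := by
    simp [Matrix.IsHermitian, Matrix.conjTranspose_mul]
  obtain ⟨S, h1, h2, -, -, h⟩ := exists_sign hH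
  set x := (Nᴴ * M).trace.re with hx
  have hx' : (Mᴴ * N).trace.re = x := by
    rw [hx, ← re_trace_conjTranspose, Matrix.conjTranspose_mul, Matrix.conjTranspose_conjTranspose]
  have e1 : (S * (M * Mᴴ - N * Nᴴ)).trace.re = (((M + N)ᴴ * (S * (M - N))).trace).re := by
    have hd : (2 : ℂ) • (S * (M * Mᴴ - N * Nᴴ)) =
        S * ((M - N) * (M + N)ᴴ) + S * ((M + N) * (M - N)ᴴ) := by
      rw [← Matrix.mul_add, ← Matrix.mul_smul]
      congr 1
      simp only [Matrix.conjTranspose_add, Matrix.conjTranspose_sub, Matrix.sub_mul, Matrix.mul_add,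
        Matrix.add_mul, Matrix.mul_sub, two_smul, smul_sub]
      abel
    have e2 : (S * ((M - N) * (M + N)ᴴ)).trace = ((M + N)ᴴ * (S * (M - N))).trace := by
      rw [← Matrix.mul_assoc, Matrix.trace_mul_comm]
    have e3 : (S * ((M + N) * (M - N)ᴴ)).trace.re = ((M + N)ᴴ * (S * (M - N))).trace.re := by
      rw [← re_trace_conjTranspose, Matrix.conjTranspose_mul, Matrix.conjTranspose_mul,
        Matrix.conjTranspose_conjTranspose, h1, Matrix.trace_mul_comm, e2]
    have := congrArg (fun Z => (Matrix.trace Z).re) hd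
    simp only [Matrix.trace_smul, Matrix.trace_add, Complex.add_re, e2, e3, smul_eq_mul,
      Complex.mul_re, Complex.re_ofNat, Complex.im_ofNat, zero_mul, sub_zero] at this
    linarith
  have e4 : ((M + N)ᴴ * (M + N)).trace.re = 2 + 2 * x := by
    simp only [Matrix.conjTranspose_add, Matrix.add_mul, Matrix.mul_add, Matrix.trace_add,
      Complex.add_re, hM, hN, hx', ← hx]
    ring
  have e5 : ((S * (M - N))ᴴ * (S * (M - N))).trace.re = 2 - 2 * x := by
    rw [Matrix.conjTranspose_mul, h1, Matrix.mul_assoc, ← Matrix.mul_assoc S, h2, Matrix.one_mul]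
    simp only [Matrix.conjTranspose_sub, Matrix.sub_mul, Matrix.mul_sub, Matrix.trace_sub,
      Complex.sub_re, hM, hN, hx', ← hx]
    ring
  have hcs := norm_trace_conjTranspose_mul_le (M + N) (S * (M - N))
  have hp : 0 ≤ 2 + 2 * x := by
    rw [← e4, trace_conjTranspose_mul_self_re]; positivity
  rw [h, e1]
  refine (Complex.re_le_norm _).trans (hcs.trans (le_of_eq ?_))
  rw [e4, e5, ← Real.sqrt_mul hp, show (2 + 2 * x) * (2 - 2 * x) = 2 ^ 2 * (1 - x ^ 2) by ring,
    Real.sqrt_mul (by norm_num), Real.sqrt_sq (by norm_num)]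

/-- A mixture of pure states with fidelity at least `1 - δ` to the pure state `t` is `2√δ`-close
to it in trace norm. -/
theorem traceNorm_sum_pureState_sub_le {κ : Type*} [Fintype κ] [DecidableEq κ] (v : κ → a → ℂ)
    (t : a → ℂ) (hv : ∑ k, ∑ x, ‖v k x‖ ^ 2 = 1) (ht : ∑ x, ‖t x‖ ^ 2 = 1) {δ : ℝ}
    (h : 1 - δ ≤ ∑ k, ‖∑ x, star (t x) * v k x‖ ^ 2) :
    traceNorm (∑ k, pureState (v k) - pureState t) ≤ 2 * √δ := by
  set f := ∑ k, ‖∑ x, star (t x) * v k x‖ ^ 2 with hf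
  have hf0 : 0 ≤ f := by positivity
  -- Purify with a register indexed by `κ`: the mixture is purified by the matrix with columns `v
  -- k`, and the pure state `t` by `t` tensored with any unit vector of the register. The freedom in
  -- `w` serves to maximize the overlap.
  have key : ∀ w : κ → ℂ, ∑ k, ‖w k‖ ^ 2 = 1 →
      traceNorm (∑ k, pureState (v k) - pureState t) ≤
        2 * √(1 - (∑ k, w k * ∑ x, star (t x) * v k x).re ^ 2) := by
    intro w hw
    have h1 := traceNorm_mul_conjTranspose_sub_le (Matrix.of fun x k => v k x)
      (Matrix.of fun x k => t x * star (w k)) ?_ ?_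
    · have e1 : ∑ k, pureState (v k) =
          (Matrix.of fun x k => v k x) * (Matrix.of fun x k => v k x)ᴴ := by
        ext x y
        simp [Matrix.sum_apply, pureState, Matrix.vecMulVec_apply, Matrix.mul_apply]
      have e2 : pureState t =
          (Matrix.of fun x k => t x * star (w k)) * (Matrix.of fun x k => t x * star (w k))ᴴ := by
        ext x y
        have hw' : ∑ k, star (w k) * w k = 1 := by
          rw [← Complex.ofReal_one, ← hw]
          push_cast
          refine Finset.sum_congr rfl fun k _ => ?_
          exact Complex.conj_mul' _
        simp only [pureState, Matrix.vecMulVec_apply, Matrix.mul_apply, Matrix.of_apply,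
          Matrix.conjTranspose_apply, star_mul', star_star, Pi.star_apply]
        calc t x * star (t y) = t x * star (t y) * ∑ k, star (w k) * w k := by rw [hw', mul_one]
          _ = _ := by rw [Finset.mul_sum]; exact Finset.sum_congr rfl fun k _ => by ring
      have e3 : ((Matrix.of fun x k => t x * star (w k))ᴴ * (Matrix.of fun x k => v k x)).trace =
          ∑ k, w k * ∑ x, star (t x) * v k x := by
        simp only [Matrix.trace, Matrix.diag_apply, Matrix.mul_apply, Matrix.conjTranspose_apply,
          Matrix.of_apply, star_mul', star_star, Finset.mul_sum]
        exact Finset.sum_congr rfl fun k _ => Finset.sum_congr rfl fun x _ => by ring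
      rwa [e1, e2, ← e3]
    · rw [trace_conjTranspose_mul_self_re, Fintype.sum_prod_type_right]
      simpa using hv
    · rw [trace_conjTranspose_mul_self_re, Fintype.sum_prod_type_right]
      simp only [Matrix.of_apply, norm_mul, norm_star, mul_pow]
      simp only [← Finset.sum_mul, ht, one_mul, hw]
  -- The optimal `w` is the normalized conjugate overlap vector, giving overlap √f. If all overlaps
  -- vanish it cannot be normalized, but then δ ≥ 1 and any basis vector will do.
  by_cases hf' : f = 0
  · have hne : Nonempty κ := by
      by_contra hne
      rw [not_nonempty_iff] at hne
      simp at hv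
    obtain ⟨k⟩ := hne
    refine (key (Pi.single k 1) ?_).trans ?_
    · simp [Pi.single_apply, apply_ite norm, ite_pow]
    · gcongr
      nlinarith [sq_nonneg ((∑ k', (Pi.single k 1 : κ → ℂ) k' * ∑ x, star (t x) * v k' x).re)]
  · have hfp : 0 < √f := Real.sqrt_pos.mpr (lt_of_le_of_ne hf0 (Ne.symm hf'))
    refine (key (fun k => star (∑ x, star (t x) * v k x) * ((√f)⁻¹ : ℝ)) ?_).trans ?_
    · simp only [norm_mul, norm_star, mul_pow, ← Finset.sum_mul, ← hf, Complex.norm_real, norm_inv,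
        Real.norm_eq_abs, abs_of_pos hfp, inv_pow, Real.sq_sqrt hf0, mul_inv_cancel₀ hf']
    · have : (∑ k, star (∑ x, star (t x) * v k x) * ((√f)⁻¹ : ℝ) * ∑ x, star (t x) * v k x) =
          ((√f : ℝ) : ℂ) := by
        have h2 : (∑ k, star (∑ x, star (t x) * v k x) * ∑ x, star (t x) * v k x) = (f : ℂ) := by
          rw [hf]; push_cast
          exact Finset.sum_congr rfl fun k _ => Complex.conj_mul' _
        calc _ = (((√f)⁻¹ : ℝ) : ℂ) * f := by
              rw [← h2, Finset.mul_sum]; exact Finset.sum_congr rfl fun k _ => by ring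
          _ = _ := by
            rw [← Complex.ofReal_mul]
            congr 1
            field_simp
            exact (Real.sq_sqrt hf0).symm
      rw [this, Complex.ofReal_re, Real.sq_sqrt hf0]
      gcongr
      linarith

end Uhlmann

/-! ### Partial isometries -/

section PartialIsometry

variable {a b : Type*} [Fintype a] [DecidableEq a] [Fintype b]

/-- Forward: for `v` orthogonal to the kernel, u = A†Av − v is too, and norm preservation at v, u
and v + u gives Re⟨u, u⟩ = 0. Backward: idempotence puts v − A†Av in the kernel, so its
orthogonality to `v` says ‖v‖² = ‖Av‖². -/
theorem isPartialIsometry_iff_idempotent (A : Matrix b a ℂ) :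
    IsPartialIsometry A ↔ Aᴴ * A * (Aᴴ * A) = Aᴴ * A := by
  classical
  set f := Matrix.toEuclideanLin A with hf
  have hg : ∀ v, Matrix.toEuclideanLin (Aᴴ * A) v = LinearMap.adjoint f (f v) := fun v => by
    rw [hf, ← Matrix.toEuclideanLin_conjTranspose_eq_adjoint]
    simp [Matrix.toLpLin_apply]
  have hgg : ∀ v, Matrix.toEuclideanLin (Aᴴ * A * (Aᴴ * A)) v =
      LinearMap.adjoint f (f (LinearMap.adjoint f (f v))) := fun v => by
    rw [← hg, ← hg]
    simp [Matrix.toLpLin_apply]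
  constructor
  · intro h
    have hperp : ∀ v, LinearMap.adjoint f (f v) ∈ (LinearMap.ker f)ᗮ := fun v => by
      rw [Submodule.mem_orthogonal]
      intro u hu
      rw [LinearMap.adjoint_inner_right, LinearMap.mem_ker.mp hu, inner_zero_left]
    have key : ∀ v ∈ (LinearMap.ker f)ᗮ, LinearMap.adjoint f (f v) = v := by
      intro v hv
      rw [← sub_eq_zero]
      set u := LinearMap.adjoint f (f v) - v with hu
      have hum : u ∈ (LinearMap.ker f)ᗮ := Submodule.sub_mem _ (hperp v) hv
      have h1 := h (v + u) (Submodule.add_mem _ hv hum)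
      have h2 := congrArg (· ^ 2) h1
      rw [map_add, @norm_add_sq ℂ, @norm_add_sq ℂ, ← hf, h v hv, h u hum,
        ← LinearMap.adjoint_inner_left] at h2
      have h3 : RCLike.re (inner ℂ u u) = 0 := by
        conv_lhs => rw [hu]
        rw [inner_sub_left, map_sub]
        linarith
      rw [inner_self_eq_norm_sq (𝕜 := ℂ) u] at h3
      exact norm_eq_zero.mp (pow_eq_zero_iff two_ne_zero |>.mp h3)
    apply Matrix.toEuclideanLin.injective
    ext1 v
    rw [hgg, hg]
    exact key _ (hperp v)
  · intro h v hv
    have h1 : LinearMap.adjoint f (f (LinearMap.adjoint f (f v))) = LinearMap.adjoint f (f v) := by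
      rw [← hgg, h, hg]
    set w := v - LinearMap.adjoint f (f v) with hw
    have h2 : f w = 0 := by
      rw [← inner_self_eq_zero (𝕜 := ℂ), ← LinearMap.adjoint_inner_left]
      conv_lhs => rw [hw, map_sub, map_sub, h1, sub_self, inner_zero_left]
    have h3 : inner ℂ w v = 0 := (Submodule.mem_orthogonal _ _).mp hv w (LinearMap.mem_ker.mpr h2)
    rw [hw, inner_sub_left, LinearMap.adjoint_inner_left, sub_eq_zero, inner_self_eq_norm_sq_to_K,
      inner_self_eq_norm_sq_to_K] at h3
    have h4 : ‖v‖ ^ 2 = ‖f v‖ ^ 2 := by exact_mod_cast h3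
    exact ((sq_eq_sq₀ (norm_nonneg _) (norm_nonneg _)).mp h4).symm

theorem trace_eq_rank_of_idempotent {P : Matrix a a ℂ} (h : P * P = P) :
    P.trace = (P.rank : ℂ) := by
  have h1 : IsIdempotentElem (Matrix.toLin' P) := by
    rw [IsIdempotentElem, Module.End.mul_eq_comp, ← Matrix.toLin'_mul, h]
  have h2 := (LinearMap.IsIdempotentElem.isProj_range _ h1).trace
  rw [Matrix.trace_toLin'_eq] at h2
  rw [h2]
  rfl

theorem trace_conjTranspose_mul_self_eq_rank {A : Matrix b a ℂ}
    (h : Aᴴ * A * (Aᴴ * A) = Aᴴ * A) : (Aᴴ * A).trace = (A.rank : ℂ) := by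
  rw [trace_eq_rank_of_idempotent h, Matrix.rank_conjTranspose_mul_self]

omit [DecidableEq a] in
theorem conjTranspose_mul_self_mul_unitary (A : Matrix b a ℂ) (U : Matrix a a ℂ) :
    (A * U)ᴴ * (A * U) = Uᴴ * (Aᴴ * A) * U := by
  simp only [Matrix.conjTranspose_mul, Matrix.mul_assoc]

theorem IsPartialIsometryMeasurement.mul_unitary {l : ℕ}
    {A : Fin (Fintype.card a / l + 1) → Matrix (Fin l) a ℂ} (hA : IsPartialIsometryMeasurement A)
    (U : Matrix.unitaryGroup a ℂ) : IsPartialIsometryMeasurement fun j => A j * U.1 := by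
  obtain ⟨h1, h2, h3, h4, h5⟩ := hA
  have hU : U.1 * U.1ᴴ = 1 := Matrix.mem_unitaryGroup_iff.mp U.2
  have hU' : U.1ᴴ * U.1 = 1 := Matrix.mem_unitaryGroup_iff'.mp U.2
  have hr : ∀ j, (A j * U.1).rank = (A j).rank := fun j =>
    Matrix.rank_mul_eq_left_of_isUnit_det _ _
      ((Matrix.isUnit_iff_isUnit_det _).mp ⟨⟨U.1, U.1ᴴ, hU, hU'⟩, rfl⟩)
  refine ⟨fun j => ?_, fun j hj => by rw [hr, h2 j hj], by rw [hr, h3], by rw [hr]; exact h4, ?_⟩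
  · have h := (isPartialIsometry_iff_idempotent _).mp (h1 j)
    rw [isPartialIsometry_iff_idempotent, conjTranspose_mul_self_mul_unitary]
    calc _ = U.1ᴴ * (A j)ᴴ * A j * (U.1 * U.1ᴴ) * ((A j)ᴴ * A j) * U.1 := by
          simp only [Matrix.mul_assoc]
      _ = U.1ᴴ * ((A j)ᴴ * A j * ((A j)ᴴ * A j)) * U.1 := by
          rw [hU]; simp only [Matrix.mul_assoc, Matrix.one_mul]
      _ = _ := by rw [h]
  · simp only [conjTranspose_mul_self_mul_unitary]
    rw [← Finset.sum_mul, ← Finset.mul_sum, h5, Matrix.mul_one, hU']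

/-- Cut the basis into consecutive blocks of length `l`, each sent identically onto the output
basis; the incomplete last block goes to outcome 0. -/
theorem exists_isPartialIsometryMeasurement {l : ℕ} (hl : 0 < l) :
    ∃ A : Fin (Fintype.card a / l + 1) → Matrix (Fin l) a ℂ, IsPartialIsometryMeasurement A := by
  set d := Fintype.card a with hd
  let e : a ≃ Fin d := Fintype.equivFin a
  -- First index of the block of outcome `j`. Outcomes `j ≥ 1` are shifted by one since 0 is
  -- reserved for the remainder, which may be empty.
  let o : Fin (d / l + 1) → ℕ := fun j => if j = 0 then d / l * l else (j - 1 : ℕ) * l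
  let A : Fin (d / l + 1) → Matrix (Fin l) a ℂ := fun j =>
    Matrix.of fun t x => if (e x : ℕ) = o j + t then 1 else 0
  have hAA : ∀ j, (A j)ᴴ * A j =
      Matrix.diagonal fun x => if o j ≤ e x ∧ (e x : ℕ) < o j + l then (1 : ℂ) else 0 := by
    intro j
    ext x y
    simp only [Matrix.mul_apply, Matrix.conjTranspose_apply, A, Matrix.of_apply,
      Matrix.diagonal_apply, apply_ite star, star_one, star_zero, mul_ite, mul_one, mul_zero]
    by_cases hxy : x = y
    · subst hxy
      simp only [if_true]
      by_cases h : o j ≤ e x ∧ (e x : ℕ) < o j + l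
      · rw [if_pos h, Finset.sum_eq_single (⟨e x - o j, by omega⟩ : Fin l)]
        · have : (e x : ℕ) = o j + (e x - o j) := by omega
          simp [← this]
        · intro t _ ht
          have : (e x : ℕ) ≠ o j + t := fun h' => ht (Fin.ext (by simp; omega))
          simp [this]
        · simp
      · rw [if_neg h]
        refine Finset.sum_eq_zero fun t _ => ?_
        have : (e x : ℕ) ≠ o j + t := fun h' => h (by omega)
        simp [this]
    · rw [if_neg hxy]
      refine Finset.sum_eq_zero fun t _ => ?_
      split_ifs with h1 h2
      · exact absurd (e.injective (Fin.ext (h2.trans h1.symm))) hxy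
      · rfl
      · rfl
  have hidem : ∀ j, (A j)ᴴ * A j * ((A j)ᴴ * A j) = (A j)ᴴ * A j := by
    intro j
    rw [hAA, Matrix.diagonal_mul_diagonal]
    congr 1
    ext x
    split_ifs <;> simp
  have hone : ∑ j, (A j)ᴴ * A j = 1 := by
    simp only [hAA]
    ext x y
    rw [Matrix.sum_apply]
    by_cases hxy : x = y
    · subst hxy
      simp only [Matrix.diagonal_apply_eq, Matrix.one_apply_eq]
      have h0 := Nat.div_add_mod (e x : ℕ) l
      have h0' := Nat.mod_lt (e x : ℕ) hl
      have h0'' := Nat.div_add_mod d l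
      have h0''' := Nat.mod_lt d hl
      have hex := (e x).2
      have hq : (e x : ℕ) / l ≤ d / l := Nat.div_le_div_right hex.le
      rw [Finset.sum_eq_single (if h : (e x : ℕ) / l < d / l then
        (⟨(e x : ℕ) / l + 1, by omega⟩ : Fin (d / l + 1)) else 0)]
      · rw [if_pos]
        split_ifs with h
        · have : o ⟨(e x : ℕ) / l + 1, by omega⟩ = (e x : ℕ) / l * l := by
            simp only [o, Fin.ext_iff, Fin.val_zero, Nat.succ_ne_zero, if_false, Nat.add_sub_cancel]
          rw [this, mul_comm]; omega
        · have : o 0 = d / l * l := by simp [o]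
          have h' : (e x : ℕ) / l = d / l := by omega
          rw [this, ← h', mul_comm]; omega
      · intro j _ hj
        rw [if_neg]
        rintro ⟨h1, h2⟩
        apply hj
        by_cases hj0 : j = 0
        · subst hj0
          have : o 0 = d / l * l := by simp [o]
          rw [this] at h1
          have : d / l ≤ (e x : ℕ) / l := (Nat.le_div_iff_mul_le hl).mpr h1
          rw [dif_neg (by omega)]
        · have hj' : (j : ℕ) ≠ 0 := fun h => hj0 (Fin.ext h)
          have : o j = (j - 1 : ℕ) * l := by simp [o, hj0]
          rw [this] at h1 h2
          have h3 : (e x : ℕ) / l = j - 1 := by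
            apply Nat.div_eq_of_lt_le h1
            rw [Nat.add_mul, one_mul]; exact h2
          have := j.2
          rw [dif_pos (by omega)]
          exact Fin.ext (by simp; omega)
      · simp
    · simp [Matrix.diagonal_apply_ne _ hxy, Matrix.one_apply_ne hxy]
  have hrank : ∀ j, j ≠ 0 → (A j).rank = l := by
    intro j hj
    have h1 : A j * (A j)ᴴ = 1 := by
      ext s t
      have hb : ∀ s : Fin l, o j + s < d := fun s => by
        have : o j = (j - 1 : ℕ) * l := by simp [o, hj]
        have hj' : (j : ℕ) ≠ 0 := fun h => hj (Fin.ext h)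
        have h2 : (j - 1 : ℕ) * l + l ≤ d / l * l := by
          calc (j - 1 : ℕ) * l + l = ((j - 1 : ℕ) + 1) * l := by ring
            _ ≤ _ := Nat.mul_le_mul_right _ (by have := j.2; omega)
        have h3 := Nat.div_mul_le_self d l
        have := s.2
        omega
      simp only [Matrix.mul_apply, Matrix.conjTranspose_apply, A, Matrix.of_apply,
        Matrix.one_apply, apply_ite star, star_one, star_zero, mul_ite, mul_one, mul_zero]
      rw [Finset.sum_eq_single (e.symm ⟨o j + s, hb s⟩)]
      · simp [Fin.ext_iff]
      · intro x _ hx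
        have : (e x : ℕ) ≠ o j + s := fun h => hx (by rw [Equiv.eq_symm_apply]; exact Fin.ext h)
        simp [this]
      · simp
    have h2 := trace_conjTranspose_mul_self_eq_rank (hidem j)
    rw [Matrix.trace_mul_comm, h1, Matrix.trace_one, Fintype.card_fin] at h2
    exact_mod_cast h2.symm
  -- The trace of the completeness relation determines the last rank from the others.
  have hrank0 : (A 0).rank = d - d / l * l := by
    have h := congrArg Matrix.trace hone
    rw [Matrix.trace_sum, Matrix.trace_one, Fin.sum_univ_succ] at h
    simp only [trace_conjTranspose_mul_self_eq_rank (hidem _)] at h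
    simp only [hrank _ (Fin.succ_ne_zero _), Finset.sum_const, Finset.card_univ, Fintype.card_fin,
      nsmul_eq_mul] at h
    have h' : (A 0).rank + d / l * l = d := by exact_mod_cast h
    omega
  refine ⟨A, fun j => (isPartialIsometry_iff_idempotent _).mpr (hidem j), hrank, hrank0, ?_, hone⟩
  rw [hrank0]
  have h0'' := Nat.div_add_mod d l
  have h0''' := Nat.mod_lt d hl
  rw [mul_comm] at h0''
  omega

end PartialIsometry

/-! ### Moments of a random projector under the Haar measure -/

section Haar

variable {a : Type*} [Fintype a] [DecidableEq a]

instance : SecondCountableTopology (Matrix.unitaryGroup a ℂ) :=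
  have : SecondCountableTopology (Matrix a a ℂ) :=
    inferInstanceAs (SecondCountableTopology (a → a → ℂ))
  TopologicalSpace.Subtype.secondCountableTopology (Matrix.unitaryGroup a ℂ : Set (Matrix a a ℂ))

instance : IsProbabilityMeasure (haarUnitary a) :=
  ⟨Measure.haarMeasure_self⟩

instance : (haarUnitary a).IsMulLeftInvariant :=
  inferInstanceAs (Measure.haarMeasure ⊤).IsMulLeftInvariant

instance : (haarUnitary a).IsMulRightInvariant := by
  refine ⟨fun W => ?_⟩
  have hm : Measurable fun U : Matrix.unitaryGroup a ℂ => U * W :=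
    (continuous_mul_const W).measurable
  have : IsProbabilityMeasure ((haarUnitary a).map (· * W)) :=
    Measure.isProbabilityMeasure_map hm.aemeasurable
  -- A right translate of the measure is again a left-invariant probability measure, so uniqueness
  -- makes it equal to the original.
  have h := Measure.haarMeasure_unique ((haarUnitary a).map (· * W)) ⊤
  rw [TopologicalSpace.PositiveCompacts.coe_top, measure_univ, one_smul] at h
  exact h

theorem Continuous.integrable_haarUnitary {E : Type*} [NormedAddCommGroup E]
    {f : Matrix.unitaryGroup a ℂ → E} (hf : Continuous f) : Integrable f (haarUnitary a) :=
  hf.integrable_of_hasCompactSupport (HasCompactSupport.of_compactSpace f)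

/-- The conjugate `U† P U`. -/
def conjBy (P : Matrix a a ℂ) (U : Matrix.unitaryGroup a ℂ) : Matrix a a ℂ :=
  U.1ᴴ * P * U.1

theorem continuous_conjBy_apply (P : Matrix a a ℂ) (x y : a) :
    Continuous fun U => conjBy P U x y := by
  have : Continuous fun U => conjBy P U := by
    unfold conjBy
    have := continuous_subtype_val (p := fun U => U ∈ Matrix.unitaryGroup a ℂ)
    exact (this.matrix_conjTranspose.matrix_mul continuous_const).matrix_mul this
  exact this.matrix_elem x y

theorem conjBy_mul (P : Matrix a a ℂ) (U W : Matrix.unitaryGroup a ℂ) :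
    conjBy P (U * W) = W.1ᴴ * conjBy P U * W.1 := by
  simp only [conjBy, Submonoid.coe_mul, Matrix.conjTranspose_mul, Matrix.mul_assoc]

theorem trace_conjBy (P : Matrix a a ℂ) (U : Matrix.unitaryGroup a ℂ) :
    (conjBy P U).trace = P.trace := by
  rw [conjBy, Matrix.mul_assoc, Matrix.trace_mul_comm, Matrix.mul_assoc,
    ← Matrix.star_eq_conjTranspose, Matrix.mem_unitaryGroup_iff.mp U.2, Matrix.mul_one]

theorem conjBy_mul_self {P : Matrix a a ℂ} (hP : P * P = P) (U : Matrix.unitaryGroup a ℂ) :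
    conjBy P U * conjBy P U = conjBy P U := by
  have hU : U.1 * U.1ᴴ = 1 := Matrix.mem_unitaryGroup_iff.mp U.2
  calc _ = U.1ᴴ * P * (U.1 * U.1ᴴ) * P * U.1 := by simp only [conjBy, Matrix.mul_assoc]
    _ = U.1ᴴ * (P * P) * U.1 := by rw [hU]; simp only [Matrix.mul_assoc, Matrix.one_mul]
    _ = _ := by rw [hP, conjBy]

/-- The unitary that multiplies the basis vector `k` by `i`. -/
def phaseUnitary (k : a) : Matrix.unitaryGroup a ℂ :=
  ⟨Matrix.diagonal fun j => if j = k then Complex.I else 1, by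
    rw [Matrix.mem_unitaryGroup_iff, Matrix.star_eq_conjTranspose, Matrix.diagonal_conjTranspose,
      Matrix.diagonal_mul_diagonal, ← Matrix.diagonal_one]
    congr 1
    ext j
    simp only [Pi.star_apply]
    split_ifs <;> simp⟩

theorem phaseUnitary_conj (k : a) (G : Matrix a a ℂ) (x y : a) :
    ((phaseUnitary k).1ᴴ * G * (phaseUnitary k).1) x y =
      (if x = k then -Complex.I else 1) * (if y = k then Complex.I else 1) * G x y := by
  simp only [phaseUnitary, Matrix.diagonal_conjTranspose, Matrix.mul_diagonal,
    Matrix.diagonal_mul, Pi.star_apply, apply_ite star, Complex.star_def, Complex.conj_I, star_one]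
  ring

/-- The unitary that permutes the basis vectors. -/
def permUnitary (σ : Equiv.Perm a) : Matrix.unitaryGroup a ℂ :=
  ⟨σ⁻¹.permMatrix ℂ, by
    rw [Matrix.mem_unitaryGroup_iff, Matrix.star_eq_conjTranspose, Matrix.conjTranspose_permMatrix,
      inv_inv, ← Matrix.permMatrix_mul]
    simp⟩

theorem permUnitary_conj (σ : Equiv.Perm a) (G : Matrix a a ℂ) (x y : a) :
    ((permUnitary σ).1ᴴ * G * (permUnitary σ).1) x y = G (σ x) (σ y) := by
  simp only [permUnitary, Matrix.conjTranspose_permMatrix, inv_inv]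
  rw [Equiv.Perm.permMatrix, Equiv.Perm.permMatrix, PEquiv.toMatrix_toPEquiv_mul,
    PEquiv.mul_toMatrix_toPEquiv]
  rfl

/-- A rational reflection in the plane spanned by the basis vectors `x` and `z`. -/
def reflectionUnitary (x z : a) (h : x ≠ z) : Matrix.unitaryGroup a ℂ :=
  -- The squared length 5 yields the 3-4-5 reflection, which mixes the two basis vectors without
  -- square roots.
  let v : a → ℂ := Pi.single x 1 + Pi.single z 2
  ⟨1 - (2 / 5 : ℂ) • Matrix.vecMulVec v v, by
    have hv : v ⬝ᵥ v = 5 := by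
      simp [v, dotProduct_add, h, h.symm]; norm_num
    have hs : star v = v := by
      ext j; simp only [v, Pi.star_apply, Pi.add_apply, Pi.single_apply]; split_ifs <;> simp
    have h1 : Matrix.vecMulVec v v * Matrix.vecMulVec v v = (5 : ℂ) • Matrix.vecMulVec v v := by
      rw [Matrix.vecMulVec_mul_vecMulVec, hv, Matrix.vecMulVec_smul]
    rw [Matrix.mem_unitaryGroup_iff, Matrix.star_eq_conjTranspose, Matrix.conjTranspose_sub,
      Matrix.conjTranspose_smul, Matrix.conjTranspose_vecMulVec, hs, Matrix.conjTranspose_one]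
    simp only [Matrix.sub_mul, Matrix.mul_sub, Matrix.one_mul, Matrix.mul_one, Matrix.smul_mul,
      Matrix.mul_smul, h1, smul_smul]
    have : star (2 / 5 : ℂ) = 2 / 5 := by simp
    rw [this]
    module⟩

theorem reflectionUnitary_conj (x z : a) (h : x ≠ z) (G : Matrix a a ℂ) :
    ((reflectionUnitary x z h).1ᴴ * G * (reflectionUnitary x z h).1) x x =
      9 / 25 * G x x + 16 / 25 * G z z - 12 / 25 * (G x z + G z x) := by
  have hc : ∀ j, (reflectionUnitary x z h).1 j x =
      (if j = x then 3 / 5 else 0) + (if j = z then -(4 / 5) else 0) := fun j => by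
    simp only [reflectionUnitary, Matrix.sub_apply, Matrix.smul_apply, Matrix.vecMulVec_apply,
      Matrix.one_apply, Pi.add_apply, Pi.single_apply, if_true, if_neg h]
    by_cases h1 : j = x
    · subst h1; simp [h]; norm_num
    · by_cases h2 : j = z
      · subst h2; simp [h1]; norm_num
      · simp [h1, h2]
  have hcs : ∀ j, star ((reflectionUnitary x z h).1 j x) =
      (if j = x then 3 / 5 else 0) + (if j = z then -(4 / 5) else 0) := fun j => by
    rw [hc]; split_ifs <;> simp
  simp only [Matrix.mul_apply, Matrix.conjTranspose_apply, hcs]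
  simp only [hc, add_mul, mul_add, ite_mul,
    mul_ite, zero_mul, mul_zero, Finset.sum_add_distrib, Finset.sum_ite_eq', Finset.mem_univ,
    if_true]
  ring

theorem integral_haarUnitary_mul_right {E : Type*} [NormedAddCommGroup E] [NormedSpace ℝ E]
    (f : Matrix.unitaryGroup a ℂ → E) (W : Matrix.unitaryGroup a ℂ) :
    ∫ U, f (U * W) ∂haarUnitary a = ∫ U, f U ∂haarUnitary a :=
  integral_mul_right_eq_self f W

/-- Phase invariance kills the off-diagonal entries, and permutation invariance makes the diagonal
ones equal, with sum the trace. -/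
theorem integral_conjBy (P : Matrix a a ℂ) (x y : a) :
    ∫ U, conjBy P U x y ∂haarUnitary a = if x = y then P.trace / Fintype.card a else 0 := by
  have hperm : ∀ σ : Equiv.Perm a, ∫ U, conjBy P U (σ x) (σ x) ∂haarUnitary a =
      ∫ U, conjBy P U x x ∂haarUnitary a := fun σ => by
    rw [← integral_haarUnitary_mul_right (fun U => conjBy P U x x) (permUnitary σ)]
    simp only [conjBy_mul, permUnitary_conj]
  split_ifs with h
  · subst h
    have h1 : ∑ z, ∫ U, conjBy P U z z ∂haarUnitary a = P.trace := by
      rw [← integral_finsetSum _ fun z _ =>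
        (continuous_conjBy_apply P z z).integrable_haarUnitary]
      have : ∀ U, ∑ z, conjBy P U z z = P.trace := fun U => trace_conjBy P U
      simp [this]
    have h2 : ∀ z, ∫ U, conjBy P U z z ∂haarUnitary a = ∫ U, conjBy P U x x ∂haarUnitary a :=
      fun z => by simpa using hperm (Equiv.swap x z)
    have hd : (Fintype.card a : ℂ) ≠ 0 := by
      have : Nonempty a := ⟨x⟩
      exact_mod_cast Fintype.card_ne_zero
    simp only [h2, Finset.sum_const, Finset.card_univ, nsmul_eq_mul] at h1
    rw [← h1]
    field_simp
  · have h1 := integral_haarUnitary_mul_right (fun U => conjBy P U x y) (phaseUnitary x)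
    simp only [conjBy_mul, phaseUnitary_conj, if_true, if_neg (Ne.symm h), mul_one,
      integral_const_mul] at h1
    have h2 : (1 + Complex.I) * ∫ U, conjBy P U x y ∂haarUnitary a = 0 := by linear_combination -h1
    exact (mul_eq_zero.mp h2).resolve_left fun h => by simpa using congrArg Complex.re h

/-- The mean of two copies of a rotated projector is β·identity + α·swap. Instead of Schur–Weyl
duality, invariance under phases, permutations and one reflection is enough to force this form; the
two constants then follow from the trace of the projector and of its square. -/
theorem exists_integral_conjBy_mul_conjBy {P : Matrix a a ℂ} (hP : P * P = P) {l : ℕ}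
    (htr : P.trace = l) (hl : 1 ≤ l) (hld : l ≤ Fintype.card a) :
    ∃ α β : ℝ, 0 ≤ α ∧ 0 ≤ β ∧ α ≤ l / (Fintype.card a : ℝ) ^ 2 ∧
      β ≤ (l : ℝ) ^ 2 / (Fintype.card a : ℝ) ^ 2 ∧
      ∀ x y z w, ∫ U, conjBy P U x y * conjBy P U z w ∂haarUnitary a =
        (if x = y ∧ z = w then (β : ℂ) else 0) + if x = w ∧ y = z then (α : ℂ) else 0 := by
  set d := Fintype.card a with hd
  set m : a → a → a → a → ℂ := fun x y z w =>
    ∫ U, conjBy P U x y * conjBy P U z w ∂haarUnitary a with hm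
  have hint : ∀ x y z w, Integrable (fun U => conjBy P U x y * conjBy P U z w) (haarUnitary a) :=
    fun x y z w => ((continuous_conjBy_apply P x y).mul
      (continuous_conjBy_apply P z w)).integrable_haarUnitary
  have hperm : ∀ (σ : Equiv.Perm a) x y z w, m (σ x) (σ y) (σ z) (σ w) = m x y z w :=
    fun σ x y z w => by
      simp only [hm]
      rw [← integral_haarUnitary_mul_right (fun U => conjBy P U x y * conjBy P U z w)
        (permUnitary σ)]
      simp only [conjBy_mul, permUnitary_conj]
  -- The phase is i rather than −1, because an index may occur twice more among rows than among
  -- columns, and such a moment must pick up a factor different from 1.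
  have hphase : ∀ k x y z w, m x y z w =
      ((if x = k then -Complex.I else 1) * (if y = k then Complex.I else 1) *
        ((if z = k then -Complex.I else 1) * (if w = k then Complex.I else 1))) * m x y z w :=
    fun k x y z w => by
      simp only [hm]
      conv_lhs => rw [← integral_haarUnitary_mul_right
        (fun U => conjBy P U x y * conjBy P U z w) (phaseUnitary k)]
      rw [← integral_const_mul]
      simp only [conjBy_mul, phaseUnitary_conj]
      congr 1
      ext U
      ring
  have hne : ∀ {c t : ℂ}, t = c * t → (1 - c).re ≠ 0 → t = 0 := fun {c t} h hc => by
    have : (1 - c) * t = 0 := by linear_combination h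
    exact (mul_eq_zero.mp this).resolve_left fun h => hc (by rw [h]; rfl)
  have hvan : ∀ x y z w, ¬(x = y ∧ z = w) → ¬(x = w ∧ y = z) → m x y z w = 0 := by
    intro x y z w h1 h2
    by_cases hxy : x = y
    · subst hxy
      have hzw : w ≠ z := fun h => h1 ⟨rfl, h.symm⟩
      refine hne (hphase z x x z w) ?_
      by_cases hxz : x = z <;> simp [hxz, hzw]
    · by_cases hxw : x = w
      · subst hxw
        have hyz : y ≠ z := fun h => h2 ⟨rfl, h⟩
        refine hne (hphase z x y z x) ?_
        by_cases hxz : x = z <;> simp [hxz, hyz]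
      · refine hne (hphase x x y z w) ?_
        by_cases hxz : z = x <;> simp [hxz, Ne.symm hxy, Ne.symm hxw]
  have hsum1 : ∑ x, ∑ z, m x x z z = (l : ℂ) ^ 2 := by
    simp only [hm]
    simp_rw [← integral_finsetSum Finset.univ fun z _ => hint _ _ z z]
    rw [← integral_finsetSum Finset.univ fun x _ =>
      integrable_finsetSum Finset.univ fun z _ => hint x x z z]
    have : ∀ U, ∑ x, ∑ z, conjBy P U x x * conjBy P U z z = (l : ℂ) ^ 2 := fun U => by
      rw [← Finset.sum_mul_sum, sq, ← htr, ← trace_conjBy P U]; rfl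
    simp [this]
  have hsum2 : ∑ x, ∑ z, m x z z x = (l : ℂ) := by
    simp only [hm]
    simp_rw [← integral_finsetSum Finset.univ fun z _ => hint _ z z _]
    rw [← integral_finsetSum Finset.univ fun x _ =>
      integrable_finsetSum Finset.univ fun z _ => hint x z z x]
    have : ∀ U, ∑ x, ∑ z, conjBy P U x z * conjBy P U z x = (l : ℂ) := fun U => by
      rw [← htr, ← trace_conjBy P U]
      conv_rhs => rw [← conjBy_mul_self hP U]
      simp [Matrix.trace, Matrix.mul_apply]
    simp [this]
  have hl' : (1 : ℝ) ≤ l := by exact_mod_cast hl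
  have hld' : (l : ℝ) ≤ d := by exact_mod_cast hld
  rcases subsingleton_or_nontrivial a with hs | hs
  -- In dimension one identity and swap coincide and d(d² − 1) vanishes, so the constants are chosen
  -- by hand.
  · have hd1 : d = 1 := le_antisymm (Fintype.card_le_one_iff_subsingleton.mpr hs) (hl.trans hld)
    have hl1 : l = 1 := by omega
    obtain ⟨x0⟩ : Nonempty a := Fintype.card_pos_iff.mp (by omega)
    have : Unique a := ⟨⟨x0⟩, fun x => Subsingleton.elim _ _⟩
    refine ⟨1, 0, zero_le_one, le_rfl, by simp [hd1, hl1], by simp [hd1, hl1], fun x y z w => ?_⟩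
    rw [Fintype.sum_unique, Fintype.sum_unique, hl1] at hsum2
    simp only [hm, Nat.cast_one] at hsum2
    rw [Subsingleton.elim x default, Subsingleton.elim y default, Subsingleton.elim z default,
      Subsingleton.elim w default, hsum2]
    simp
  · obtain ⟨x0, z0, hxz⟩ := exists_pair_ne a
    have htrans : ∀ x z, x ≠ z → ∃ σ : Equiv.Perm a, σ x0 = x ∧ σ z0 = z := fun x z h => by
      refine ⟨(Equiv.swap x0 x).trans (Equiv.swap (Equiv.swap x0 x z0) z), ?_, by simp⟩
      have h1 : x ≠ Equiv.swap x0 x z0 := by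
        intro h'
        have := (Equiv.swap x0 x).injective ((Equiv.swap_apply_left x0 x).trans h')
        exact hxz this
      simp [Equiv.swap_apply_of_ne_of_ne h1 h]
    set B := m x0 x0 z0 z0 with hB
    set A := m x0 z0 z0 x0 with hA
    have hBc : ∀ x z, x ≠ z → m x x z z = B := fun x z h => by
      obtain ⟨σ, rfl, rfl⟩ := htrans x z h
      exact hperm σ _ _ _ _
    have hAc : ∀ x z, x ≠ z → m x z z x = A := fun x z h => by
      obtain ⟨σ, rfl, rfl⟩ := htrans x z h
      exact hperm σ _ _ _ _
    have hγ : ∀ x, m x x x x = m x0 x0 x0 x0 := fun x => by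
      simpa using hperm (Equiv.swap x0 x) x0 x0 x0 x0
    -- Phases and permutations leave three free constants. Reflection invariance of the fourth,
    -- fully diagonal type of moment reads γ = (337/625)γ + (288/625)(A + B), which removes one;
    -- hence the coefficient 625/288 below.
    have hγ' : m x0 x0 x0 x0 = A + B := by
      have h := integral_haarUnitary_mul_right (fun U => conjBy P U x0 x0 * conjBy P U x0 x0)
        (reflectionUnitary x0 z0 hxz)
      simp only [conjBy_mul, reflectionUnitary_conj] at h
      have e : ∀ U, (9 / 25 * conjBy P U x0 x0 + 16 / 25 * conjBy P U z0 z0 -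
          12 / 25 * (conjBy P U x0 z0 + conjBy P U z0 x0)) * (9 / 25 * conjBy P U x0 x0 +
          16 / 25 * conjBy P U z0 z0 - 12 / 25 * (conjBy P U x0 z0 + conjBy P U z0 x0)) =
          ∑ i : Fin 4, ∑ j : Fin 4, (![9 / 25, 16 / 25, -12 / 25, -12 / 25] i *
            ![9 / 25, 16 / 25, -12 / 25, -12 / 25] j : ℂ) *
            (conjBy P U (![x0, z0, x0, z0] i) (![x0, z0, z0, x0] i) *
              conjBy P U (![x0, z0, x0, z0] j) (![x0, z0, z0, x0] j)) := fun U => by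
        simp [Fin.sum_univ_succ]
        ring
      simp only [e] at h
      rw [integral_finsetSum Finset.univ fun i _ => integrable_finsetSum Finset.univ fun j _ =>
        (hint _ _ _ _).const_mul _] at h
      simp_rw [integral_finsetSum Finset.univ fun j _ => (hint _ _ _ _).const_mul _,
        integral_const_mul] at h
      change ∑ i : Fin 4, ∑ j : Fin 4, (_ * _) * m _ _ _ _ = m x0 x0 x0 x0 at h
      simp only [Fin.sum_univ_four, Matrix.cons_val] at h
      rw [hγ z0, hBc x0 z0 hxz, hBc z0 x0 hxz.symm, hAc x0 z0 hxz, hAc z0 x0 hxz.symm] at h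
      have v : ∀ x y z w, ¬(x = y ∧ z = w) → ¬(x = w ∧ y = z) → m x y z w = 0 := hvan
      rw [v x0 x0 x0 z0, v x0 x0 z0 x0, v z0 z0 x0 z0, v z0 z0 z0 x0, v x0 z0 x0 x0, v x0 z0 z0 z0,
        v x0 z0 x0 z0, v z0 x0 x0 x0, v z0 x0 z0 z0, v z0 x0 z0 x0] at h
      · linear_combination (-625 / 288 : ℂ) * h
      all_goals simp [hxz, hxz.symm]
    have hmm : ∀ x y z w, m x y z w =
        (if x = y ∧ z = w then B else 0) + if x = w ∧ y = z then A else 0 := by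
      intro x y z w
      by_cases h1 : x = y ∧ z = w
      · obtain ⟨rfl, rfl⟩ := h1
        by_cases h2 : x = z
        · subst h2; simp [hγ, hγ', add_comm]
        · simp [h2, hBc x z h2]
      · by_cases h2 : x = w ∧ y = z
        · obtain ⟨rfl, rfl⟩ := h2
          have h3 : x ≠ y := fun h => h1 ⟨h, h.symm⟩
          simp [h3, hAc x y h3]
        · simp [h1, h2, hvan x y z w h1 h2]
    have hd2 : (2 : ℝ) ≤ d := by exact_mod_cast Fintype.one_lt_card
    -- This is (Tr P)² = l²; the next equation is Tr P² = l. Together they determine `A` and `B`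
    -- when d ≥ 2.
    have e1 : B * d ^ 2 + A * d = (l : ℂ) ^ 2 := by
      rw [← hsum1]
      simp only [hmm, and_self, if_true, Finset.sum_add_distrib, Finset.sum_const,
        Finset.card_univ, nsmul_eq_mul, ← hd, Finset.sum_ite_eq, Finset.mem_univ]
      ring
    have e2 : B * d + A * d ^ 2 = (l : ℂ) := by
      rw [← hsum2]
      have : ∀ x z : a, (x = z ∧ z = x) ↔ x = z := fun x z => ⟨fun h => h.1, fun h => ⟨h, h.symm⟩⟩
      simp only [hmm, this, and_self, if_true, Finset.sum_add_distrib, Finset.sum_const,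
        Finset.card_univ, nsmul_eq_mul, ← hd, Finset.sum_ite_eq, Finset.mem_univ]
      ring
    have hD : (0 : ℝ) < d * (d ^ 2 - 1) := by
      have : (0 : ℝ) < d ^ 2 - 1 := by nlinarith
      positivity
    have hDc : (d : ℂ) * (d ^ 2 - 1) ≠ 0 := by exact_mod_cast hD.ne'
    have hAr : A = ((l * (d - l) / (d * (d ^ 2 - 1)) : ℝ) : ℂ) := by
      push_cast
      rw [eq_div_iff hDc]
      linear_combination (d : ℂ) * e2 - e1
    have hBr : B = ((l * (l * d - 1) / (d * (d ^ 2 - 1)) : ℝ) : ℂ) := by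
      push_cast
      rw [eq_div_iff hDc]
      linear_combination (d : ℂ) * e1 - e2
    have hdp : (0 : ℝ) < d := by linarith
    refine ⟨l * (d - l) / (d * (d ^ 2 - 1)), l * (l * d - 1) / (d * (d ^ 2 - 1)), ?_, ?_, ?_, ?_,
      fun x y z w => ?_⟩
    · exact div_nonneg (mul_nonneg (by linarith) (by linarith)) hD.le
    · exact div_nonneg (mul_nonneg (by linarith) (by nlinarith)) hD.le
    · rw [div_le_div_iff₀ hD (by positivity)]
      have h1 : (d - l) * (d : ℝ) ≤ d ^ 2 - 1 := by nlinarith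
      calc _ = (l * d : ℝ) * ((d - l) * d) := by ring
        _ ≤ (l * d : ℝ) * (d ^ 2 - 1) := by gcongr
        _ = _ := by ring
    · rw [div_le_div_iff₀ hD (by positivity)]
      have h1 : (l * d - 1) * (d : ℝ) ≤ l * (d ^ 2 - 1) := by nlinarith
      calc _ = (l * d : ℝ) * ((l * d - 1) * d) := by ring
        _ ≤ (l * d : ℝ) * (l * (d ^ 2 - 1)) := by gcongr
        _ = _ := by ring
    · rw [← hAr, ← hBr, ← hmm]

end Haar

/-! ### Kraus operators -/

section Kraus

variable {a b c s : Type*} [Fintype a] [Fintype b] [Fintype c] [Fintype s] [DecidableEq s]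

namespace SuperOp

omit [Fintype b] in
theorem kraus_apply (A : Matrix b a ℂ) (M : Matrix a a ℂ) : kraus A M = A * M * Aᴴ := rfl

omit [Fintype b] in
theorem actFst_kraus (A : Matrix b a ℂ) :
    (kraus A).actFst s = kraus (A ⊗ₖ (1 : Matrix s s ℂ)) := by
  ext1 M
  ext ⟨y, t⟩ ⟨y', t'⟩
  simp [actFst, kraus_apply, Matrix.mul_apply, Fintype.sum_prod_type, Matrix.one_apply,
    apply_ite (starRingEnd ℂ)]

omit [Fintype b] in
theorem actSnd_kraus (A : Matrix b a ℂ) :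
    (kraus A).actSnd s = kraus ((1 : Matrix s s ℂ) ⊗ₖ A) := by
  ext1 M
  ext ⟨t, y⟩ ⟨t', y'⟩
  simp [actSnd, kraus_apply, Matrix.mul_apply, Fintype.sum_prod_type, Matrix.one_apply,
    apply_ite (starRingEnd ℂ)]

omit [Fintype c] in
theorem kraus_comp_kraus (A : Matrix c b ℂ) (A' : Matrix b a ℂ) :
    kraus A ∘ₗ kraus A' = kraus (A * A') := by
  ext1 M
  simp only [LinearMap.comp_apply, kraus_apply, Matrix.conjTranspose_mul, Matrix.mul_assoc]

theorem kraus_pureState (A : Matrix b a ℂ) (v : a → ℂ) :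
    kraus A (pureState v) = pureState (A *ᵥ v) := by
  rw [kraus_apply, pureState, pureState, Matrix.mul_vecMulVec, Matrix.vecMulVec_mul,
    Matrix.star_mulVec]

omit [Fintype a] [Fintype b] [Fintype s] [DecidableEq s] in
theorem actFst_sum {κ : Type*} (t : Finset κ) (E : κ → SuperOp a b) :
    (∑ k ∈ t, E k).actFst s = ∑ k ∈ t, (E k).actFst s := by
  ext M y y'
  simp [actFst, LinearMap.sum_apply, Matrix.sum_apply]

omit [Fintype a] [Fintype b] [Fintype s] [DecidableEq s] in
theorem actSnd_sum {κ : Type*} (t : Finset κ) (E : κ → SuperOp a b) :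
    (∑ k ∈ t, E k).actSnd s = ∑ k ∈ t, (E k).actSnd s := by
  ext M y y'
  simp [actSnd, LinearMap.sum_apply, Matrix.sum_apply]

theorem isCP_kraus (A : Matrix b a ℂ) : (kraus A).IsCP := by
  intro n M hM
  rw [actFst_kraus, kraus_apply]
  exact hM.mul_mul_conjTranspose_same _

omit [Fintype a] [Fintype b] in
theorem isCP_sum {κ : Type*} (t : Finset κ) (E : κ → SuperOp a b) (h : ∀ k, (E k).IsCP) :
    (∑ k ∈ t, E k).IsCP := by
  intro n M hM
  rw [actFst_sum, LinearMap.sum_apply]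
  exact Matrix.posSemidef_sum _ fun k _ => h k n M hM

theorem isChannel_sum_kraus {κ : Type*} [Fintype κ] [DecidableEq a] (A : κ → Matrix b a ℂ)
    (h : ∑ k, (A k)ᴴ * A k = 1) : (∑ k, kraus (A k)).IsChannel := by
  refine ⟨isCP_sum _ _ fun k => isCP_kraus _, fun M => ?_⟩
  rw [LinearMap.sum_apply, Matrix.trace_sum]
  calc _ = ∑ k, ((A k)ᴴ * A k * M).trace := Finset.sum_congr rfl fun k _ => by
        rw [kraus_apply, Matrix.mul_assoc, Matrix.trace_mul_comm, Matrix.mul_assoc,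
          Matrix.trace_mul_comm]
    _ = _ := by rw [← Matrix.trace_sum, ← Finset.sum_mul, h, Matrix.one_mul]

theorem isInstrument_kraus {κ : Type*} [Fintype κ] [DecidableEq a] (A : κ → Matrix b a ℂ)
    (h : ∑ k, (A k)ᴴ * A k = 1) : IsInstrument fun k => kraus (A k) :=
  ⟨fun _ => isCP_kraus _, isChannel_sum_kraus A h⟩

end SuperOp

end Kraus

/-! ### Tensor products of families of Kraus operators. -/

section PiKronecker

variable {ι : Type*} [Fintype ι] [DecidableEq ι] {X Y Z : ι → Type*}
  [∀ i, Fintype (X i)] [∀ i, DecidableEq (X i)] [∀ i, Fintype (Y i)] [∀ i, DecidableEq (Y i)]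

/-- The tensor product `⨂ᵢ Aᵢ` of matrices. -/
def piKronecker {X Y : ι → Type*} (A : ∀ i, Matrix (Y i) (X i) ℂ) :
    Matrix (∀ i, Y i) (∀ i, X i) ℂ :=
  Matrix.of fun y x => ∏ i, A i (y i) (x i)

omit [DecidableEq ι] [∀ i, Fintype (X i)] [∀ i, DecidableEq (X i)] [∀ i, Fintype (Y i)]
  [∀ i, DecidableEq (Y i)] in
theorem piKronecker_conjTranspose (A : ∀ i, Matrix (Y i) (X i) ℂ) :
    (piKronecker A)ᴴ = piKronecker fun i => (A i)ᴴ := by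
  ext x y
  simp [piKronecker]

omit [∀ i, Fintype (X i)] [∀ i, DecidableEq (X i)] [∀ i, DecidableEq (Y i)] in
theorem piKronecker_mul (A : ∀ i, Matrix (Z i) (Y i) ℂ) (A' : ∀ i, Matrix (Y i) (X i) ℂ) :
    piKronecker A * piKronecker A' = piKronecker fun i => A i * A' i := by
  ext z x
  simp only [piKronecker, Matrix.mul_apply, Matrix.of_apply, ← Finset.prod_mul_distrib]
  rw [Finset.prod_univ_sum, Fintype.piFinset_univ]

omit [DecidableEq ι] [∀ i, Fintype (X i)] in
theorem piKronecker_one : piKronecker (fun i => (1 : Matrix (X i) (X i) ℂ)) = 1 := by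
  ext x y
  simp only [piKronecker, Matrix.of_apply, Matrix.one_apply, Finset.prod_ite_zero,
    Finset.mem_univ, true_imp_iff, Finset.prod_const_one, funext_iff]

omit [∀ i, Fintype (X i)] [∀ i, DecidableEq (X i)] [∀ i, Fintype (Y i)]
  [∀ i, DecidableEq (Y i)] in
theorem piKronecker_sum {J : ι → Type*} [∀ i, Fintype (J i)] (A : ∀ i, J i → Matrix (Y i) (X i) ℂ) :
    ∑ j : ∀ i, J i, piKronecker (fun i => A i (j i)) = piKronecker fun i => ∑ j, A i j := by
  ext y x
  simp only [piKronecker, Matrix.sum_apply, Matrix.of_apply]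
  rw [Finset.prod_univ_sum, Fintype.piFinset_univ]

theorem SuperOp.piTensor_kraus (A : ∀ i, Matrix (Y i) (X i) ℂ) :
    (SuperOp.piTensor fun i => SuperOp.kraus (A i)) = SuperOp.kraus (piKronecker A) := by
  ext1 M
  ext y y'
  have h : ∀ i (x x' : X i), SuperOp.kraus (A i) (Matrix.single x x' 1) (y i) (y' i) =
      A i (y i) x * star (A i (y' i) x') := fun i x x' => by
    rw [SuperOp.kraus_apply, Matrix.mul_apply, Finset.sum_eq_single x']
    · simp
    · intro z _ hz
      simp [Matrix.mul_single_apply_of_ne _ _ _ _ _ hz]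
    · simp
  simp only [SuperOp.piTensor, LinearMap.coe_mk, AddHom.coe_mk, Matrix.of_apply, h,
    Finset.prod_mul_distrib]
  simp only [SuperOp.kraus_apply, Matrix.mul_apply, piKronecker, Matrix.of_apply,
    Matrix.conjTranspose_apply, star_prod, Finset.sum_mul]
  rw [Finset.sum_comm]
  exact Finset.sum_congr rfl fun _ _ => Finset.sum_congr rfl fun _ _ => by ring

end PiKronecker

/-- The triangle inequality bounds the variation by the trace norm of the difference, and the
Hilbert–Schmidt norm, visibly continuous in the entries, dominates that. -/
theorem continuous_traceNorm_comp {a α : Type*} [Fintype a] [DecidableEq a] [TopologicalSpace α]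
    {F : α → Matrix a a ℂ} (hF : Continuous F) (hH : ∀ u, (F u).IsHermitian) :
    Continuous fun u => traceNorm (F u) := by
  rw [continuous_iff_continuousAt]
  intro u
  rw [ContinuousAt, tendsto_iff_dist_tendsto_zero]
  have hle : ∀ u', dist (traceNorm (F u')) (traceNorm (F u)) ≤
      √(Fintype.card a) * √(((F u' - F u)ᴴ * (F u' - F u)).trace.re) := fun u' => by
    refine le_trans ?_ (traceNorm_le_sqrt_card_mul ((hH u').sub (hH u)))
    rw [Real.dist_eq, abs_le]
    have h1 := traceNorm_add_le ((hH u').sub (hH u)) (hH u)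
    have h2 := traceNorm_add_le ((hH u).sub (hH u')) (hH u')
    rw [sub_add_cancel] at h1 h2
    rw [← neg_sub, traceNorm_neg] at h2
    constructor <;> linarith
  refine squeeze_zero (fun _ => dist_nonneg) hle ?_
  have hc : Continuous fun u' =>
      √(Fintype.card a) * √(((F u' - F u)ᴴ * (F u' - F u)).trace.re) := by
    have h := hF.sub (continuous_const (y := F u))
    exact continuous_const.mul (Complex.continuous_re.comp
      (h.matrix_conjTranspose.matrix_mul h).matrix_trace).sqrt
  have := hc.tendsto u
  simpa using this

/-! ### Outcome states and reduced states of the merging problem -/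

section States

/-- The vector `v` of `x ⊗ s ⊗ r` as a matrix from `s` to `x ⊗ r`. -/
def vecMat {x s r : Type*} (v : (x × s) × r → ℂ) : Matrix (x × r) s ℂ :=
  Matrix.of fun p t => v ((p.1, t), p.2)

section Generic

variable {x y s r : Type*} [Fintype x] [Fintype y] [Fintype s] [Fintype r] [DecidableEq r]
  [DecidableEq s]

omit [Fintype y] in
theorem vecMat_kronecker_mulVec (M : Matrix y x ℂ) (v : (x × s) × r → ℂ) :
    vecMat (((M ⊗ₖ (1 : Matrix s s ℂ)) ⊗ₖ (1 : Matrix r r ℂ)) *ᵥ v) =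
      (M ⊗ₖ (1 : Matrix r r ℂ)) * vecMat v := by
  ext ⟨y, k⟩ t
  simp [vecMat, Matrix.mulVec, dotProduct, Matrix.mul_apply, Fintype.sum_prod_type,
    Matrix.one_apply]

omit [Fintype x] [Fintype r] [DecidableEq r] [DecidableEq s] in
theorem partialTraceSnd_pureState (v : (x × s) × r → ℂ) :
    partialTraceSnd ((pureState v).submatrix (fun p : (x × r) × s => ((p.1.1, p.2), p.1.2))
      (fun p => ((p.1.1, p.2), p.1.2))) = vecMat v * (vecMat v)ᴴ := by
  ext ⟨a, k⟩ ⟨a', k'⟩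
  simp [partialTraceSnd, pureState, Matrix.vecMulVec_apply, vecMat, Matrix.mul_apply]

omit [DecidableEq r] [DecidableEq s] in
theorem trace_partialTraceFst (M : Matrix (x × r) (x × r) ℂ) :
    (partialTraceFst M).trace = M.trace := by
  simp [partialTraceFst, Matrix.trace, Fintype.sum_prod_type_right]

end Generic

variable {ι : Type*} [Fintype ι] [DecidableEq ι] {C : ι → Type*} [∀ i, Fintype (C i)]
  [∀ i, DecidableEq (C i)] {B R : Type*} [Fintype B] [DecidableEq B] [Fintype R] [DecidableEq R]
  {K L : ι → ℕ}

set_option synthInstance.maxSize 512 in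
theorem outcomeState_kraus {J : ι → Type*} [∀ i, Fintype (J i)]
    (ψ : EuclideanSpace ℂ ((∀ i, C i) × B × R))
    (A : ∀ i, J i → Matrix (Fin (L i)) (C i × Fin (K i)) ℂ) (j : ∀ i, J i) :
    outcomeState ψ (fun i k => SuperOp.kraus (A i k)) j =
      ((piKronecker fun i => A i (j i)) ⊗ₖ (1 : Matrix R R ℂ)) *
        (vecMat (initialVec ψ K) * (vecMat (initialVec ψ K))ᴴ) *
        ((piKronecker fun i => A i (j i)) ⊗ₖ (1 : Matrix R R ℂ))ᴴ := by
  rw [outcomeState, SuperOp.piTensor_kraus, SuperOp.actFst_kraus, SuperOp.actFst_kraus,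
    SuperOp.kraus_pureState]
  rw [partialTraceSnd_pureState, vecMat_kronecker_mulVec, Matrix.conjTranspose_mul]
  simp only [Matrix.mul_assoc]

/-- The reduced state of `ψ` on the senders and the reference. -/
def reducedCR (ψ : EuclideanSpace ℂ ((∀ i, C i) × B × R)) :
    Matrix ((∀ i, C i) × R) ((∀ i, C i) × R) ℂ :=
  Matrix.of fun p q => ∑ b, ψ (p.1, b, p.2) * star (ψ (q.1, b, q.2))

omit [∀ i, DecidableEq (C i)] [DecidableEq B] [Fintype R] [DecidableEq R] in
theorem partialTraceFst_reducedCR (ψ : EuclideanSpace ℂ ((∀ i, C i) × B × R)) :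
    partialTraceFst (reducedCR ψ) = reducedR ψ := by
  ext r r'
  simp only [partialTraceFst, reducedCR, reducedR, pureState, Matrix.of_apply,
    Matrix.vecMulVec_apply, Pi.star_apply]
  rw [Finset.sum_comm]

theorem trace_reducedR {ψ : EuclideanSpace ℂ ((∀ i, C i) × B × R)} (hψ : ‖ψ‖ = 1) :
    (reducedR ψ).trace = 1 := by
  have h : ∑ p, ‖ψ p‖ ^ 2 = 1 := by
    rw [← EuclideanSpace.norm_sq_eq, hψ, one_pow]
  have h' : (∑ p, ψ p * star (ψ p)) = 1 := by
    rw [← Complex.ofReal_one, ← h]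
    push_cast
    exact Finset.sum_congr rfl fun p _ => Complex.mul_conj' _
  rw [← h', ← partialTraceFst_reducedCR, trace_partialTraceFst]
  simp only [Matrix.trace, Matrix.diag_apply, reducedCR, Matrix.of_apply, Fintype.sum_prod_type]
  exact Finset.sum_congr rfl fun c _ => Finset.sum_comm

theorem sum_maxEntangled_mul_star {n : ℕ} (k k' : Fin n) :
    ∑ t, maxEntangled n k t * star (maxEntangled n k' t) =
      if k = k' then (n : ℂ)⁻¹ else 0 := by
  rw [Finset.sum_eq_single k]
  · simp only [maxEntangled, if_true, apply_ite star, star_zero, mul_ite, mul_zero,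
      eq_comm (a := k')]
    congr 1
    rw [star_inv₀, Complex.star_def, Complex.conj_ofReal, ← mul_inv, ← Complex.ofReal_mul,
      Real.mul_self_sqrt (Nat.cast_nonneg _), Complex.ofReal_natCast]
  · intro t _ ht
    simp [maxEntangled, Ne.symm ht]
  · simp

theorem sum_prod_maxEntangled (k k' : ∀ i, Fin (K i)) :
    ∑ t : ∀ i, Fin (K i), (∏ i, maxEntangled (K i) (k i) (t i)) *
        star (∏ i, maxEntangled (K i) (k' i) (t i)) =
      ∏ i, if k i = k' i then (K i : ℂ)⁻¹ else 0 := by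
  simp only [star_prod, ← Finset.prod_mul_distrib, ← sum_maxEntangled_mul_star]
  rw [Finset.prod_univ_sum, Fintype.piFinset_univ]

/-- Tracing out the receiver leaves each half of Φ^{K i} maximally mixed, in product with the
reduced state of ψ. -/
theorem vecMat_initialVec_apply (ψ : EuclideanSpace ℂ ((∀ i, C i) × B × R))
    (p q : (∀ i, C i × Fin (K i)) × R) :
    (vecMat (initialVec ψ K) * (vecMat (initialVec ψ K))ᴴ) p q =
      reducedCR ψ (fun i => (p.1 i).1, p.2) (fun i => (q.1 i).1, q.2) *
        ∏ i, if (p.1 i).2 = (q.1 i).2 then (K i : ℂ)⁻¹ else 0 := by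
  rw [← sum_prod_maxEntangled (fun i => (p.1 i).2) (fun i => (q.1 i).2)]
  simp only [Matrix.mul_apply, vecMat, initialVec, Matrix.of_apply, Matrix.conjTranspose_apply,
    Fintype.sum_prod_type, reducedCR, Finset.sum_mul_sum, star_mul']
  exact Finset.sum_congr rfl fun _ _ => Finset.sum_congr rfl fun _ _ => by ring

/-- The target of merging purifies the ideal decoupled state, with the receiver as purifying system.
This is what lets Uhlmann's theorem produce decoders. -/
theorem vecMat_targetVec (ψ : EuclideanSpace ℂ ((∀ i, C i) × B × R)) :
    vecMat (targetVec ψ L) * (vecMat (targetVec ψ L))ᴴ =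
      maximallyMixed (∀ i, Fin (L i)) ⊗ₖ reducedR ψ := by
  ext ⟨l, r⟩ ⟨l', r'⟩
  have h : maximallyMixed (∀ i, Fin (L i)) l l' = ∏ i, if l i = l' i then (L i : ℂ)⁻¹ else 0 := by
    simp only [maximallyMixed, Fintype.card_pi, Fintype.card_fin, Matrix.smul_apply,
      Matrix.one_apply, smul_eq_mul, Finset.prod_ite_zero, Finset.mem_univ, true_imp_iff,
      Finset.prod_inv_distrib, funext_iff, mul_ite, mul_one, mul_zero, Nat.cast_prod]
  rw [Matrix.kroneckerMap_apply, h, ← sum_prod_maxEntangled, ← partialTraceFst_reducedCR]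
  simp only [Matrix.mul_apply, vecMat, targetVec, Matrix.of_apply, Matrix.conjTranspose_apply,
    Fintype.sum_prod_type, reducedCR, partialTraceFst, Finset.sum_mul_sum, star_mul']
  simp only [Finset.mul_sum]
  refine Finset.sum_congr rfl fun _ _ => ?_
  exact Finset.sum_congr rfl fun _ _ => Finset.sum_congr rfl fun _ _ => by ring

theorem sum_pi_prod {M : Type*} [AddCommMonoid M] {Y Z : ι → Type*} [∀ i, Fintype (Y i)]
    [∀ i, Fintype (Z i)] (f : (∀ i, Y i × Z i) → M) :
    ∑ x, f x = ∑ y : ∀ i, Y i, ∑ z : ∀ i, Z i, f fun i => (y i, z i) := by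
  rw [← Fintype.sum_prod_type']
  exact Fintype.sum_equiv (Equiv.arrowProdEquivProdArrow ι Y Z) _ _ fun _ => rfl

theorem partialTraceFst_initialVec (hK : ∀ i, 0 < K i)
    (ψ : EuclideanSpace ℂ ((∀ i, C i) × B × R)) :
    partialTraceFst (vecMat (initialVec ψ K) * (vecMat (initialVec ψ K))ᴴ) = reducedR ψ := by
  ext r r'
  rw [← partialTraceFst_reducedCR]
  simp only [partialTraceFst, Matrix.of_apply, vecMat_initialVec_apply, if_true, sum_pi_prod,
    Finset.sum_const, Finset.card_univ, Fintype.card_pi, Fintype.card_fin, nsmul_eq_mul,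
    Finset.prod_inv_distrib, Nat.cast_prod]
  refine Finset.sum_congr rfl fun c _ => ?_
  have : (∏ i, (K i : ℂ)) ≠ 0 := Finset.prod_ne_zero_iff.mpr fun i _ => by
    exact_mod_cast (hK i).ne'
  field_simp

/-- The swap overlap `Tr[(σ ⊗ σ) (F_T ⊗ F_R)]`, where `F_T` and `F_R` exchange the two copies of the
systems in `T` and of the reference. -/
def swapOverlap {X : ι → Type*} [∀ i, Fintype (X i)] (σ : Matrix ((∀ i, X i) × R) ((∀ i, X i) × R) ℂ)
    (T : Finset ι) : ℂ :=
  ∑ x : ∀ i, X i, ∑ z : ∀ i, X i, ∑ r, ∑ r',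
    σ (x, r) (T.piecewise z x, r') * σ (z, r') (T.piecewise x z, r)

theorem swapOverlap_empty {X : ι → Type*} [∀ i, Fintype (X i)]
    (σ : Matrix ((∀ i, X i) × R) ((∀ i, X i) × R) ℂ) :
    swapOverlap σ ∅ = (partialTraceFst σ * partialTraceFst σ).trace := by
  simp only [swapOverlap, Finset.piecewise_empty, Matrix.trace, Matrix.diag_apply, Matrix.mul_apply,
    partialTraceFst, Matrix.of_apply, Finset.sum_mul_sum]
  calc _ = ∑ x : ∀ i, X i, ∑ r, ∑ r', ∑ z : ∀ i, X i, σ (x, r) (x, r') * σ (z, r') (z, r) := by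
        refine Finset.sum_congr rfl fun x _ => ?_
        rw [Finset.sum_comm]
        exact Finset.sum_congr rfl fun r _ => Finset.sum_comm
    _ = _ := by
        rw [Finset.sum_comm]
        exact Finset.sum_congr rfl fun r _ => Finset.sum_comm

/-- The overlap factorizes: a maximally mixed ancilla contributes its purity 1/K when its copies are
swapped and its trace 1 when they are not. -/
theorem swapOverlap_initialVec (hK : ∀ i, 0 < K i) (ψ : EuclideanSpace ℂ ((∀ i, C i) × B × R))
    (T : Finset ι) :
    swapOverlap (vecMat (initialVec ψ K) * (vecMat (initialVec ψ K))ᴴ) T =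
      (∏ i ∈ T, (K i : ℂ)⁻¹) * swapOverlap (reducedCR ψ) T := by
  have hpw : ∀ (c e : ∀ i, C i) (k h : ∀ i, Fin (K i)),
      T.piecewise (fun i => (e i, h i)) (fun i => (c i, k i)) =
        fun i => (T.piecewise e c i, T.piecewise h k i) := fun c e k h => by
    ext i <;> by_cases hi : i ∈ T <;> simp [hi]
  have hsum : ∑ k : ∀ i, Fin (K i), ∑ h : ∀ i, Fin (K i),
      (∏ i, if k i = T.piecewise h k i then (K i : ℂ)⁻¹ else 0) *
        (∏ i, if h i = T.piecewise k h i then (K i : ℂ)⁻¹ else 0) = ∏ i ∈ T, (K i : ℂ)⁻¹ := by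
    have h1 : ∀ k h : ∀ i, Fin (K i), (∏ i, if k i = T.piecewise h k i then (K i : ℂ)⁻¹ else 0) *
        (∏ i, if h i = T.piecewise k h i then (K i : ℂ)⁻¹ else 0) =
        ∏ i, (if i ∈ T then (if k i = h i then (K i : ℂ)⁻¹ * (K i : ℂ)⁻¹ else 0)
          else (K i : ℂ)⁻¹ * (K i : ℂ)⁻¹) := fun k h => by
      rw [← Finset.prod_mul_distrib]
      refine Finset.prod_congr rfl fun i _ => ?_
      by_cases hi : i ∈ T
      · by_cases hkh : k i = h i <;> simp [hi, hkh]
      · simp [hi]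
    simp only [h1]
    have h2 : ∀ k : ∀ i, Fin (K i), ∑ h : ∀ i, Fin (K i),
        ∏ i, (if i ∈ T then (if k i = h i then (K i : ℂ)⁻¹ * (K i : ℂ)⁻¹ else 0)
          else (K i : ℂ)⁻¹ * (K i : ℂ)⁻¹) =
        ∏ i, (if i ∈ T then (K i : ℂ)⁻¹ * (K i : ℂ)⁻¹ else (K i : ℂ)⁻¹) := fun k => by
      rw [← Fintype.piFinset_univ, ← Finset.prod_univ_sum (fun _ => Finset.univ) fun i t =>
        (if i ∈ T then (if k i = t then (K i : ℂ)⁻¹ * (K i : ℂ)⁻¹ else 0)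
          else (K i : ℂ)⁻¹ * (K i : ℂ)⁻¹)]
      refine Finset.prod_congr rfl fun i _ => ?_
      have : (K i : ℂ) ≠ 0 := by exact_mod_cast (hK i).ne'
      by_cases hi : i ∈ T
      · simp [hi]
      · simp [hi, this]
    simp only [h2, Finset.sum_const, Finset.card_univ, Fintype.card_pi, Fintype.card_fin,
      nsmul_eq_mul, Nat.cast_prod, ← Finset.prod_mul_distrib]
    rw [← Finset.prod_subset (Finset.subset_univ T)]
    · refine Finset.prod_congr rfl fun i hi => ?_
      have : (K i : ℂ) ≠ 0 := by exact_mod_cast (hK i).ne'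
      simp [hi, this]
    · intro i _ hi
      have : (K i : ℂ) ≠ 0 := by exact_mod_cast (hK i).ne'
      simp [hi, this]
  rw [← hsum]
  simp only [swapOverlap, sum_pi_prod, vecMat_initialVec_apply, hpw]
  have hfac : ∀ (P : (∀ i, Fin (K i)) → (∀ i, Fin (K i)) → ℂ) (q : (∀ i, C i) → (∀ i, C i) → ℂ),
      ∑ c, ∑ k, ∑ e, ∑ h, P k h * q c e = (∑ k, ∑ h, P k h) * ∑ c, ∑ e, q c e := fun P q => by
    simp only [← Finset.mul_sum, ← Finset.sum_mul]
  rw [← hfac]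
  refine Finset.sum_congr rfl fun c _ => Finset.sum_congr rfl fun k _ =>
    Finset.sum_congr rfl fun e _ => Finset.sum_congr rfl fun h _ => ?_
  simp only [Finset.mul_sum]
  exact Finset.sum_congr rfl fun r _ => Finset.sum_congr rfl fun r' _ => by ring

theorem sum_comm_five {a₁ a₂ a₃ a₄ a₅ M : Type*} [Fintype a₁] [Fintype a₂] [Fintype a₃]
    [Fintype a₄] [Fintype a₅] [AddCommMonoid M] (f : a₁ → a₂ → a₃ → a₄ → a₅ → M) :
    ∑ w, ∑ u, ∑ w', ∑ r, ∑ r', f w u w' r r' = ∑ r, ∑ u, ∑ r', ∑ w, ∑ w', f w u w' r r' := by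
  calc _ = ∑ w, ∑ r, ∑ u, ∑ r', ∑ w', f w u w' r r' := by
        refine Finset.sum_congr rfl fun w _ => ?_
        refine Eq.trans (Finset.sum_congr rfl fun u _ => ?_) Finset.sum_comm
        rw [Finset.sum_comm]
        exact Finset.sum_congr rfl fun r _ => Finset.sum_comm
    _ = _ := by
        rw [Finset.sum_comm]
        refine Finset.sum_congr rfl fun r _ => ?_
        rw [Finset.sum_comm]
        exact Finset.sum_congr rfl fun u _ => Finset.sum_comm

/-- The swap trick: senders outside `T` are traced out separately in each copy, and swapping
everything that remains computes the purity. -/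
theorem swapOverlap_reducedCR (ψ : EuclideanSpace ℂ ((∀ i, C i) × B × R)) (T : Finset ι) :
    swapOverlap (reducedCR ψ) T = (reducedRT ψ T ^ 2).trace := by
  let e := Equiv.piEquivPiSubtypeProd (· ∈ T) C
  have hpw : ∀ u u' w w', T.piecewise (e.symm (u', w')) (e.symm (u, w)) = e.symm (u', w) := by
    intro u u' w w'
    ext i
    by_cases hi : i ∈ T <;> simp [e, hi, Equiv.piEquivPiSubtypeProd]
  have hred : ∀ u u' r r', reducedRT ψ T (u, r) (u', r') =
      ∑ w, reducedCR ψ (e.symm (u, w), r) (e.symm (u', w), r') := by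
    intro u u' r r'
    simp [reducedRT, partialTraceSnd, pureState, Matrix.vecMulVec_apply, reducedCR,
      Fintype.sum_prod_type, e]
  have hs : ∀ f : (∀ i, C i) → ℂ, ∑ c, f c = ∑ u, ∑ w, f (e.symm (u, w)) := fun f => by
    rw [← Fintype.sum_prod_type', ← e.symm.sum_comp]
  simp only [swapOverlap, hs, hpw, sq, Matrix.trace, Matrix.diag_apply, Matrix.mul_apply,
    Fintype.sum_prod_type, hred, Finset.sum_mul_sum]
  refine Finset.sum_congr rfl fun u _ => ?_
  exact sum_comm_five fun w u' w' r r' => reducedCR ψ (e.symm (u, w), r) (e.symm (u', w), r') *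
    reducedCR ψ (e.symm (u', w'), r') (e.symm (u, w'), r)

theorem trace_reducedRT_sq (ψ : EuclideanSpace ℂ ((∀ i, C i) × B × R)) (T : Finset ι) :
    (reducedRT ψ T ^ 2).trace = ((reducedRT ψ T ^ 2).trace.re : ℂ) ∧
      0 ≤ (reducedRT ψ T ^ 2).trace.re := by
  have hH : (reducedRT ψ T)ᴴ = reducedRT ψ T := by
    ext p q
    simp only [Matrix.conjTranspose_apply, reducedRT, partialTraceSnd, Matrix.of_apply, pureState,
      Matrix.vecMulVec_apply, star_sum, star_mul', Pi.star_apply, star_star]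
    exact Finset.sum_congr rfl fun _ _ => mul_comm _ _
  have h := (Matrix.posSemidef_conjTranspose_mul_self (reducedRT ψ T)).trace_nonneg
  rw [hH, ← sq, Complex.nonneg_iff] at h
  exact ⟨Complex.ext rfl (by simpa using h.2.symm), h.1⟩

end States

/-! ### Average of the decoupling error over random unitaries -/

section Average

variable {ι : Type*} [Fintype ι] [DecidableEq ι] {X : ι → Type*} [∀ i, Fintype (X i)]
  [∀ i, DecidableEq (X i)] {R : Type*} [Fintype R] [DecidableEq R] {L : ι → ℕ}

/-- The state of `⨂ᵢ ℂ^{Lᵢ} ⊗ R` after the unitaries `U` and the Kraus operators `V`. -/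
def rotatedOutcome (σ : Matrix ((∀ i, X i) × R) ((∀ i, X i) × R) ℂ)
    (V : ∀ i, Matrix (Fin (L i)) (X i) ℂ) (U : ∀ i, Matrix.unitaryGroup (X i) ℂ) :
    Matrix ((∀ i, Fin (L i)) × R) ((∀ i, Fin (L i)) × R) ℂ :=
  ((piKronecker fun i => V i * (U i).1) ⊗ₖ (1 : Matrix R R ℂ)) * σ *
    ((piKronecker fun i => V i * (U i).1) ⊗ₖ (1 : Matrix R R ℂ))ᴴ

/-- The tensor product of the randomly rotated projectors `Uᵢ† Vᵢ† Vᵢ Uᵢ`. -/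
def piConjBy (V : ∀ i, Matrix (Fin (L i)) (X i) ℂ) (U : ∀ i, Matrix.unitaryGroup (X i) ℂ) :
    Matrix (∀ i, X i) (∀ i, X i) ℂ :=
  piKronecker fun i => conjBy ((V i)ᴴ * V i) (U i)

theorem Continuous.integrable_pi_haarUnitary {E : Type*} [NormedAddCommGroup E]
    {f : (∀ i, Matrix.unitaryGroup (X i) ℂ) → E} (hf : Continuous f) :
    Integrable f (Measure.pi fun i => haarUnitary (X i)) :=
  hf.integrable_of_hasCompactSupport (HasCompactSupport.of_compactSpace f)

theorem continuous_rotatedOutcome (σ : Matrix ((∀ i, X i) × R) ((∀ i, X i) × R) ℂ)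
    (V : ∀ i, Matrix (Fin (L i)) (X i) ℂ) : Continuous (rotatedOutcome σ V) := by
  have hA : Continuous fun U : ∀ i, Matrix.unitaryGroup (X i) ℂ =>
      (piKronecker fun i => V i * (U i).1) ⊗ₖ (1 : Matrix R R ℂ) := by
    refine continuous_matrix fun p q => ?_
    simp only [Matrix.kroneckerMap_apply, piKronecker, Matrix.of_apply]
    refine Continuous.mul (continuous_finsetProd _ fun i _ => ?_) continuous_const
    exact (continuous_const.matrix_mul
      (continuous_subtype_val.comp (continuous_apply i))).matrix_elem _ _
  exact (hA.matrix_mul continuous_const).matrix_mul hA.matrix_conjTranspose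

theorem rotatedOutcome_posSemidef {σ : Matrix ((∀ i, X i) × R) ((∀ i, X i) × R) ℂ}
    (hσ : σ.PosSemidef) (V : ∀ i, Matrix (Fin (L i)) (X i) ℂ)
    (U : ∀ i, Matrix.unitaryGroup (X i) ℂ) : (rotatedOutcome σ V U).PosSemidef :=
  hσ.mul_mul_conjTranspose_same _

theorem piKronecker_conjTranspose_mul_self (V : ∀ i, Matrix (Fin (L i)) (X i) ℂ)
    (U : ∀ i, Matrix.unitaryGroup (X i) ℂ) :
    (piKronecker fun i => V i * (U i).1)ᴴ * (piKronecker fun i => V i * (U i).1) =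
      piConjBy V U := by
  simp only [piKronecker_conjTranspose, piKronecker_mul, conjTranspose_mul_self_mul_unitary]
  rfl

theorem continuous_piConjBy_apply (V : ∀ i, Matrix (Fin (L i)) (X i) ℂ) (x y : ∀ i, X i) :
    Continuous fun U => piConjBy V U x y := by
  simp only [piConjBy, piKronecker, Matrix.of_apply]
  exact continuous_finsetProd _ fun i _ =>
    (continuous_conjBy_apply _ _ _).comp (continuous_apply i)

theorem trace_rotatedOutcome_mul (σ : Matrix ((∀ i, X i) × R) ((∀ i, X i) × R) ℂ)
    (V : ∀ i, Matrix (Fin (L i)) (X i) ℂ) (U : ∀ i, Matrix.unitaryGroup (X i) ℂ)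
    (A : Matrix R R ℂ) :
    (rotatedOutcome σ V U * ((1 : Matrix (∀ i, Fin (L i)) (∀ i, Fin (L i)) ℂ) ⊗ₖ A)).trace =
      ∑ x, ∑ y, piConjBy V U x y * ∑ r, ∑ r', A r r' * σ (y, r') (x, r) := by
  set M := piKronecker fun i => V i * (U i).1 with hM
  have h : (rotatedOutcome σ V U * ((1 : Matrix (∀ i, Fin (L i)) (∀ i, Fin (L i)) ℂ) ⊗ₖ A)).trace =
      ((piConjBy V U ⊗ₖ A) * σ).trace := by
    rw [rotatedOutcome, ← hM, Matrix.conjTranspose_kronecker, Matrix.conjTranspose_one,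
      Matrix.mul_assoc, Matrix.mul_assoc, Matrix.trace_mul_comm, Matrix.mul_assoc,
      Matrix.trace_mul_comm]
    simp only [← Matrix.mul_kronecker_mul, Matrix.mul_one, Matrix.one_mul]
    rw [hM, piKronecker_conjTranspose_mul_self]
  rw [h]
  simp only [Matrix.trace, Matrix.diag_apply, Matrix.mul_apply, Fintype.sum_prod_type,
    Matrix.kroneckerMap_apply, Finset.mul_sum]
  refine Finset.sum_congr rfl fun x _ => ?_
  rw [Finset.sum_comm]
  exact Finset.sum_congr rfl fun y _ => Finset.sum_congr rfl fun r _ =>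
    Finset.sum_congr rfl fun r' _ => by ring

/-- Cyclicity of the trace joins each Kraus operator with its adjoint, so the purity depends on the
unitaries only through two copies of the rotated projector. -/
theorem trace_rotatedOutcome_mul_self (σ : Matrix ((∀ i, X i) × R) ((∀ i, X i) × R) ℂ)
    (V : ∀ i, Matrix (Fin (L i)) (X i) ℂ) (U : ∀ i, Matrix.unitaryGroup (X i) ℂ) :
    (rotatedOutcome σ V U * rotatedOutcome σ V U).trace =
      ∑ a, ∑ b, ∑ c, ∑ d, piConjBy V U a b * piConjBy V U c d *
        ∑ r, ∑ r', σ (b, r) (c, r') * σ (d, r') (a, r) := by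
  set M := piKronecker fun i => V i * (U i).1 with hM
  set N := piConjBy V U ⊗ₖ (1 : Matrix R R ℂ) with hN
  have hMN : (M ⊗ₖ (1 : Matrix R R ℂ))ᴴ * (M ⊗ₖ (1 : Matrix R R ℂ)) = N := by
    rw [Matrix.conjTranspose_kronecker, Matrix.conjTranspose_one, ← Matrix.mul_kronecker_mul,
      Matrix.mul_one, hM, piKronecker_conjTranspose_mul_self]
  have h : (rotatedOutcome σ V U * rotatedOutcome σ V U).trace = (N * σ * (N * σ)).trace := by
    rw [rotatedOutcome, ← hM, ← hMN]
    simp only [Matrix.mul_assoc]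
    rw [Matrix.trace_mul_comm]
    simp only [Matrix.mul_assoc]
    rw [Matrix.trace_mul_comm σ]
    simp only [Matrix.mul_assoc]
  have hNσ : ∀ a d r r', (N * σ) (a, r) (d, r') = ∑ b, piConjBy V U a b * σ (b, r) (d, r') := by
    intro a d r r'
    simp [hN, Matrix.mul_apply, Fintype.sum_prod_type, Matrix.kroneckerMap_apply, Matrix.one_apply]
  rw [h]
  simp only [Matrix.trace, Matrix.diag_apply, Matrix.mul_apply (M := N * σ),
    Fintype.sum_prod_type, hNσ, Finset.sum_mul_sum]
  refine Finset.sum_congr rfl fun a _ => ?_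
  simp only [Finset.mul_sum]
  rw [sum_comm_five fun b c d r r' => piConjBy V U a b * piConjBy V U c d *
    (σ (b, r) (c, r') * σ (d, r') (a, r))]
  exact Finset.sum_congr rfl fun r _ => Finset.sum_congr rfl fun c _ => Finset.sum_congr rfl
    fun r' _ => Finset.sum_congr rfl fun b _ => Finset.sum_congr rfl fun d _ => by ring

theorem integral_piConjBy (V : ∀ i, Matrix (Fin (L i)) (X i) ℂ) (x y : ∀ i, X i) :
    ∫ U, piConjBy V U x y ∂(Measure.pi fun i => haarUnitary (X i)) =
      if x = y then ∏ i, ((V i)ᴴ * V i).trace / Fintype.card (X i) else 0 := by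
  simp only [piConjBy, piKronecker, Matrix.of_apply]
  rw [integral_fintype_prod_eq_prod (fun i U => conjBy ((V i)ᴴ * V i) U (x i) (y i))]
  simp only [integral_conjBy, Finset.prod_ite_zero, Finset.mem_univ, true_imp_iff, funext_iff]

theorem integral_trace_rotatedOutcome_mul (σ : Matrix ((∀ i, X i) × R) ((∀ i, X i) × R) ℂ)
    (V : ∀ i, Matrix (Fin (L i)) (X i) ℂ) (A : Matrix R R ℂ) :
    ∫ U, (rotatedOutcome σ V U * ((1 : Matrix (∀ i, Fin (L i)) (∀ i, Fin (L i)) ℂ) ⊗ₖ A)).trace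
        ∂(Measure.pi fun i => haarUnitary (X i)) =
      (∏ i, ((V i)ᴴ * V i).trace / Fintype.card (X i)) * (A * partialTraceFst σ).trace := by
  have hint : ∀ x y, Integrable (fun U => piConjBy V U x y * ∑ r, ∑ r', A r r' * σ (y, r') (x, r))
      (Measure.pi fun i => haarUnitary (X i)) := fun x y =>
    ((continuous_piConjBy_apply V x y).mul continuous_const).integrable_pi_haarUnitary
  simp only [trace_rotatedOutcome_mul]
  rw [integral_finsetSum Finset.univ fun x _ => integrable_finsetSum Finset.univ fun y _ => hint x y]
  simp_rw [integral_finsetSum Finset.univ fun y _ => hint _ y, integral_mul_const,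
    integral_piConjBy, ite_mul, zero_mul, Finset.sum_ite_eq, Finset.mem_univ, if_true,
    ← Finset.mul_sum]
  congr 1
  simp only [Matrix.trace, Matrix.diag_apply, Matrix.mul_apply, partialTraceFst, Matrix.of_apply,
    Finset.mul_sum]
  rw [Finset.sum_comm]
  exact Finset.sum_congr rfl fun r _ => Finset.sum_comm

/-- Independence makes the moment a product over senders of two-term sums, expanded over the set `T`
where the β term is taken. The purity already contains one swap of the outputs, so the identity term
β leaves the inputs in `T` swapped, while the swap term α undoes it. -/
theorem integral_trace_rotatedOutcome_mul_self (σ : Matrix ((∀ i, X i) × R) ((∀ i, X i) × R) ℂ)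
    (V : ∀ i, Matrix (Fin (L i)) (X i) ℂ) (α β : ι → ℝ)
    (hm : ∀ i x y z w, ∫ U, conjBy ((V i)ᴴ * V i) U x y * conjBy ((V i)ᴴ * V i) U z w
        ∂haarUnitary (X i) =
      (if x = y ∧ z = w then (β i : ℂ) else 0) + if x = w ∧ y = z then (α i : ℂ) else 0) :
    ∫ U, (rotatedOutcome σ V U * rotatedOutcome σ V U).trace
        ∂(Measure.pi fun i => haarUnitary (X i)) =
      ∑ T : Finset ι, (∏ i ∈ T, (β i : ℂ)) * (∏ i ∈ Finset.univ \ T, (α i : ℂ)) *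
        swapOverlap σ T := by
  have hmom : ∀ a b c d : ∀ i, X i, ∫ U, piConjBy V U a b * piConjBy V U c d
      ∂(Measure.pi fun i => haarUnitary (X i)) =
      ∑ T : Finset ι, if a = T.piecewise b d then if c = T.piecewise d b then
        (∏ i ∈ T, (β i : ℂ)) * ∏ i ∈ Finset.univ \ T, (α i : ℂ) else 0 else 0 := by
    intro a b c d
    simp only [piConjBy, piKronecker, Matrix.of_apply, ← Finset.prod_mul_distrib]
    rw [integral_fintype_prod_eq_prod (fun i U => conjBy ((V i)ᴴ * V i) U (a i) (b i) *
      conjBy ((V i)ᴴ * V i) U (c i) (d i))]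
    simp only [hm, Finset.prod_add, Finset.powerset_univ]
    refine Finset.sum_congr rfl fun T _ => ?_
    rw [Finset.prod_ite_zero, Finset.prod_ite_zero, ← ite_and]
    have h1 : (a = T.piecewise b d ∧ c = T.piecewise d b) ↔
        (∀ i ∈ T, a i = b i ∧ c i = d i) ∧ ∀ i ∈ Finset.univ \ T, a i = d i ∧ b i = c i := by
      constructor
      · rintro ⟨rfl, rfl⟩
        exact ⟨fun i hi => by simp [hi], fun i hi => by simp [(Finset.mem_sdiff.mp hi).2]⟩
      · rintro ⟨h1, h2⟩
        constructor <;> ext i <;> by_cases hi : i ∈ T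
        · simp [hi, (h1 i hi).1]
        · simp [hi, (h2 i (by simp [hi])).1]
        · simp [hi, (h1 i hi).2]
        · simp [hi, (h2 i (by simp [hi])).2]
    by_cases h2 : a = T.piecewise b d ∧ c = T.piecewise d b
    · rw [if_pos h2, if_pos (h1.mp h2).1, if_pos (h1.mp h2).2]
    · rw [if_neg h2]
      by_cases h3 : ∀ i ∈ T, a i = b i ∧ c i = d i
      · rw [if_neg fun h4 => h2 (h1.mpr ⟨h3, h4⟩), mul_zero]
      · rw [if_neg h3, zero_mul]
  have hint : ∀ a b c d, Integrable (fun U => piConjBy V U a b * piConjBy V U c d *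
      ∑ r, ∑ r', σ (b, r) (c, r') * σ (d, r') (a, r)) (Measure.pi fun i => haarUnitary (X i)) :=
    fun a b c d => (((continuous_piConjBy_apply V a b).mul (continuous_piConjBy_apply V c d)).mul
      continuous_const).integrable_pi_haarUnitary
  simp only [trace_rotatedOutcome_mul_self]
  rw [integral_finsetSum Finset.univ fun a _ => integrable_finsetSum Finset.univ fun b _ =>
    integrable_finsetSum Finset.univ fun c _ => integrable_finsetSum Finset.univ fun d _ =>
    hint a b c d]
  simp_rw [integral_finsetSum Finset.univ fun b _ =>
    integrable_finsetSum Finset.univ fun c _ => integrable_finsetSum Finset.univ fun d _ =>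
    hint _ b c d, integral_finsetSum Finset.univ fun c _ => integrable_finsetSum Finset.univ
    fun d _ => hint _ _ c d, integral_finsetSum Finset.univ fun d _ => hint _ _ _ d,
    integral_mul_const, hmom, Finset.sum_mul]
  calc _ = ∑ T : Finset ι, ∑ b : ∀ i, X i, ∑ d : ∀ i, X i, ∑ a : ∀ i, X i, ∑ c : ∀ i, X i,
        (if a = T.piecewise b d then if c = T.piecewise d b then
        (∏ i ∈ T, (β i : ℂ)) * ∏ i ∈ Finset.univ \ T, (α i : ℂ) else 0 else 0) *
          ∑ r, ∑ r', σ (b, r) (c, r') * σ (d, r') (a, r) := by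
        rw [← sum_comm_five fun a b c T d => (if a = T.piecewise b d then
          if c = T.piecewise d b then (∏ i ∈ T, (β i : ℂ)) * ∏ i ∈ Finset.univ \ T, (α i : ℂ)
          else 0 else 0) * ∑ r, ∑ r', σ (b, r) (c, r') * σ (d, r') (a, r)]
        exact Finset.sum_congr rfl fun a _ => Finset.sum_congr rfl fun b _ =>
          Finset.sum_congr rfl fun c _ => Finset.sum_comm
    _ = _ := by
        refine Finset.sum_congr rfl fun T _ => ?_
        rw [swapOverlap, Finset.mul_sum]
        refine Finset.sum_congr rfl fun b _ => ?_
        rw [Finset.mul_sum]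
        refine Finset.sum_congr rfl fun d _ => ?_
        rw [Finset.sum_eq_single (T.piecewise b d), Finset.sum_eq_single (T.piecewise d b)]
        · simp
        · intro c _ hc; simp [hc]
        · simp
        · intro a _ ha; simp [ha]
        · simp

end Average

/-! ### Second-moment bound for outcomes of full rank. -/

section GoodOutcome

variable {ι : Type*} [Fintype ι] [DecidableEq ι] {X : ι → Type*} [∀ i, Fintype (X i)]
  [∀ i, DecidableEq (X i)] {R : Type*} [Fintype R] [DecidableEq R] {L : ι → ℕ}

/-- The bound on α alone makes the term of the empty set at most the subtracted one; every index in
`T` costs one further factor l. -/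
theorem sum_prod_moments_sub_le {d l α β : ι → ℝ} (hα : ∀ i, 0 ≤ α i) (hβ : ∀ i, 0 ≤ β i)
    (hα' : ∀ i, α i ≤ l i / d i ^ 2) (hβ' : ∀ i, β i ≤ l i ^ 2 / d i ^ 2) {q : Finset ι → ℝ} (hq : ∀ T, 0 ≤ q T) :
    (∑ T : Finset ι, (∏ i ∈ T, β i) * (∏ i ∈ Finset.univ \ T, α i) * q T) -
        (∏ i, l i / d i ^ 2) * q ∅ ≤
      (∏ i, l i / d i ^ 2) * ∑ T : Finset ι with T.Nonempty, (∏ i ∈ T, l i) * q T := by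
  have hT : ∀ T : Finset ι, (∏ i ∈ T, β i) * (∏ i ∈ Finset.univ \ T, α i) ≤
      (∏ i, l i / d i ^ 2) * ∏ i ∈ T, l i := fun T => by
    rw [← Finset.prod_sdiff (Finset.subset_univ T), mul_assoc, ← Finset.prod_mul_distrib, mul_comm]
    refine mul_le_mul (Finset.prod_le_prod (fun i _ => hα i) fun i _ => hα' i)
      (Finset.prod_le_prod (fun i _ => hβ i) fun i _ => (hβ' i).trans (le_of_eq (by ring)))
      (Finset.prod_nonneg fun i _ => hβ i) (Finset.prod_nonneg fun i _ => (hα i).trans (hα' i))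
  rw [← Finset.sum_filter_add_sum_filter_not Finset.univ (fun T : Finset ι => T.Nonempty),
    Finset.mul_sum]
  have he : (Finset.univ.filter fun T : Finset ι => ¬T.Nonempty) = {∅} := by
    ext T
    simp [Finset.not_nonempty_iff_eq_empty]
  rw [he, Finset.sum_singleton]
  have h0 := mul_le_mul_of_nonneg_right (hT ∅) (hq ∅)
  have h1 : ∑ T : Finset ι with T.Nonempty, (∏ i ∈ T, β i) * (∏ i ∈ Finset.univ \ T, α i) * q T ≤
      ∑ T : Finset ι with T.Nonempty, (∏ i, l i / d i ^ 2) * ((∏ i ∈ T, l i) * q T) :=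
    Finset.sum_le_sum fun T _ => by
      rw [← mul_assoc]
      exact mul_le_mul_of_nonneg_right (hT T) (hq T)
  simp only [Finset.prod_empty, mul_one] at h0
  simp only [Finset.prod_empty]
  linarith

theorem integral_le_sqrt_integral_sq {α : Type*} [MeasurableSpace α] {μ : Measure α}
    [IsProbabilityMeasure μ] {f : α → ℝ} (hf : Integrable f μ)
    (hf2 : Integrable (fun x => f x ^ 2) μ) : ∫ x, f x ∂μ ≤ √(∫ x, f x ^ 2 ∂μ) := by
  apply Real.le_sqrt_of_sq_le
  have h : 0 ≤ ∫ x, (f x - ∫ y, f y ∂μ) ^ 2 ∂μ := integral_nonneg fun x => sq_nonneg _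
  have e : ∀ x, (f x - ∫ y, f y ∂μ) ^ 2 =
      f x ^ 2 - 2 * (∫ y, f y ∂μ) * f x + (∫ y, f y ∂μ) ^ 2 := fun x => by ring
  simp only [e] at h
  have h1 : Integrable (fun x => f x ^ 2 - 2 * (∫ y, f y ∂μ) * f x) μ := hf2.sub (hf.const_mul _)
  rw [integral_add h1 (integrable_const _),
    integral_sub hf2 (hf.const_mul _), integral_const_mul, integral_const, probReal_univ,
    one_smul] at h
  linarith

/-- The subtracted matrix is the Haar mean of the outcome state. The trace norm is bounded by the
Hilbert–Schmidt norm, and Jensen's inequality reduces the claim to the variance. -/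
theorem integral_traceNorm_rotatedOutcome_sub_le {σ : Matrix ((∀ i, X i) × R) ((∀ i, X i) × R) ℂ}
    (hσ : σ.PosSemidef) (V : ∀ i, Matrix (Fin (L i)) (X i) ℂ)
    (hV : ∀ i, (V i)ᴴ * V i * ((V i)ᴴ * V i) = (V i)ᴴ * V i) (hr : ∀ i, (V i).rank = L i)
    (hL : ∀ i, 0 < L i) {q : Finset ι → ℝ} (hq : ∀ T, 0 ≤ q T)
    (hqσ : ∀ T, swapOverlap σ T = (q T : ℂ)) :
    ∫ U, traceNorm (rotatedOutcome σ V U -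
          ((∏ i, (Fintype.card (X i) : ℝ)⁻¹ : ℝ) : ℂ) • ((1 : Matrix _ _ ℂ) ⊗ₖ partialTraceFst σ))
        ∂(Measure.pi fun i => haarUnitary (X i)) ≤
      (∏ i, (L i : ℝ) / Fintype.card (X i)) *
        √((Fintype.card R : ℝ) * ∑ T : Finset ι with T.Nonempty, (∏ i ∈ T, (L i : ℝ)) * q T) := by
  have htr : ∀ i, ((V i)ᴴ * V i).trace = L i := fun i => by
    rw [trace_conjTranspose_mul_self_eq_rank (hV i), hr]
  have hLd : ∀ i, L i ≤ Fintype.card (X i) := fun i => by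
    rw [← hr i]; exact Matrix.rank_le_card_width _
  choose α β hα hβ hα' hβ' hm using fun i =>
    exists_integral_conjBy_mul_conjBy (hV i) (htr i) (hL i) (hLd i)
  set ρ := partialTraceFst σ with hρ
  have hρH : ρ.IsHermitian := by
    ext r r'
    simp only [hρ, partialTraceFst, Matrix.conjTranspose_apply, Matrix.of_apply, star_sum]
    exact Finset.sum_congr rfl fun x _ => congrFun (congrFun hσ.1 (x, r)) (x, r')
  set e : ℝ := ∏ i, (Fintype.card (X i) : ℝ)⁻¹ with he
  set Z : Matrix ((∀ i, Fin (L i)) × R) ((∀ i, Fin (L i)) × R) ℂ := (e : ℂ) • ((1 : Matrix _ _ ℂ) ⊗ₖ ρ)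
    with hZ
  have hZH : Z.IsHermitian := by
    rw [Matrix.IsHermitian, hZ, Matrix.conjTranspose_smul, Matrix.conjTranspose_kronecker,
      Matrix.conjTranspose_one, hρH.eq, Complex.star_def, Complex.conj_ofReal]
  set μ := Measure.pi fun i => haarUnitary (X i) with hμ
  have hω : Continuous (rotatedOutcome σ V) := continuous_rotatedOutcome σ V
  have hωH : ∀ U, (rotatedOutcome σ V U - Z).IsHermitian := fun U =>
    (rotatedOutcome_posSemidef hσ V U).1.sub hZH
  set f : (∀ i, Matrix.unitaryGroup (X i) ℂ) → ℝ := fun U => traceNorm (rotatedOutcome σ V U - Z)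
    with hf
  set s : (∀ i, Matrix.unitaryGroup (X i) ℂ) → ℂ := fun U =>
    ((rotatedOutcome σ V U - Z)ᴴ * (rotatedOutcome σ V U - Z)).trace with hs
  have hfc : Continuous f := continuous_traceNorm_comp (hω.sub continuous_const) hωH
  have hsc : Continuous s := ((hω.sub continuous_const).matrix_conjTranspose.matrix_mul
    (hω.sub continuous_const)).matrix_trace
  have hsr : Continuous fun U => (s U).re := Complex.continuous_re.comp hsc
  have hcard : (Fintype.card ((∀ i, Fin (L i)) × R) : ℝ) = (∏ i, (L i : ℝ)) * Fintype.card R := by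
    simp
  have hfs : ∀ U, f U ^ 2 ≤ (∏ i, (L i : ℝ)) * Fintype.card R * (s U).re := fun U => by
    have h1 := traceNorm_le_sqrt_card_mul (hωH U)
    have h2 : 0 ≤ (s U).re := by
      simp only [hs]; rw [trace_conjTranspose_mul_self_re]; positivity
    rw [hcard] at h1
    calc f U ^ 2 ≤ (√((∏ i, (L i : ℝ)) * Fintype.card R) * √((s U).re)) ^ 2 :=
          pow_le_pow_left₀ (traceNorm_nonneg (hωH U)) h1 2
      _ = _ := by rw [mul_pow, Real.sq_sqrt (by positivity), Real.sq_sqrt h2]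
  -- Expanding the square, the cross terms contribute −2 and the constant term +1 times the squared
  -- norm of the mean, which is ∏ L/d² times the purity `q ∅` of the reference.
  have hsint : ∫ U, s U ∂μ = (((∑ T : Finset ι, (∏ i ∈ T, β i) * (∏ i ∈ Finset.univ \ T, α i) * q T) -
        (∏ i, (L i : ℝ) / (Fintype.card (X i) : ℝ) ^ 2) * q ∅ : ℝ) : ℂ) := by
    have e1 : ∀ U, s U = (rotatedOutcome σ V U * rotatedOutcome σ V U).trace -
        2 * e * (rotatedOutcome σ V U * ((1 : Matrix _ _ ℂ) ⊗ₖ ρ)).trace +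
        e ^ 2 * ((∏ i, (L i : ℂ)) * (ρ * ρ).trace) := fun U => by
      simp only [hs]
      rw [(hωH U).eq, Matrix.sub_mul, Matrix.mul_sub, Matrix.mul_sub, Matrix.trace_sub,
        Matrix.trace_sub, Matrix.trace_sub, Matrix.trace_mul_comm Z, hZ, Matrix.mul_smul,
        Matrix.trace_smul, Matrix.smul_mul, Matrix.mul_smul, Matrix.trace_smul, Matrix.trace_smul,
        ← Matrix.mul_kronecker_mul, Matrix.one_mul, Matrix.trace_kronecker, Matrix.trace_one]
      simp only [smul_eq_mul, Fintype.card_pi, Fintype.card_fin, Nat.cast_prod]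
      ring
    have c1 : Continuous fun U => (rotatedOutcome σ V U * rotatedOutcome σ V U).trace :=
      (hω.matrix_mul hω).matrix_trace
    have c2 : Continuous fun U => (2 * e : ℂ) *
        (rotatedOutcome σ V U * ((1 : Matrix _ _ ℂ) ⊗ₖ ρ)).trace :=
      continuous_const.mul (hω.matrix_mul continuous_const).matrix_trace
    have c3 : Continuous fun U => (rotatedOutcome σ V U * rotatedOutcome σ V U).trace - (2 * e : ℂ) *
        (rotatedOutcome σ V U * ((1 : Matrix _ _ ℂ) ⊗ₖ ρ)).trace := c1.sub c2
    simp only [e1]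
    rw [integral_add c3.integrable_pi_haarUnitary (integrable_const _),
      integral_sub c1.integrable_pi_haarUnitary c2.integrable_pi_haarUnitary, integral_const_mul,
      integral_const, probReal_univ, one_smul, integral_trace_rotatedOutcome_mul,
      integral_trace_rotatedOutcome_mul_self σ V α β hm, ← hρ, ← swapOverlap_empty]
    simp only [hqσ, htr]
    push_cast
    have e2 : (e : ℂ) = ∏ i, (Fintype.card (X i) : ℂ)⁻¹ := by rw [he]; push_cast; rfl
    have e3 : (∏ i, (L i : ℂ) / (Fintype.card (X i) : ℂ)) = (∏ i, (L i : ℂ)) * e := by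
      rw [e2, ← Finset.prod_mul_distrib]
      exact Finset.prod_congr rfl fun i _ => div_eq_mul_inv _ _
    have e4 : (∏ i, (L i : ℂ) / (Fintype.card (X i) : ℂ) ^ 2) = (∏ i, (L i : ℂ)) * e ^ 2 := by
      rw [e2, ← Finset.prod_pow, ← Finset.prod_mul_distrib]
      exact Finset.prod_congr rfl fun i _ => by rw [div_eq_mul_inv, inv_pow]
    rw [e3, e4]
    ring
  have hsint' : ∫ U, (s U).re ∂μ ≤ (∏ i, (L i : ℝ) / (Fintype.card (X i) : ℝ) ^ 2) *
      ∑ T : Finset ι with T.Nonempty, (∏ i ∈ T, (L i : ℝ)) * q T := by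
    have h := integral_re (𝕜 := ℂ) (μ := μ) (f := s) hsc.integrable_pi_haarUnitary
    rw [hsint] at h
    refine (le_of_eq h).trans ?_
    exact sum_prod_moments_sub_le hα hβ hα' hβ' hq
  calc ∫ U, f U ∂μ ≤ √(∫ U, f U ^ 2 ∂μ) := integral_le_sqrt_integral_sq
        hfc.integrable_pi_haarUnitary (hfc.pow 2).integrable_pi_haarUnitary
    _ ≤ √((∏ i, (L i : ℝ)) * Fintype.card R * ((∏ i, (L i : ℝ) / (Fintype.card (X i) : ℝ) ^ 2) *
        ∑ T : Finset ι with T.Nonempty, (∏ i ∈ T, (L i : ℝ)) * q T)) := by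
      apply Real.sqrt_le_sqrt
      calc _ ≤ ∫ U, (∏ i, (L i : ℝ)) * Fintype.card R * (s U).re ∂μ :=
            integral_mono (hfc.pow 2).integrable_pi_haarUnitary
              (continuous_const.mul hsr).integrable_pi_haarUnitary hfs
        _ = (∏ i, (L i : ℝ)) * Fintype.card R * ∫ U, (s U).re ∂μ := integral_const_mul _ _
        _ ≤ _ := mul_le_mul_of_nonneg_left hsint' (by positivity)
    _ = _ := by
      -- The output dimension ∏ L from Cauchy–Schwarz turns the prefactor ∏ L/d² into a perfect
      -- square, whose root is the mean probability of the outcome.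
      have e5 : (∏ i, (L i : ℝ)) * Fintype.card R * ((∏ i, (L i : ℝ) / (Fintype.card (X i) : ℝ) ^ 2) *
          ∑ T : Finset ι with T.Nonempty, (∏ i ∈ T, (L i : ℝ)) * q T) =
          (∏ i, (L i : ℝ) / Fintype.card (X i)) ^ 2 * (Fintype.card R *
          ∑ T : Finset ι with T.Nonempty, (∏ i ∈ T, (L i : ℝ)) * q T) := by
        have : (∏ i, (L i : ℝ)) * (∏ i, (L i : ℝ) / (Fintype.card (X i) : ℝ) ^ 2) =
            (∏ i, (L i : ℝ) / Fintype.card (X i)) ^ 2 := by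
          rw [← Finset.prod_mul_distrib, ← Finset.prod_pow]
          exact Finset.prod_congr rfl fun i _ => by ring
        rw [← this]; ring
      rw [e5, Real.sqrt_mul (sq_nonneg _), Real.sqrt_sq (by positivity)]

end GoodOutcome

/-! ### Summation over outcomes: the averaged decoupling error. -/

section Decoupling

/-- The product weights are a probability distribution. Expanding ∏(f i 0 + g i), with `g i` the
weight of the nonzero outcomes, sorts the tuples by the set of senders with outcome 0. -/
theorem sum_prod_zero_outcome_le {ι : Type*} [Fintype ι] [DecidableEq ι] {n : ι → ℕ}
    {f : ∀ i, Fin (n i + 1) → ℝ} (hf : ∀ i j, 0 ≤ f i j) (hf1 : ∀ i, ∑ j, f i j = 1) {t : ι → ℝ}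
    (ht : ∀ i, f i 0 ≤ t i) :
    (∑ J : ∀ i, Fin (n i + 1) with ∀ i, J i ≠ 0, ∏ i, f i (J i)) ≤ 1 ∧
      (∑ J : ∀ i, Fin (n i + 1) with ¬∀ i, J i ≠ 0, ∏ i, f i (J i)) ≤
        ∑ T : Finset ι with T.Nonempty, ∏ i ∈ T, t i := by
  set g : ι → ℝ := fun i => ∑ j ∈ Finset.univ.erase 0, f i j with hg
  have hg0 : ∀ i, 0 ≤ g i := fun i => Finset.sum_nonneg fun j _ => hf i j
  have hfg : ∀ i, f i 0 + g i = 1 := fun i => by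
    rw [← hf1 i, hg, Finset.add_sum_erase _ _ (Finset.mem_univ _)]
  have hg1 : ∀ i, g i ≤ 1 := fun i => by linarith [hfg i, hf i 0]
  have hall : ∑ J : ∀ i, Fin (n i + 1), ∏ i, f i (J i) =
      ∑ T : Finset ι, (∏ i ∈ T, f i 0) * ∏ i ∈ Finset.univ \ T, g i := by
    rw [← Finset.powerset_univ, ← Finset.prod_add, ← Fintype.piFinset_univ, ← Finset.prod_univ_sum]
    simp only [hfg, hf1]
  have hgood : (∑ J : ∀ i, Fin (n i + 1) with ∀ i, J i ≠ 0, ∏ i, f i (J i)) = ∏ i, g i := by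
    rw [hg, Finset.prod_univ_sum]
    refine Finset.sum_congr ?_ fun _ _ => rfl
    ext J
    simp [Fintype.mem_piFinset]
  have he : (Finset.univ.filter fun T : Finset ι => ¬T.Nonempty) = {∅} := by
    ext T
    simp [Finset.not_nonempty_iff_eq_empty]
  constructor
  · rw [hgood]
    exact Finset.prod_le_one (fun i _ => hg0 i) fun i _ => hg1 i
  · have h1 := Finset.sum_filter_add_sum_filter_not Finset.univ
      (fun J : ∀ i, Fin (n i + 1) => ∀ i, J i ≠ 0) fun J => ∏ i, f i (J i)
    rw [hall, hgood, ← Finset.sum_filter_add_sum_filter_not Finset.univ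
      (fun T : Finset ι => T.Nonempty), he, Finset.sum_singleton, Finset.prod_empty, one_mul,
      Finset.sdiff_empty] at h1
    have h2 : ∑ T : Finset ι with T.Nonempty, (∏ i ∈ T, f i 0) * ∏ i ∈ Finset.univ \ T, g i ≤
        ∑ T : Finset ι with T.Nonempty, ∏ i ∈ T, t i := Finset.sum_le_sum fun T _ => by
      calc _ ≤ (∏ i ∈ T, t i) * 1 := mul_le_mul
            (Finset.prod_le_prod (fun i _ => hf i 0) fun i _ => ht i)
            (Finset.prod_le_one (fun i _ => hg0 i) fun i _ => hg1 i)
            (Finset.prod_nonneg fun i _ => hg0 i)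
            (Finset.prod_nonneg fun i _ => (hf i 0).trans (ht i))
        _ = _ := mul_one _
    linarith

variable {ι : Type*} [Fintype ι] [DecidableEq ι] {C : ι → Type*} [∀ i, Fintype (C i)]
  [∀ i, DecidableEq (C i)] {B R : Type*} [Fintype B] [DecidableEq B] [Fintype R] [DecidableEq R]
  {K L : ι → ℕ}

theorem decoupledState_posSemidef (ψ : EuclideanSpace ℂ ((∀ i, C i) × B × R)) :
    (maximallyMixed (∀ i, Fin (L i)) ⊗ₖ reducedR ψ).PosSemidef := by
  rw [← vecMat_targetVec]
  exact Matrix.posSemidef_self_mul_conjTranspose _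

theorem trace_decoupledState {ψ : EuclideanSpace ℂ ((∀ i, C i) × B × R)} (hψ : ‖ψ‖ = 1)
    (hL : ∀ i, 0 < L i) : (maximallyMixed (∀ i, Fin (L i)) ⊗ₖ reducedR ψ).trace = 1 := by
  rw [Matrix.trace_kronecker, trace_reducedR hψ, mul_one, maximallyMixed, Matrix.trace_smul,
    Matrix.trace_one, smul_eq_mul, inv_mul_cancel₀]
  rw [Fintype.card_pi, Nat.cast_ne_zero]
  exact Finset.prod_ne_zero_iff.mpr fun i _ => by simpa using (hL i).ne'

/-- Removes the normalization from the decoupling error. An outcome of probability zero has ω = 0,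
so the convention `0⁻¹ = 0` is harmless. -/
theorem mul_traceNorm_inv_smul_sub {a : Type*} [Fintype a] [DecidableEq a] {ω τ : Matrix a a ℂ}
    (hω : ω.PosSemidef) (hτ : τ.IsHermitian) :
    ω.trace.re * traceNorm ((ω.trace.re : ℂ)⁻¹ • ω - τ) =
      traceNorm (ω - (ω.trace.re : ℂ) • τ) := by
  have hp := Complex.nonneg_iff.mp hω.trace_nonneg
  have hsmul : ∀ (r : ℝ) (Y : Matrix a a ℂ), Y.IsHermitian → ((r : ℂ) • Y).IsHermitian :=
    fun r Y hY => by
      rw [Matrix.IsHermitian, Matrix.conjTranspose_smul, hY.eq, Complex.star_def,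
        Complex.conj_ofReal]
  by_cases h : ω.trace.re = 0
  · have h0 : ω = 0 := (hω.trace_eq_zero_iff).mp (Complex.ext h hp.2.symm)
    subst h0
    simp [traceNorm]
  · rw [← traceNorm_smul _ hp.1, smul_sub, smul_smul, mul_inv_cancel₀ (by exact_mod_cast h), one_smul]
    rw [← Complex.ofReal_inv]
    exact (hsmul _ _ hω.1).sub hτ

set_option synthInstance.maxSize 512 in
theorem decouplingError_rotated {n : ι → ℕ} (ψ : EuclideanSpace ℂ ((∀ i, C i) × B × R))
    (V : ∀ i, Fin (n i + 1) → Matrix (Fin (L i)) (C i × Fin (K i)) ℂ)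
    (U : ∀ i, Matrix.unitaryGroup (C i × Fin (K i)) ℂ) :
    decouplingError ψ (fun i j => SuperOp.kraus (V i j * (U i).1)) =
      ∑ J : ∀ i, Fin (n i + 1), traceNorm
        (rotatedOutcome (vecMat (initialVec ψ K) * (vecMat (initialVec ψ K))ᴴ) (fun i => V i (J i)) U -
        ((rotatedOutcome (vecMat (initialVec ψ K) * (vecMat (initialVec ψ K))ᴴ)
          (fun i => V i (J i)) U).trace.re : ℂ) •
          (maximallyMixed (∀ i, Fin (L i)) ⊗ₖ reducedR ψ)) := by
  refine Finset.sum_congr rfl fun J _ => ?_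
  have h : outcomeState ψ (fun i j => SuperOp.kraus (V i j * (U i).1)) J =
      rotatedOutcome (vecMat (initialVec ψ K) * (vecMat (initialVec ψ K))ᴴ) (fun i => V i (J i)) U :=
    outcomeState_kraus ψ (fun i j => V i j * (U i).1) J
  rw [h]
  exact mul_traceNorm_inv_smul_sub
    (rotatedOutcome_posSemidef (Matrix.posSemidef_self_mul_conjTranspose _) _ _)
    (decoupledState_posSemidef ψ).1

theorem continuous_traceNorm_sub_trace_smul {ψ : EuclideanSpace ℂ ((∀ i, C i) × B × R)}
    (V : ∀ i, Matrix (Fin (L i)) (C i × Fin (K i)) ℂ) :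
    Continuous fun U => traceNorm
      (rotatedOutcome (vecMat (initialVec ψ K) * (vecMat (initialVec ψ K))ᴴ) V U -
      ((rotatedOutcome (vecMat (initialVec ψ K) * (vecMat (initialVec ψ K))ᴴ) V U).trace.re : ℂ) •
        (maximallyMixed (∀ i, Fin (L i)) ⊗ₖ reducedR ψ)) := by
  have hω := continuous_rotatedOutcome (vecMat (initialVec ψ K) * (vecMat (initialVec ψ K))ᴴ) V
  refine continuous_traceNorm_comp (hω.sub ?_) fun U => ?_
  · exact (Complex.continuous_ofReal.comp
      (Complex.continuous_re.comp hω.matrix_trace)).smul continuous_const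
  · refine (rotatedOutcome_posSemidef (Matrix.posSemidef_self_mul_conjTranspose _) _ _).1.sub ?_
    rw [Matrix.IsHermitian, Matrix.conjTranspose_smul, (decoupledState_posSemidef ψ).1.eq,
      Complex.star_def, Complex.conj_ofReal]

theorem traceNorm_sub_trace_smul_le {a : Type*} [Fintype a] [DecidableEq a] {ω τ : Matrix a a ℂ}
    (hω : ω.PosSemidef) (hτ : τ.PosSemidef) (hτ1 : τ.trace = 1) :
    traceNorm (ω - (ω.trace.re : ℂ) • τ) ≤ 2 * ω.trace.re := by
  have hp := Complex.nonneg_iff.mp hω.trace_nonneg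
  have hH : ((ω.trace.re : ℂ) • τ).IsHermitian := by
    rw [Matrix.IsHermitian, Matrix.conjTranspose_smul, hτ.1.eq, Complex.star_def,
      Complex.conj_ofReal]
  rw [sub_eq_add_neg]
  refine (traceNorm_add_le hω.1 hH.neg).trans (le_of_eq ?_)
  rw [traceNorm_neg, traceNorm_smul hτ.1 hp.1, traceNorm_of_posSemidef hω,
    traceNorm_of_posSemidef hτ, hτ1, Complex.one_re]
  ring

/-- The error in the trace is itself controlled: |c − Tr ω| = |Tr(ω − cτ)| ≤ ‖ω − cτ‖₁. This is the
origin of the factor 2 before the square root in Δ. -/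
theorem traceNorm_sub_trace_smul_le_of_approx {a : Type*} [Fintype a] [DecidableEq a]
    {ω τ : Matrix a a ℂ} (hω : ω.PosSemidef) (hτ : τ.PosSemidef) (hτ1 : τ.trace = 1) (c : ℝ) :
    traceNorm (ω - (ω.trace.re : ℂ) • τ) ≤ 2 * traceNorm (ω - (c : ℂ) • τ) := by
  have hH : ∀ r : ℝ, ((r : ℂ) • τ).IsHermitian := fun r => by
    rw [Matrix.IsHermitian, Matrix.conjTranspose_smul, hτ.1.eq, Complex.star_def,
      Complex.conj_ofReal]
  have h1 : ω - (ω.trace.re : ℂ) • τ = (ω - (c : ℂ) • τ) + (((c - ω.trace.re : ℝ)) : ℂ) • τ := by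
    push_cast
    rw [sub_smul]
    abel
  have h2 : traceNorm ((((c - ω.trace.re : ℝ)) : ℂ) • τ) = |c - ω.trace.re| := by
    have h3 : ∀ r : ℝ, 0 ≤ r → traceNorm ((r : ℂ) • τ) = r := fun r hr => by
      rw [traceNorm_smul hτ.1 hr, traceNorm_of_posSemidef hτ, hτ1, Complex.one_re, mul_one]
    rcases le_total 0 (c - ω.trace.re) with h | h
    · rw [h3 _ h, abs_of_nonneg h]
    · rw [abs_of_nonpos h, ← traceNorm_neg, ← neg_smul, ← Complex.ofReal_neg, h3 _ (by linarith)]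
  have h4 := abs_re_trace_le_traceNorm (hω.1.sub (hH c))
  rw [Matrix.trace_sub, Matrix.trace_smul, hτ1, smul_eq_mul, mul_one, Complex.sub_re,
    Complex.ofReal_re, abs_sub_comm] at h4
  rw [h1]
  refine (traceNorm_add_le (hω.1.sub (hH c)) (hH _)).trans ?_
  rw [h2]
  linarith

theorem integrable_decouplingError {n : ι → ℕ} (ψ : EuclideanSpace ℂ ((∀ i, C i) × B × R))
    (V : ∀ i, Fin (n i + 1) → Matrix (Fin (L i)) (C i × Fin (K i)) ℂ) :
    Integrable (fun U : ∀ i, Matrix.unitaryGroup (C i × Fin (K i)) ℂ =>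
        decouplingError ψ fun i j => SuperOp.kraus (V i j * (U i).1))
      (Measure.pi fun i => haarUnitary (C i × Fin (K i))) := by
  simp only [decouplingError_rotated]
  exact integrable_finsetSum _ fun J _ =>
    (continuous_traceNorm_sub_trace_smul fun i => V i (J i)).integrable_pi_haarUnitary

theorem card_pos_of_norm_eq_one {ψ : EuclideanSpace ℂ ((∀ i, C i) × B × R)} (hψ : ‖ψ‖ = 1)
    (i : ι) : 0 < Fintype.card (C i) := by
  have : Nonempty ((∀ i, C i) × B × R) := by
    by_contra h
    rw [not_nonempty_iff] at h
    rw [EuclideanSpace.norm_eq] at hψ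
    simp at hψ
  obtain ⟨c, -, -⟩ := this
  exact Fintype.card_pos_iff.mpr ⟨c i⟩

theorem integral_decouplingError_le {ψ : EuclideanSpace ℂ ((∀ i, C i) × B × R)} (hψ : ‖ψ‖ = 1)
    (hK : ∀ i, 0 < K i) (hL : ∀ i, 0 < L i)
    (V : ∀ i, Fin (Fintype.card (C i × Fin (K i)) / L i + 1) →
      Matrix (Fin (L i)) (C i × Fin (K i)) ℂ)
    (hV : ∀ i, IsPartialIsometryMeasurement (V i)) :
    ∫ U : ∀ i, Matrix.unitaryGroup (C i × Fin (K i)) ℂ,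
          decouplingError ψ (fun i j => SuperOp.kraus (V i j * (U i).1))
        ∂(Measure.pi fun i => haarUnitary (C i × Fin (K i))) ≤ mergingBound ψ K L := by
  set σ := vecMat (initialVec ψ K) * (vecMat (initialVec ψ K))ᴴ with hσ
  have hσp : σ.PosSemidef := Matrix.posSemidef_self_mul_conjTranspose _
  have hσR : partialTraceFst σ = reducedR ψ := partialTraceFst_initialVec hK ψ
  set τ := maximallyMixed (∀ i, Fin (L i)) ⊗ₖ reducedR ψ with hτ
  have hτp : τ.PosSemidef := decoupledState_posSemidef ψ
  have hτ1 : τ.trace = 1 := trace_decoupledState hψ hL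
  have hd : ∀ i, 0 < Fintype.card (C i × Fin (K i)) := fun i => by
    rw [Fintype.card_prod, Fintype.card_fin]
    exact Nat.mul_pos (card_pos_of_norm_eq_one hψ i) (hK i)
  have hidem : ∀ i j, (V i j)ᴴ * V i j * ((V i j)ᴴ * V i j) = (V i j)ᴴ * V i j := fun i j =>
    (isPartialIsometry_iff_idempotent _).mp ((hV i).1 j)
  set μ := Measure.pi fun i => haarUnitary (C i × Fin (K i)) with hμ
  -- Relative ranks: the Haar-averaged probability of the tuple `J` is the product of the `f i (J
  -- i)`.
  set f : ∀ i, Fin (Fintype.card (C i × Fin (K i)) / L i + 1) → ℝ := fun i j =>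
    (V i j).rank / Fintype.card (C i × Fin (K i)) with hf
  have hf1 : ∀ i, ∑ j, f i j = 1 := fun i => by
    have h := congrArg Matrix.trace (hV i).2.2.2.2
    rw [Matrix.trace_sum, Matrix.trace_one] at h
    simp only [trace_conjTranspose_mul_self_eq_rank (hidem i _)] at h
    have h' : ∑ j, ((V i j).rank : ℝ) = Fintype.card (C i × Fin (K i)) := by exact_mod_cast h
    simp only [hf, ← Finset.sum_div, h']
    exact div_self (by exact_mod_cast (hd i).ne')
  have hf0 : ∀ i, f i 0 ≤ (L i : ℝ) / ((Fintype.card (C i) : ℝ) * K i) := fun i => by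
    have h := (hV i).2.2.2.1
    simp only [hf, Fintype.card_prod, Fintype.card_fin, Nat.cast_mul]
    gcongr
  obtain ⟨hs1, hs2⟩ := sum_prod_zero_outcome_le (fun i j => by positivity) hf1 hf0
  set q : Finset ι → ℝ := fun T => (∏ i ∈ T, (K i : ℝ)⁻¹) * (reducedRT ψ T ^ 2).trace.re with hq
  have hq0 : ∀ T, 0 ≤ q T := fun T =>
    mul_nonneg (Finset.prod_nonneg fun i _ => by positivity) (trace_reducedRT_sq ψ T).2
  have hqσ : ∀ T, swapOverlap σ T = (q T : ℂ) := fun T => by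
    rw [hσ, swapOverlap_initialVec hK, swapOverlap_reducedCR, (trace_reducedRT_sq ψ T).1, hq]
    push_cast
    rfl
  set W := √((Fintype.card R : ℝ) * ∑ T : Finset ι with T.Nonempty,
      (∏ i ∈ T, (L i : ℝ) / K i) * (reducedRT ψ T ^ 2).trace.re) with hW
  have hbad : ∀ J : ∀ i, Fin (Fintype.card (C i × Fin (K i)) / L i + 1),
      ∫ U, traceNorm (rotatedOutcome σ (fun i => V i (J i)) U -
        ((rotatedOutcome σ (fun i => V i (J i)) U).trace.re : ℂ) • τ) ∂μ ≤ 2 * ∏ i, f i (J i) := by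
    intro J
    have hω := continuous_rotatedOutcome σ fun i => V i (J i)
    have h := integral_trace_rotatedOutcome_mul σ (fun i => V i (J i)) 1
    simp only [Matrix.one_kronecker_one, Matrix.mul_one, Matrix.one_mul, hσR, trace_reducedR hψ,
      trace_conjTranspose_mul_self_eq_rank (hidem _ _)] at h
    have h' := integral_re (𝕜 := ℂ) (μ := μ) hω.matrix_trace.integrable_pi_haarUnitary
    rw [h] at h'
    calc _ ≤ ∫ U, 2 * (rotatedOutcome σ (fun i => V i (J i)) U).trace.re ∂μ :=
          integral_mono (continuous_traceNorm_sub_trace_smul _).integrable_pi_haarUnitary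
            (continuous_const.mul (Complex.continuous_re.comp
              hω.matrix_trace)).integrable_pi_haarUnitary
            fun U => traceNorm_sub_trace_smul_le (rotatedOutcome_posSemidef hσp _ _) hτp hτ1
      _ = 2 * ∫ U, (rotatedOutcome σ (fun i => V i (J i)) U).trace.re ∂μ := integral_const_mul _ _
      _ = _ := by
        congr 1
        refine h'.trans ?_
        have : (∏ i, ((V i (J i)).rank : ℂ) / (Fintype.card (C i × Fin (K i)) : ℂ)) =
            ((∏ i, f i (J i) : ℝ) : ℂ) := by
          simp only [hf]; push_cast; rfl
        rw [this, mul_one]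
        exact Complex.ofReal_re _
  have hgood : ∀ J : ∀ i, Fin (Fintype.card (C i × Fin (K i)) / L i + 1), (∀ i, J i ≠ 0) →
      ∫ U, traceNorm (rotatedOutcome σ (fun i => V i (J i)) U -
        ((rotatedOutcome σ (fun i => V i (J i)) U).trace.re : ℂ) • τ) ∂μ ≤
        (∏ i, f i (J i)) * (2 * W) := by
    intro J hJ
    have hω := continuous_rotatedOutcome σ fun i => V i (J i)
    have hr : ∀ i, (V i (J i)).rank = L i := fun i => (hV i).2.1 _ (hJ i)
    have h := integral_traceNorm_rotatedOutcome_sub_le hσp (fun i => V i (J i))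
      (fun i => hidem i (J i)) hr hL hq0 hqσ
    have hW' : √((Fintype.card R : ℝ) * ∑ T : Finset ι with T.Nonempty,
        (∏ i ∈ T, (L i : ℝ)) * q T) = W := by
      rw [hW]
      congr 2
      refine Finset.sum_congr rfl fun T _ => ?_
      simp only [hq, div_eq_mul_inv, Finset.prod_mul_distrib]
      ring
    have hc : (∏ i, (L i : ℝ) / Fintype.card (C i × Fin (K i))) = ∏ i, f i (J i) :=
      Finset.prod_congr rfl fun i _ => by simp only [hf, hr]
    -- The mean outcome state is exactly its mean probability times the decoupled state, so the
    -- comparison constant `c` is that probability.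
    have hZ : ((∏ i, (Fintype.card (C i × Fin (K i)) : ℝ)⁻¹ : ℝ) : ℂ) •
        ((1 : Matrix (∀ i, Fin (L i)) (∀ i, Fin (L i)) ℂ) ⊗ₖ partialTraceFst σ) =
        ((∏ i, f i (J i) : ℝ) : ℂ) • τ := by
      rw [← hc, hτ, hσR, maximallyMixed, Matrix.smul_kronecker, smul_smul]
      congr 1
      have hLp : (∏ i, (L i : ℂ)) ≠ 0 := Finset.prod_ne_zero_iff.mpr fun i _ => by
        exact_mod_cast (hL i).ne'
      simp only [Fintype.card_pi, Fintype.card_fin, div_eq_mul_inv, Finset.prod_mul_distrib]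
      push_cast
      field_simp
    rw [hZ, hW', hc] at h
    have hH : ∀ U, (rotatedOutcome σ (fun i => V i (J i)) U -
        ((∏ i, f i (J i) : ℝ) : ℂ) • τ).IsHermitian := fun U => by
      refine (rotatedOutcome_posSemidef hσp _ _).1.sub ?_
      rw [Matrix.IsHermitian, Matrix.conjTranspose_smul, hτp.1.eq, Complex.star_def,
        Complex.conj_ofReal]
    calc _ ≤ ∫ U, 2 * traceNorm (rotatedOutcome σ (fun i => V i (J i)) U -
          ((∏ i, f i (J i) : ℝ) : ℂ) • τ) ∂μ :=
          integral_mono (continuous_traceNorm_sub_trace_smul _).integrable_pi_haarUnitary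
            (continuous_const.mul (continuous_traceNorm_comp (hω.sub continuous_const)
              hH)).integrable_pi_haarUnitary fun U => traceNorm_sub_trace_smul_le_of_approx
              (rotatedOutcome_posSemidef hσp _ _) hτp hτ1 _
      _ = 2 * ∫ U, traceNorm (rotatedOutcome σ (fun i => V i (J i)) U -
          ((∏ i, f i (J i) : ℝ) : ℂ) • τ) ∂μ := integral_const_mul _ _
      _ ≤ _ := by linarith
  simp only [decouplingError_rotated]
  rw [integral_finsetSum _ fun J _ =>
    (continuous_traceNorm_sub_trace_smul fun i => V i (J i)).integrable_pi_haarUnitary,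
    ← Finset.sum_filter_add_sum_filter_not Finset.univ
      (fun J : ∀ i, Fin (Fintype.card (C i × Fin (K i)) / L i + 1) => ∀ i, J i ≠ 0),
    mergingBound, ← hW, add_comm]
  have hW0 : 0 ≤ W := Real.sqrt_nonneg _
  refine add_le_add ?_ ?_
  · calc _ ≤ ∑ J : ∀ i, Fin (Fintype.card (C i × Fin (K i)) / L i + 1) with ¬∀ i, J i ≠ 0,
          2 * ∏ i, f i (J i) := Finset.sum_le_sum fun J _ => hbad J
      _ = 2 * ∑ J : ∀ i, Fin (Fintype.card (C i × Fin (K i)) / L i + 1) with ¬∀ i, J i ≠ 0,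
          ∏ i, f i (J i) := (Finset.mul_sum _ _ _).symm
      _ ≤ _ := by gcongr
  · calc _ ≤ ∑ J : ∀ i, Fin (Fintype.card (C i × Fin (K i)) / L i + 1) with ∀ i, J i ≠ 0,
          (∏ i, f i (J i)) * (2 * W) :=
          Finset.sum_le_sum fun J hJ => hgood J (Finset.mem_filter.mp hJ).2
      _ = (∑ J : ∀ i, Fin (Fintype.card (C i × Fin (K i)) / L i + 1) with ∀ i, J i ≠ 0,
          ∏ i, f i (J i)) * (2 * W) := (Finset.sum_mul _ _ _).symm
      _ ≤ 1 * (2 * W) := by gcongr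
      _ = _ := one_mul _

end Decoupling

/-! ### Construction of the decoders -/

section Decoding

/-- With G = √(1 − WᴴW), add the operators |t₀⟩⟨x|G: on the part not handled by `W`, measure in the
basis and prepare a fixed state. A single isometric extension could fail for lack of room in `t`. -/
theorem exists_kraus_completion {s t : Type*} [Fintype s] [DecidableEq s] [Fintype t]
    [DecidableEq t] [Nonempty t] {W : Matrix t s ℂ} (hW : (1 - Wᴴ * W).PosSemidef) :
    ∃ F : Option s → Matrix t s ℂ, F none = W ∧ ∑ k, (F k)ᴴ * F k = 1 := by
  obtain ⟨G, hG, hGG⟩ := hW.exists_sqrt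
  let t0 : t := Classical.arbitrary t
  refine ⟨fun k => k.elim W fun x => Matrix.of fun y x' => if y = t0 then G x x' else 0, rfl, ?_⟩
  have h : ∑ x, (Matrix.of fun y x' => if y = t0 then G x x' else 0 : Matrix t s ℂ)ᴴ *
      (Matrix.of fun y x' => if y = t0 then G x x' else 0 : Matrix t s ℂ) = G * G := by
    conv_rhs => enter [1]; rw [← hG.1.eq]
    ext y z
    simp [Matrix.sum_apply, Matrix.mul_apply, apply_ite (starRingEnd ℂ)]
  rw [Fintype.sum_option]
  simp only [Option.elim_none, Option.elim_some]
  rw [h, hGG]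
  abel

theorem trace_pureState {a : Type*} [Fintype a] (v : a → ℂ) :
    (pureState v).trace = ((∑ x, ‖v x‖ ^ 2 : ℝ) : ℂ) := by
  simp only [Matrix.trace, Matrix.diag_apply, pureState, Matrix.vecMulVec_apply, Pi.star_apply]
  push_cast
  exact Finset.sum_congr rfl fun x _ => Complex.mul_conj' _

theorem trace_vecMat_mul_conjTranspose {x s r : Type*} [Fintype x] [Fintype s] [Fintype r]
    (v : (x × s) × r → ℂ) :
    (vecMat v * (vecMat v)ᴴ).trace = ((∑ p, ‖v p‖ ^ 2 : ℝ) : ℂ) := by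
  rw [← trace_pureState]
  simp only [Matrix.trace, Matrix.diag_apply, Matrix.mul_apply, vecMat, Matrix.of_apply,
    Matrix.conjTranspose_apply, pureState, Matrix.vecMulVec_apply, Pi.star_apply,
    Fintype.sum_prod_type]
  exact Finset.sum_congr rfl fun _ _ => Finset.sum_comm

theorem sum_star_mul_eq_trace_vecMat {x s r : Type*} [Fintype x] [Fintype s] [Fintype r]
    (t v : (x × s) × r → ℂ) :
    ∑ p, star (t p) * v p = ((vecMat t)ᴴ * vecMat v).trace := by
  simp only [Matrix.trace, Matrix.diag_apply, Matrix.mul_apply, vecMat, Matrix.of_apply,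
    Matrix.conjTranspose_apply, Fintype.sum_prod_type]
  rw [Finset.sum_comm]

/-- Explains the transpose in the Uhlmann overlap: the receiver's operators act on the column index
of the reshaped vector. -/
theorem vecMat_one_kronecker_mulVec {x s t r : Type*} [Fintype x] [Fintype s] [Fintype r]
    [DecidableEq x] [DecidableEq r] (F : Matrix t s ℂ) (v : (x × s) × r → ℂ) :
    vecMat ((((1 : Matrix x x ℂ) ⊗ₖ F) ⊗ₖ (1 : Matrix r r ℂ)) *ᵥ v) = vecMat v * Fᵀ := by
  ext ⟨y, k⟩ z
  simp [vecMat, Matrix.mulVec, dotProduct, Matrix.mul_apply, Fintype.sum_prod_type,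
    Matrix.one_apply, mul_comm]

theorem exists_contraction_overlap_of_trace {a b c : Type*} [Fintype a] [Fintype b] [Fintype c]
    [DecidableEq a] [DecidableEq b] [DecidableEq c] (X : Matrix a b ℂ) (Y : Matrix a c ℂ)
    (hY : (Y * Yᴴ).trace.re = 1) :
    ∃ W : Matrix c b ℂ, (1 - Wᴴ * W).PosSemidef ∧
      (X * Xᴴ).trace.re - (X * Xᴴ).trace.re *
        traceNorm (((X * Xᴴ).trace.re : ℂ)⁻¹ • (X * Xᴴ) - Y * Yᴴ) ≤
          ‖(Yᴴ * X * Wᵀ).trace‖ ^ 2 := by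
  set p := (X * Xᴴ).trace.re with hp
  have hp0 : 0 ≤ p :=
    (Complex.nonneg_iff.mp (Matrix.posSemidef_self_mul_conjTranspose X).trace_nonneg).1
  by_cases h : p = 0
  -- An outcome of probability zero demands nothing; otherwise `X` is rescaled by 1/√p.
  · refine ⟨0, by simpa using Matrix.PosSemidef.one, ?_⟩
    rw [h]
    simp
  · have hpp : 0 < p := lt_of_le_of_ne hp0 (Ne.symm h)
    have hs : (((√p)⁻¹ : ℝ) : ℂ) * (((√p)⁻¹ : ℝ) : ℂ) = (p : ℂ)⁻¹ := by
      rw [← Complex.ofReal_mul, ← mul_inv, Real.mul_self_sqrt hp0, Complex.ofReal_inv]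
    have hXX : ((((√p)⁻¹ : ℝ) : ℂ) • X) * ((((√p)⁻¹ : ℝ) : ℂ) • X)ᴴ = (p : ℂ)⁻¹ • (X * Xᴴ) := by
      rw [Matrix.conjTranspose_smul, Matrix.smul_mul, Matrix.mul_smul, smul_smul, Complex.star_def,
        Complex.conj_ofReal, hs]
    obtain ⟨W, hW, hW2⟩ := exists_contraction_overlap ((((√p)⁻¹ : ℝ) : ℂ) • X) Y (by
      rw [hXX, Matrix.trace_smul, smul_eq_mul, ← Complex.ofReal_inv, Complex.re_ofReal_mul, ← hp,
        inv_mul_cancel₀ h]) hY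
    refine ⟨W, hW, ?_⟩
    rw [hXX, Matrix.mul_smul, Matrix.smul_mul, Matrix.trace_smul, norm_smul, mul_pow,
      Complex.norm_real, norm_inv, Real.norm_of_nonneg (Real.sqrt_nonneg p), inv_pow,
      Real.sq_sqrt hp0] at hW2
    have := mul_le_mul_of_nonneg_left hW2 hp0
    rw [← mul_assoc, mul_inv_cancel₀ h, one_mul] at this
    linarith

variable {ι : Type*} [Fintype ι] [DecidableEq ι] {C : ι → Type*} [∀ i, Fintype (C i)]
  [∀ i, DecidableEq (C i)] {B R : Type*} [Fintype B] [DecidableEq B] [Fintype R] [DecidableEq R]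
  {K L : ι → ℕ} {J : ι → Type*} [∀ i, Fintype (J i)]

theorem sum_piKronecker_conjTranspose_mul_self
    {A : ∀ i, J i → Matrix (Fin (L i)) (C i × Fin (K i)) ℂ}
    (hA : ∀ i, ∑ j, (A i j)ᴴ * A i j = 1) :
    ∑ j : ∀ i, J i, (piKronecker fun i => A i (j i))ᴴ * (piKronecker fun i => A i (j i)) = 1 := by
  simp only [piKronecker_conjTranspose, piKronecker_mul]
  rw [piKronecker_sum fun i j => (A i j)ᴴ * A i j]
  simp only [hA, piKronecker_one]

-- Merging is decoupling read from the receiver's side. Since Uhlmann's bound is linear in the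
-- distance for each outcome, the squared overlaps sum to at least one minus the decoupling error,
-- and the square root is taken only once, for the final mixture.
set_option synthInstance.maxSize 512 in
theorem exists_isMergingProtocol {ψ : EuclideanSpace ℂ ((∀ i, C i) × B × R)} (hψ : ‖ψ‖ = 1)
    (hK : ∀ i, 0 < K i) (hL : ∀ i, 0 < L i) [∀ i, DecidableEq (J i)]
    {A : ∀ i, J i → Matrix (Fin (L i)) (C i × Fin (K i)) ℂ}
    (hA : ∀ i, ∑ j, (A i j)ᴴ * A i j = 1) {δ : ℝ}
    (hδ : decouplingError ψ (fun i j => SuperOp.kraus (A i j)) ≤ δ) :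
    ∃ D : (∀ i, J i) → SuperOp (B × (∀ i, Fin (K i))) ((∀ i, Fin (L i)) × (∀ i, C i) × B),
      IsMergingProtocol ψ (fun i j => SuperOp.kraus (A i j)) D (2 * √δ) := by
  set v := initialVec ψ K with hv
  set t := targetVec ψ L with ht
  set M : (∀ i, J i) → Matrix (∀ i, Fin (L i)) (∀ i, C i × Fin (K i)) ℂ :=
    fun j => piKronecker fun i => A i (j i) with hM
  have hMM : ∑ j, (M j)ᴴ * M j = 1 := sum_piKronecker_conjTranspose_mul_self hA
  have hne : Nonempty ((∀ i, Fin (L i)) × (∀ i, C i) × B) := by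
    have : Nonempty ((∀ i, C i) × B × R) := by
      by_contra h
      rw [not_nonempty_iff] at h
      rw [EuclideanSpace.norm_eq] at hψ
      simp at hψ
    obtain ⟨c, b, -⟩ := this
    exact ⟨fun i => ⟨0, hL i⟩, c, b⟩
  have hv1 : (vecMat v * (vecMat v)ᴴ).trace = 1 := by
    rw [← trace_partialTraceFst, hv, partialTraceFst_initialVec hK, trace_reducedR hψ]
  have ht1 : (vecMat t * (vecMat t)ᴴ).trace = 1 := by
    rw [ht, vecMat_targetVec, trace_decoupledState hψ hL]
  set X : (∀ i, J i) → Matrix ((∀ i, Fin (L i)) × R) (B × (∀ i, Fin (K i))) ℂ :=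
    fun j => (M j ⊗ₖ (1 : Matrix R R ℂ)) * vecMat v with hX
  have hXX : ∀ j, outcomeState ψ (fun i k => SuperOp.kraus (A i k)) j = X j * (X j)ᴴ := fun j => by
    rw [outcomeState_kraus, hX, Matrix.conjTranspose_mul]
    simp only [Matrix.mul_assoc, ← hv, hM]
  choose W hW hWX using fun j => exists_contraction_overlap_of_trace (X j) (vecMat t)
    (by rw [ht1, Complex.one_re])
  choose F hF hFF using fun j => exists_kraus_completion (hW j)
  refine ⟨fun j => ∑ k, SuperOp.kraus (F j k), fun i => SuperOp.isInstrument_kraus _ (hA i),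
    fun j => SuperOp.isChannel_sum_kraus _ (hFF j), ?_⟩
  set N : (∀ i, J i) × Option (B × (∀ i, Fin (K i))) → Matrix
      (((∀ i, Fin (L i)) × ((∀ i, Fin (L i)) × (∀ i, C i) × B)) × R)
      (((∀ i, C i × Fin (K i)) × (B × (∀ i, Fin (K i)))) × R) ℂ := fun p =>
    (((1 : Matrix (∀ i, Fin (L i)) (∀ i, Fin (L i)) ℂ) ⊗ₖ F p.1 p.2) *
      (M p.1 ⊗ₖ (1 : Matrix (B × (∀ i, Fin (K i))) (B × (∀ i, Fin (K i))) ℂ))) ⊗ₖ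
        (1 : Matrix R R ℂ) with hN
  have hmap : (mergingMap (fun i j => SuperOp.kraus (A i j))
      (fun j => ∑ k, SuperOp.kraus (F j k))).actFst R (pureState v) =
      ∑ p, pureState (N p *ᵥ v) := by
    have h : mergingMap (fun i j => SuperOp.kraus (A i j)) (fun j => ∑ k, SuperOp.kraus (F j k)) =
        ∑ j, ∑ k, SuperOp.kraus (((1 : Matrix (∀ i, Fin (L i)) (∀ i, Fin (L i)) ℂ) ⊗ₖ F j k) *
          (M j ⊗ₖ (1 : Matrix (B × (∀ i, Fin (K i))) (B × (∀ i, Fin (K i))) ℂ))) := by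
      refine Finset.sum_congr rfl fun j _ => ?_
      rw [SuperOp.actSnd_sum, SuperOp.piTensor_kraus, SuperOp.actFst_kraus]
      ext1 x
      simp only [LinearMap.comp_apply, LinearMap.sum_apply]
      exact Finset.sum_congr rfl fun k _ => by
        rw [SuperOp.actSnd_kraus, ← LinearMap.comp_apply, SuperOp.kraus_comp_kraus]
    rw [h, SuperOp.actFst_sum, LinearMap.sum_apply, Fintype.sum_prod_type]
    refine Finset.sum_congr rfl fun j _ => ?_
    rw [SuperOp.actFst_sum, LinearMap.sum_apply]
    exact Finset.sum_congr rfl fun k _ => by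
      rw [SuperOp.actFst_kraus, SuperOp.kraus_pureState]
  have hNN : ∑ p, (N p)ᴴ * N p = 1 := by
    have h1 : ∀ j k, (N (j, k))ᴴ * N (j, k) = (((M j)ᴴ * M j) ⊗ₖ ((F j k)ᴴ * F j k)) ⊗ₖ
        (1 : Matrix R R ℂ) := fun j k => by
      simp only [hN, ← Matrix.mul_kronecker_mul, Matrix.conjTranspose_kronecker,
        Matrix.conjTranspose_one, Matrix.one_mul, Matrix.mul_one]
    rw [Fintype.sum_prod_type]
    simp only [h1]
    have h2 : ∀ j, ∑ k, (((M j)ᴴ * M j) ⊗ₖ ((F j k)ᴴ * F j k)) ⊗ₖ (1 : Matrix R R ℂ) =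
        (((M j)ᴴ * M j) ⊗ₖ (1 : Matrix (B × (∀ i, Fin (K i))) (B × (∀ i, Fin (K i))) ℂ)) ⊗ₖ
          (1 : Matrix R R ℂ) := fun j => by
      rw [← hFF j]
      ext p q
      simp only [Matrix.sum_apply, Matrix.kroneckerMap_apply, Finset.sum_mul, Finset.mul_sum]
    simp only [h2]
    have h3 : ∑ j, (((M j)ᴴ * M j) ⊗ₖ (1 : Matrix (B × (∀ i, Fin (K i)))
        (B × (∀ i, Fin (K i))) ℂ)) ⊗ₖ (1 : Matrix R R ℂ) =
        ((∑ j, (M j)ᴴ * M j) ⊗ₖ (1 : Matrix (B × (∀ i, Fin (K i)))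
        (B × (∀ i, Fin (K i))) ℂ)) ⊗ₖ (1 : Matrix R R ℂ) := by
      ext p q
      simp [Matrix.sum_apply, Matrix.kroneckerMap_apply, Finset.sum_mul]
    rw [h3, hMM, Matrix.one_kronecker_one, Matrix.one_kronecker_one]
  have hvt : ∑ p, ‖v p‖ ^ 2 = 1 := by
    rw [trace_vecMat_mul_conjTranspose] at hv1
    exact_mod_cast hv1
  have htt : ∑ p, ‖t p‖ ^ 2 = 1 := by
    rw [trace_vecMat_mul_conjTranspose] at ht1
    exact_mod_cast ht1
  have hsum1 : ∑ p, ∑ x, ‖(N p *ᵥ v) x‖ ^ 2 = 1 := by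
    have h := (SuperOp.isChannel_sum_kraus N hNN).2 (pureState v)
    rw [LinearMap.sum_apply, Matrix.trace_sum, trace_pureState, hvt] at h
    simp only [SuperOp.kraus_pureState, trace_pureState] at h
    exact_mod_cast h
  have hover : ∀ j, ∑ x, star (t x) * (N (j, none) *ᵥ v) x =
      ((vecMat t)ᴴ * X j * (W j)ᵀ).trace := fun j => by
    have h : N (j, none) = (((1 : Matrix (∀ i, Fin (L i)) (∀ i, Fin (L i)) ℂ) ⊗ₖ W j) ⊗ₖ
        (1 : Matrix R R ℂ)) * ((M j ⊗ₖ (1 : Matrix (B × (∀ i, Fin (K i)))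
        (B × (∀ i, Fin (K i))) ℂ)) ⊗ₖ (1 : Matrix R R ℂ)) := by
      rw [← Matrix.mul_kronecker_mul, Matrix.one_mul, ← hF]
    rw [sum_star_mul_eq_trace_vecMat, h, ← Matrix.mulVec_mulVec, vecMat_one_kronecker_mulVec,
      vecMat_kronecker_mulVec]
    simp only [hX, Matrix.mul_assoc]
  have hprob : ∑ j, (X j * (X j)ᴴ).trace.re = 1 := by
    have h1 : ∑ j, (M j ⊗ₖ (1 : Matrix R R ℂ))ᴴ * (M j ⊗ₖ (1 : Matrix R R ℂ)) = 1 := by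
      have h2 : ∀ j, (M j ⊗ₖ (1 : Matrix R R ℂ))ᴴ * (M j ⊗ₖ (1 : Matrix R R ℂ)) =
          ((M j)ᴴ * M j) ⊗ₖ (1 : Matrix R R ℂ) := fun j => by
        rw [Matrix.conjTranspose_kronecker, ← Matrix.mul_kronecker_mul, Matrix.conjTranspose_one,
          Matrix.one_mul]
      simp only [h2]
      rw [← Matrix.one_kronecker_one, ← hMM]
      ext p q
      simp [Matrix.sum_apply, Matrix.kroneckerMap_apply, Finset.sum_mul]
    have h := (SuperOp.isChannel_sum_kraus _ h1).2 (vecMat v * (vecMat v)ᴴ)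
    rw [LinearMap.sum_apply, Matrix.trace_sum, hv1] at h
    rw [← Complex.re_sum, ← Complex.one_re, ← h]
    congr 1
    refine Finset.sum_congr rfl fun j _ => ?_
    rw [SuperOp.kraus_apply, hX, Matrix.conjTranspose_mul]
    simp only [Matrix.mul_assoc]
  rw [hmap]
  refine traceNorm_sum_pureState_sub_le (fun p => N p *ᵥ v) t hsum1 htt ?_
  have hQ : decouplingError ψ (fun i j => SuperOp.kraus (A i j)) =
      ∑ j, (X j * (X j)ᴴ).trace.re *
        traceNorm (((X j * (X j)ᴴ).trace.re : ℂ)⁻¹ • (X j * (X j)ᴴ) - vecMat t * (vecMat t)ᴴ) := by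
    refine Finset.sum_congr rfl fun j _ => ?_
    rw [hXX, ht, vecMat_targetVec]
  calc 1 - δ ≤ ∑ j, ((X j * (X j)ᴴ).trace.re - (X j * (X j)ᴴ).trace.re *
        traceNorm (((X j * (X j)ᴴ).trace.re : ℂ)⁻¹ • (X j * (X j)ᴴ) - vecMat t * (vecMat t)ᴴ)) := by
        rw [Finset.sum_sub_distrib, hprob, ← hQ]
        linarith
    _ ≤ ∑ j, ‖∑ x, star (t x) * (N (j, none) *ᵥ v) x‖ ^ 2 :=
        Finset.sum_le_sum fun j _ => by rw [hover]; exact hWX j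
    -- The completing Kraus operators are ignored in the fidelity: they can only increase it.
    _ ≤ _ := by
        rw [Fintype.sum_prod_type]
        refine Finset.sum_le_sum fun j _ => ?_
        rw [Fintype.sum_option]
        exact le_add_of_nonneg_right (Finset.sum_nonneg fun _ _ => by positivity)

end Decoding

end

theorem mainTheorem4 {m : ℕ} {C : Fin m → Type*} [∀ i, Fintype (C i)] [∀ i, DecidableEq (C i)]
    {B R : Type*} [Fintype B] [DecidableEq B] [Fintype R] [DecidableEq R]
    (ψ : EuclideanSpace ℂ ((∀ i, C i) × B × R)) (hψ : ‖ψ‖ = 1)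
    (K L : Fin m → ℕ) (hK : ∀ i, 0 < K i) (hL : ∀ i, 0 < L i) :
    (∀ V : ∀ i, Fin (Fintype.card (C i × Fin (K i)) / L i + 1) →
        Matrix (Fin (L i)) (C i × Fin (K i)) ℂ,
      (∀ i, IsPartialIsometryMeasurement (V i)) →
      Integrable (fun U : ∀ i, Matrix.unitaryGroup (C i × Fin (K i)) ℂ =>
          decouplingError ψ fun i j => SuperOp.kraus (V i j * (U i).1))
        (Measure.pi fun i => haarUnitary (C i × Fin (K i))) ∧
      ∫ U : ∀ i, Matrix.unitaryGroup (C i × Fin (K i)) ℂ,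
          decouplingError ψ (fun i j => SuperOp.kraus (V i j * (U i).1))
        ∂(Measure.pi fun i => haarUnitary (C i × Fin (K i))) ≤ mergingBound ψ K L) ∧
    ∃ A : ∀ i, Fin (Fintype.card (C i × Fin (K i)) / L i + 1) →
        Matrix (Fin (L i)) (C i × Fin (K i)) ℂ,
      (∀ i, IsPartialIsometryMeasurement (A i)) ∧
      decouplingError ψ (fun i j => SuperOp.kraus (A i j)) ≤ mergingBound ψ K L ∧
      ∃ D : (∀ i, Fin (Fintype.card (C i × Fin (K i)) / L i + 1)) →
          SuperOp (B × (∀ i, Fin (K i))) ((∀ i, Fin (L i)) × (∀ i, C i) × B),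
        IsMergingProtocol ψ (fun i j => SuperOp.kraus (A i j)) D
          (2 * √(mergingBound ψ K L)) := by
  refine ⟨fun V hV => ⟨integrable_decouplingError ψ V, integral_decouplingError_le hψ hK hL V hV⟩,
    ?_⟩
  choose V hV using fun i => exists_isPartialIsometryMeasurement (a := C i × Fin (K i)) (hL i)
  -- Derandomization: some choice of unitaries does not exceed the mean, and rotation preserves
  -- partial-isometry measurements.
  obtain ⟨U, hU⟩ := exists_le_integral (integrable_decouplingError ψ V)
  have hQ := hU.trans (integral_decouplingError_le hψ hK hL V hV)
  have hA : ∀ i, IsPartialIsometryMeasurement fun j => V i j * (U i).1 := fun i =>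
    (hV i).mul_unitary (U i)
  exact ⟨fun i j => V i j * (U i).1, hA, hQ,
    exists_isMergingProtocol hψ hK hL (fun i => (hA i).2.2.2.2) hQ⟩
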